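/- **Theorem (gerbel theories on a given 2-Tate space $\mathbb V$ form a $\mathbb G_m$ 2-gerbe $\mathbb{GERB}_{\mathbb V}$).** Let $k$ be a field, $\mathbb G_m=k^\times$. *Tate spaces.* A 1-Tate space is a Hausdorff, linearly topologized, locally linearly compact $k$-vector space which is first countable and has a lattice (an open linearly compact subspace) of countable codimension. A 2-Tate space is a locally compact object of the category of 1-Tate spaces: an ind-pro-object $\operatorname{colim}_j\lim_i F(i,j)$ given by a diagram of 1-Tate spaces on $I^{op}\times J$ ($I,J$ countable linear orders) with cartesian and cocartesian squares, admissible surjections in the $I$-direction and admissible injections in the $J$-direction; short exact sequences are those represented by levelwise exact sequences of diagrams. It is compact (discrete) if it is isomorphic to a diagram constant in the $J$-direction ($I$-direction). A lattice in a 2-Tate space $\mathbb V$ is an admissible compact subobject with discrete quotient. For lattices $L_1\subset L_2$ of $\mathbb V$ the quotient $L_2/L_1$ is a 1-Tate space. *Gerbes.* A $\mathbb G_m$-gerbe is a nonempty connected groupoid with identifications $\operatorname{Aut}(A)=\mathbb G_m$ for all objects $A$, compatible with all arrows. Morphisms are functors compatible with the bands, and $\mathcal C\otimes\mathcal D$ is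 the product with band pushed forward along the multiplication $\mathbb G_m\times\mathbb G_m\to\mathbb G_m$. For a 1-Tate space $\mathcal V$, $\mathcal D_{\mathcal V}$ is the gerbe of determinant theories: assignments of a line $\Delta_L$ to every lattice $L\subset\mathcal V$ with isomorphisms $\Delta_{L_1}\otimes\det(L_2/L_1)\to\Delta_{L_2}$ for $L_1\subset L_2$, compatible for $L_1\subset L_2\subset L_3$. *Multiplicative structure.* A multiplicative structure on the determinant gerbes of $\mathbb V$ consists of equivalences of gerbes $\mathcal D_{L_2/L_1}\otimes\mathcal D_{L_3/L_2}\to\mathcal D_{L_3/L_1}$ for lattices $L_1\subset L_2\subset L_3$ of $\mathbb V$, and natural transformations between the two resulting functors $\mathcal D_{L_2/L_1}\otimes\mathcal D_{L_3/L_2}\otimes\mathcal D_{L_4/L_3}\to\mathcal D_{L_4/L_1}$ for $L_1\subset\dots\subset L_4$, such that the cubical diagram commutes for $L_1\subset\dots\subset L_5$. *Gerbel theories.* Relative to a multiplicative structure, a gerbel theory $\mathbb D$ on $\mathbb V$ consists of a $\mathbb G_m$-gerbe $\mathbb D_L$ for every lattice $L$, equivalences of gerbes $\mathbb D_{L_1}\otimes\mathcal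 D_{L_2/L_1}\to\mathbb D_{L_2}$ for $L_1\subset L_2$, and natural transformations between the two resulting functors $\mathbb D_{L_1}\otimes\mathcal D_{L_2/L_1}\otimes\mathcal D_{L_3/L_2}\to\mathbb D_{L_3}$ for $L_1\subset L_2\subset L_3$, such that the cubical diagram commutes for $L_1\subset L_2\subset L_3\subset L_4$. A morphism $\mathbb D\to\mathbb E$ consists of morphisms of gerbes $f_L:\mathbb D_L\to\mathbb E_L$ and natural transformations filling the squares formed with the structure equivalences for $L_1\subset L_2$, compatible with the structure transformations for $L_1\subset L_2\subset L_3$; a 2-morphism consists of natural transformations $f_L\to g_L$ compatible with these fillings. These form a bicategory $\mathbb{GERB}_{\mathbb V}$. *Claim.* For every 2-Tate space $\mathbb V$ a multiplicative structure exists, and for every multiplicative structure $\mathbb{GERB}_{\mathbb V}$ is a 2-gerbe with band $\mathbb G_m$: it is nonempty, all 2-arrows are invertible, every 1-arrow is invertible up to a 2-arrow, there is a 1-arrow between any two objects and a 2-arrow between any two parallel 1-arrows, and there are identifications of the automorphism group of every 1-arrow with $\mathbb G_m$, compatible with 2-arrows and with composition of 1-arrows. -/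

import Mathlib

open CategoryTheory TensorProduct Cardinal

universe u

noncomputable section

namespace Gerbel

/-! ## One-dimensional Tate spaces -/

/-- The subquotient `L₂ / L₁` of a module, used for `L₁ ≤ L₂`.  When the module is topological it
carries the quotient of the subspace topology. -/
abbrev Subquot {k : Type u} [Field k] {V : Type u} [AddCommGroup V] [Module k V]
    (L₁ L₂ : Submodule k V) : Type u :=
  L₂ ⧸ L₁.submoduleOf L₂

/-- Linear compactness (Lefschetz): every family of closed affine subspaces with the finite
intersection property has a common point.  (It is used for Hausdorff linear topologies over the
discrete field `k`.) -/
def LinearlyCompact (k : Type u) [Field k] (V : Type u) [AddCommGroup V] [Module k V]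
    [TopologicalSpace V] : Prop :=
  ∀ S : Set (AffineSubspace k V), (∀ A ∈ S, IsClosed (A : Set V)) →
    (∀ T : Finset (AffineSubspace k V), (T : Set (AffineSubspace k V)) ⊆ S →
      (⋂ A ∈ T, (A : Set V)).Nonempty) →
    (⋂ A ∈ S, (A : Set V)).Nonempty

/-- A lattice of a 1-Tate space: an open linearly compact subspace. -/
def IsTateLattice {k : Type u} [Field k] {V : Type u} [AddCommGroup V] [Module k V]
    [TopologicalSpace V] (L : Submodule k V) : Prop :=
  IsOpen (L : Set V) ∧ LinearlyCompact k L

/-- A (1-)Tate space: a Hausdorff linearly topologized vector space that is locally linearly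
compact; the two countability conditions say that the indexing sets of the corresponding
ind-pro-system of finite-dimensional spaces are countable. -/
structure IsTate (k : Type u) [Field k] (V : Type u) [AddCommGroup V] [Module k V]
    [TopologicalSpace V] : Prop where
  topAddGroup : IsTopologicalAddGroup V
  linear : IsLinearTopology k V
  t2 : T2Space V
  firstCountable : FirstCountableTopology V
  exists_lattice : ∃ L : Submodule k V, IsTateLattice L ∧ Module.rank k (V ⧸ L) ≤ ℵ₀

/-- The set of lattices of a 1-Tate space, ordered by inclusion. -/
abbrev TateLattice (k : Type u) [Field k] (V : Type u) [AddCommGroup V] [Module k V]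
    [TopologicalSpace V] : Type u :=
  {L : Submodule k V // IsTateLattice L}

/-- Successive quotients of lattices are finite-dimensional. -/
theorem finite_subquot {k : Type u} [Field k] {V : Type u} [AddCommGroup V] [Module k V]
    [TopologicalSpace V] {L₁ L₂ : Submodule k V} (h₁ : IsOpen (L₁ : Set V))
    (hadd : IsTopologicalAddGroup V)
    (h₂ : LinearlyCompact k L₂) : Module.Finite k (Subquot L₁ L₂) := by
  classical
  let q : L₂ →ₗ[k] Subquot L₁ L₂ := (L₁.submoduleOf L₂).mkQ
  have hopen : IsOpen ((L₁.submoduleOf L₂ : Submodule k L₂) : Set L₂) :=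
    h₁.preimage continuous_subtype_val
  have hdisc : DiscreteTopology (Subquot L₁ L₂) :=
    QuotientAddGroup.discreteTopology hopen
  have hq : Continuous q := continuous_quotient_mk'
  let b := Module.Basis.ofVectorSpace k (Subquot L₁ L₂)
  let A : _ → AffineSubspace k L₂ := fun i =>
    (AffineSubspace.mk' (b i) (LinearMap.ker (b.coord i))).comap q.toAffineMap
  have hA : ∀ i x, x ∈ A i ↔ b.coord i (q x) = 1 := by
    intro i x
    simp only [A, AffineSubspace.mem_comap, AffineSubspace.mem_mk', LinearMap.mem_ker]
    simp [sub_eq_zero]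
  obtain ⟨x, hx⟩ := h₂ (Set.range A)
    (by
      rintro _ ⟨i, rfl⟩
      have : (A i : Set L₂) = q ⁻¹' {y | b.coord i y = 1} := by
        ext x; exact hA i x
      rw [this]
      exact (isClosed_discrete _).preimage hq)
    (by
      intro T hT
      have hc : ∀ B ∈ T, ∃ i, A i = B := fun B hB => hT hB
      let s : Finset _ := T.attach.image fun B => (hc B.1 B.2).choose
      obtain ⟨x, hx⟩ := (L₁.submoduleOf L₂).mkQ_surjective (∑ i ∈ s, b i)
      refine ⟨x, ?_⟩
      simp only [Set.mem_iInter]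
      intro B hB
      have e := (hc B hB).choose_spec
      rw [← e]
      refine (hA _ _).2 ?_
      have hs : (hc B hB).choose ∈ s :=
        Finset.mem_image.2 ⟨⟨B, hB⟩, Finset.mem_attach _ _, rfl⟩
      change b.coord _ ((L₁.submoduleOf L₂).mkQ x) = 1
      rw [hx, map_sum]
      rw [Finset.sum_eq_single_of_mem _ hs]
      · simp
      · intro j _ hj
        simp [hj])
  have hall : ∀ i, b.coord i (q x) = 1 := fun i => (hA i x).1 (by
    have := Set.mem_iInter₂.1 hx (A i) ⟨i, rfl⟩
    exact this)
  have hfin : Finite (Module.Basis.ofVectorSpaceIndex k (Subquot L₁ L₂)) := by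
    have : (Set.univ : Set (Module.Basis.ofVectorSpaceIndex k (Subquot L₁ L₂))) ⊆
        ((b.repr (q x)).support : Set _) := by
      intro i _
      have := hall i
      simp only [Module.Basis.coord_apply] at this
      simp [this]
    exact Set.finite_univ_iff.1 ((Finset.finite_toSet _).subset this)
  exact Module.Finite.of_basis b

/-- The map `L₂ / L₁ → L₃ / L₁` for `L₂ ≤ L₃`. -/
def Subquot.incl {k : Type u} [Field k] {V : Type u} [AddCommGroup V] [Module k V]
    (L₁ : Submodule k V) {L₂ L₃ : Submodule k V} (h : L₂ ≤ L₃) :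
    Subquot L₁ L₂ →ₗ[k] Subquot L₁ L₃ :=
  Submodule.mapQ _ _ (Submodule.inclusion h) (fun _ hx => hx)

/-- The map `L₃ / L₁ → L₃ / L₂` for `L₁ ≤ L₂`. -/
def Subquot.proj {k : Type u} [Field k] {V : Type u} [AddCommGroup V] [Module k V]
    {L₁ L₂ : Submodule k V} (h : L₁ ≤ L₂) (L₃ : Submodule k V) :
    Subquot L₁ L₃ →ₗ[k] Subquot L₂ L₃ :=
  Submodule.mapQ _ _ LinearMap.id (fun _ hx => h hx)

theorem Subquot.finrank_add {k : Type u} [Field k] {V : Type u} [AddCommGroup V] [Module k V]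
    {L₁ L₂ L₃ : Submodule k V} (h₁₂ : L₁ ≤ L₂) (h₂₃ : L₂ ≤ L₃)
    (hfin : Module.Finite k (Subquot L₁ L₃)) :
    Module.finrank k (Subquot L₁ L₃) =
      Module.finrank k (Subquot L₁ L₂) + Module.finrank k (Subquot L₂ L₃) := by
  have hp : Function.Surjective (Subquot.proj h₁₂ L₃) := by
    intro y
    obtain ⟨y, rfl⟩ := Submodule.mkQ_surjective _ y
    exact ⟨Submodule.Quotient.mk y, rfl⟩
  have hi : Function.Injective (Subquot.incl L₁ h₂₃) := by
    rw [injective_iff_map_eq_zero]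
    intro y hy
    obtain ⟨y, rfl⟩ := Submodule.mkQ_surjective _ y
    have hy' : (y : V) ∈ L₁ := (Submodule.Quotient.mk_eq_zero (L₁.submoduleOf L₃)).1 hy
    exact (Submodule.Quotient.mk_eq_zero _).2 hy'
  have hex : LinearMap.range (Subquot.incl L₁ h₂₃) = LinearMap.ker (Subquot.proj h₁₂ L₃) := by
    ext y
    obtain ⟨y, rfl⟩ := Submodule.mkQ_surjective _ y
    constructor
    · rintro ⟨z, hz⟩
      obtain ⟨z, rfl⟩ := Submodule.mkQ_surjective _ z
      rw [← hz]
      exact (Submodule.Quotient.mk_eq_zero _).2 z.2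
    · intro hy
      have : (y : V) ∈ L₂ := (Submodule.Quotient.mk_eq_zero (L₂.submoduleOf L₃)).1 hy
      exact ⟨Submodule.Quotient.mk ⟨y, this⟩, rfl⟩
  have h := LinearMap.finrank_range_add_finrank_ker (Subquot.proj h₁₂ L₃)
  rw [LinearMap.range_eq_top.2 hp, finrank_top, ← hex, LinearMap.finrank_range_of_inj hi] at h
  omega

/-- Additivity of dimensions for lattices of a 1-Tate space. -/
theorem TateLattice.finrank_add {k : Type u} [Field k] {V : Type u} [AddCommGroup V] [Module k V]
    [TopologicalSpace V] [IsTopologicalAddGroup V] {L₁ L₂ L₃ : TateLattice k V} (h₁₂ : L₁ ≤ L₂)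
    (h₂₃ : L₂ ≤ L₃) :
    Module.finrank k (Subquot L₁.1 L₃.1) =
      Module.finrank k (Subquot L₁.1 L₂.1) + Module.finrank k (Subquot L₂.1 L₃.1) :=
  Subquot.finrank_add h₁₂ h₂₃ (finite_subquot L₁.2.1 inferInstance L₃.2.2)

/-- The determinant line of a finite-dimensional space: its top exterior power. -/
abbrev Det (k : Type u) [Field k] (W : Type u) [AddCommGroup W] [Module k W] : Type u :=
  ⋀[k]^(Module.finrank k W) W

/-- The wedge `w₁ ∧ ⋯ ∧ wₙ` of `n = dim W` vectors, in `Det W`. -/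
def wedge {k : Type u} [Field k] {W : Type u} [AddCommGroup W] [Module k W] {n : ℕ}
    (h : Module.finrank k W = n) (w : Fin n → W) : Det k W :=
  exteriorPower.ιMulti k (Module.finrank k W) (w ∘ Fin.cast h)

/-! ## Banded groupoids and gerbes -/

/-- A groupoid with a central action of `kˣ` by automorphisms of its objects. -/
structure BandedGroupoid (k : Type u) [Field k] where
  carrier : Type (u + 1)
  [grpd : Groupoid.{u} carrier]
  sc : ∀ A : carrier, kˣ → (A ⟶ A)
  sc_one : ∀ A, sc A 1 = 𝟙 A
  sc_mul : ∀ A c d, sc A (c * d) = sc A c ≫ sc A d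
  sc_comm : ∀ {A B : carrier} (f : A ⟶ B) (c : kˣ), sc A c ≫ f = f ≫ sc B c

attribute [instance] BandedGroupoid.grpd

instance (k : Type u) [Field k] : CoeSort (BandedGroupoid k) (Type (u + 1)) :=
  ⟨BandedGroupoid.carrier⟩

/-- A `𝔾ₘ`-gerbe (over a point): a nonempty connected groupoid in which the automorphism group of
every object is identified with `kˣ`, compatibly with all arrows. -/
structure BandedGroupoid.IsGerbe {k : Type u} [Field k] (G : BandedGroupoid k) : Prop where
  nonempty : Nonempty G
  connected : ∀ A B : G, Nonempty (A ⟶ B)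
  band : ∀ A : G, Function.Bijective (G.sc A)

/-- Morphisms of banded groupoids: functors compatible with the bands. -/
structure BandedFunctor {k : Type u} [Field k] (G H : BandedGroupoid k) where
  functor : G.carrier ⥤ H.carrier
  map_sc : ∀ (A : G) (c : kˣ), functor.map (G.sc A c) = H.sc (functor.obj A) c

attribute [simp] BandedFunctor.map_sc

namespace BandedFunctor

variable {k : Type u} [Field k]

/-- The identity functor. -/
abbrev id (G : BandedGroupoid k) : BandedFunctor G G where
  functor := 𝟭 _
  map_sc _ _ := rfl

/-- Composition of band-preserving functors. -/
abbrev comp {G H K : BandedGroupoid k} (F : BandedFunctor G H) (F' : BandedFunctor H K) :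
    BandedFunctor G K where
  functor := F.functor ⋙ F'.functor
  map_sc A c := by simp

end BandedFunctor

/-! ### The tensor product of gerbes -/

section Tensor

variable {k : Type u} [Field k]

/-- Objects of the tensor product `G ⊗ H`: pairs of objects. -/
@[ext] structure TensorObj (G H : BandedGroupoid k) : Type (u + 1) where
  fst : G
  snd : H

/-- The relation `(f c, g) ∼ (f, g c)` on pairs of arrows. -/
def tensorSetoid {G H : BandedGroupoid k} (P Q : TensorObj G H) :
    Setoid ((P.fst ⟶ Q.fst) × (P.snd ⟶ Q.snd)) where
  r x y := ∃ c : kˣ, y.1 = x.1 ≫ G.sc _ c ∧ x.2 = y.2 ≫ H.sc _ c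
  iseqv :=
    { refl := fun x => ⟨1, by simp [G.sc_one], by simp [H.sc_one]⟩
      symm := by
        rintro ⟨f, g⟩ ⟨f', g'⟩ ⟨c, h₁, h₂⟩
        dsimp only at h₁ h₂
        subst h₁ h₂
        refine ⟨c⁻¹, ?_, ?_⟩
        · simp [← G.sc_mul, G.sc_one]
        · simp [← H.sc_mul, H.sc_one]
      trans := by
        rintro ⟨f, g⟩ ⟨f', g'⟩ ⟨f'', g''⟩ ⟨c, h₁, h₂⟩ ⟨d, h₃, h₄⟩
        dsimp only at h₁ h₂ h₃ h₄
        subst h₁ h₄ h₃ h₂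
        refine ⟨c * d, ?_, ?_⟩
        · simp [G.sc_mul]
        · simp [mul_comm c d, H.sc_mul] }

/-- Arrows of `G ⊗ H`: the contracted product of the arrows of `G` and of `H` over `kˣ`. -/
def TensorHom {G H : BandedGroupoid k} (P Q : TensorObj G H) : Type u :=
  Quotient (tensorSetoid P Q)

/-- The class `f ⊗ g` of a pair of arrows. -/
def TensorHom.mk {G H : BandedGroupoid k} {P Q : TensorObj G H} (f : P.fst ⟶ Q.fst)
    (g : P.snd ⟶ Q.snd) : TensorHom P Q :=
  Quotient.mk (tensorSetoid P Q) (f, g)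

theorem TensorHom.exists_rep {G H : BandedGroupoid k} {P Q : TensorObj G H}
    (x : TensorHom P Q) : ∃ f g, x = TensorHom.mk f g := by
  induction x using Quotient.ind with
  | _ y => exact ⟨y.1, y.2, rfl⟩

theorem TensorHom.sound {G H : BandedGroupoid k} {P Q : TensorObj G H} (f : P.fst ⟶ Q.fst)
    (g : P.snd ⟶ Q.snd) (c : kˣ) :
    TensorHom.mk (P := P) (Q := Q) (f ≫ G.sc _ c) g = TensorHom.mk f (g ≫ H.sc _ c) :=
  (Quotient.sound (s := tensorSetoid P Q) ⟨c, rfl, rfl⟩).symm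

/-- Maps out of the arrows of `G ⊗ H`. -/
def TensorHom.lift {G H : BandedGroupoid k} {P Q : TensorObj G H} {T : Type*}
    (F : (P.fst ⟶ Q.fst) → (P.snd ⟶ Q.snd) → T)
    (hF : ∀ f g c, F (f ≫ G.sc _ c) g = F f (g ≫ H.sc _ c)) : TensorHom P Q → T :=
  Quotient.lift (fun x => F x.1 x.2) (by
    rintro ⟨f, g⟩ ⟨f', g'⟩ ⟨c, h₁, h₂⟩
    dsimp only at h₁ h₂ ⊢
    subst h₁ h₂
    exact (hF _ _ _).symm)

@[simp] theorem TensorHom.lift_mk {G H : BandedGroupoid k} {P Q : TensorObj G H} {T : Type*}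
    (F : (P.fst ⟶ Q.fst) → (P.snd ⟶ Q.snd) → T)
    (hF : ∀ f g c, F (f ≫ G.sc _ c) g = F f (g ≫ H.sc _ c)) (f : P.fst ⟶ Q.fst)
    (g : P.snd ⟶ Q.snd) : TensorHom.lift F hF (TensorHom.mk f g) = F f g := rfl

/-- Composition of arrows of `G ⊗ H`, componentwise. -/
def TensorHom.comp {G H : BandedGroupoid k} {P Q R : TensorObj G H} (x : TensorHom P Q)
    (y : TensorHom Q R) : TensorHom P R :=
  TensorHom.lift (fun f g => TensorHom.lift
      (fun f' g' => TensorHom.mk (P := P) (Q := R) (f ≫ f') (g ≫ g'))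
      (fun f' g' c => by simpa using TensorHom.sound (P := P) (Q := R) (f ≫ f') (g ≫ g') c) y)
    (fun f g c => by
      obtain ⟨f', g', rfl⟩ := TensorHom.exists_rep y
      simpa [G.sc_comm, H.sc_comm] using
        TensorHom.sound (P := P) (Q := R) (f ≫ f') (g ≫ g') c) x

/-- Inverses of arrows of `G ⊗ H`, componentwise. -/
def TensorHom.inv {G H : BandedGroupoid k} {P Q : TensorObj G H} (x : TensorHom P Q) :
    TensorHom Q P :=
  TensorHom.lift (fun f g => TensorHom.mk (P := Q) (Q := P) (Groupoid.inv f) (Groupoid.inv g))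
    (fun f g c => by
      have e₁ : Groupoid.inv (f ≫ G.sc _ c) = Groupoid.inv f ≫ G.sc _ c⁻¹ := by
        rw [← cancel_epi (f ≫ G.sc _ c), Groupoid.comp_inv, Category.assoc,
          G.sc_comm, Category.assoc, ← G.sc_mul]
        simp [G.sc_one]
      have e₂ : Groupoid.inv g = Groupoid.inv (g ≫ H.sc _ c) ≫ H.sc _ c := by
        rw [← cancel_epi (g ≫ H.sc _ c), ← Category.assoc (g ≫ H.sc _ c), Groupoid.comp_inv,
          Category.assoc, H.sc_comm]
        simp
      rw [e₁, e₂, ← TensorHom.sound]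
      simp [← G.sc_mul, G.sc_one]) x

instance (G H : BandedGroupoid k) : Groupoid.{u} (TensorObj G H) where
  Hom := TensorHom
  id P := TensorHom.mk (𝟙 P.fst) (𝟙 P.snd)
  comp := TensorHom.comp
  id_comp x := by
    obtain ⟨f, g, rfl⟩ := TensorHom.exists_rep x
    simp [TensorHom.comp]
  comp_id x := by
    obtain ⟨f, g, rfl⟩ := TensorHom.exists_rep x
    simp [TensorHom.comp]
  assoc x y z := by
    obtain ⟨f, g, rfl⟩ := TensorHom.exists_rep x
    obtain ⟨f', g', rfl⟩ := TensorHom.exists_rep y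
    obtain ⟨f'', g'', rfl⟩ := TensorHom.exists_rep z
    simp [TensorHom.comp]
  inv := TensorHom.inv
  inv_comp x := by
    obtain ⟨f, g, rfl⟩ := TensorHom.exists_rep x
    simp [TensorHom.comp, TensorHom.inv]
  comp_inv x := by
    obtain ⟨f, g, rfl⟩ := TensorHom.exists_rep x
    simp [TensorHom.comp, TensorHom.inv]

/-- The object `A ⊗ B` of `G ⊗ H`. -/
abbrev tobj {G H : BandedGroupoid k} (A : G) (B : H) : TensorObj G H := ⟨A, B⟩

/-- The arrow `f ⊗ g` of `G ⊗ H`. -/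
def thom {G H : BandedGroupoid k} {A A' : G} {B B' : H} (f : A ⟶ A') (g : B ⟶ B') :
    tobj A B ⟶ tobj A' B' :=
  TensorHom.mk (P := tobj A B) (Q := tobj A' B') f g

theorem thom_exists_rep {G H : BandedGroupoid k} {P Q : TensorObj G H} (x : P ⟶ Q) :
    ∃ (f : P.fst ⟶ Q.fst) (g : P.snd ⟶ Q.snd), x = thom f g :=
  TensorHom.exists_rep x

@[simp]
theorem thom_comp {G H : BandedGroupoid k} {A A' A'' : G} {B B' B'' : H} (f : A ⟶ A')
    (g : B ⟶ B') (f' : A' ⟶ A'') (g' : B' ⟶ B'') :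
    thom f g ≫ thom f' g' = thom (f ≫ f') (g ≫ g') := rfl

theorem tobj_id {G H : BandedGroupoid k} (A : G) (B : H) : 𝟙 (tobj A B) = thom (𝟙 A) (𝟙 B) := rfl

theorem thom_sc {G H : BandedGroupoid k} {A A' : G} {B B' : H} (f : A ⟶ A') (g : B ⟶ B')
    (c : kˣ) : thom (f ≫ G.sc _ c) g = thom f (g ≫ H.sc _ c) :=
  TensorHom.sound (P := tobj A B) (Q := tobj A' B') f g c

/-- The tensor product of banded groupoids (of `𝔾ₘ`-gerbes): the product with its band pushed
forward along the multiplication `kˣ × kˣ → kˣ`. -/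
def tensor (G H : BandedGroupoid k) : BandedGroupoid k where
  carrier := TensorObj G H
  sc P c := thom (G.sc P.fst c) (𝟙 P.snd)
  sc_one P := by rw [G.sc_one]; rfl
  sc_mul P c d := by rw [thom_comp, G.sc_mul, Category.comp_id]
  sc_comm {P Q} x c := by
    obtain ⟨f, g, rfl⟩ := thom_exists_rep x
    change thom _ _ ≫ thom f g = thom f g ≫ thom _ _
    rw [thom_comp, thom_comp, G.sc_comm, Category.id_comp, Category.comp_id]

/-- The value `F (A ⊗ B)` of a functor `F` on `G ⊗ H`. -/
def BandedFunctor.obj₂ {G H K : BandedGroupoid k} (F : BandedFunctor (tensor G H) K) (A : G)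
    (B : H) : K :=
  F.functor.obj (tobj A B)

/-- The value `F (a ⊗ b)` of a functor `F` on `G ⊗ H`. -/
def BandedFunctor.map₂ {G H K : BandedGroupoid k} (F : BandedFunctor (tensor G H) K) {A A' : G}
    {B B' : H} (a : A ⟶ A') (b : B ⟶ B') : F.obj₂ A B ⟶ F.obj₂ A' B' :=
  F.functor.map (X := tobj A B) (Y := tobj A' B') (thom a b)

theorem BandedFunctor.map₂_id {G H K : BandedGroupoid k} (F : BandedFunctor (tensor G H) K)
    (A : G) (B : H) : F.map₂ (𝟙 A) (𝟙 B) = 𝟙 (F.obj₂ A B) :=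
  F.functor.map_id (tobj A B)

theorem BandedFunctor.map₂_comp {G H K : BandedGroupoid k} (F : BandedFunctor (tensor G H) K)
    {A A' A'' : G} {B B' B'' : H} (a : A ⟶ A') (a' : A' ⟶ A'') (b : B ⟶ B') (b' : B' ⟶ B'') :
    F.map₂ (a ≫ a') (b ≫ b') = F.map₂ a b ≫ F.map₂ a' b' :=
  F.functor.map_comp (X := tobj A B) (Y := tobj A' B') (Z := tobj A'' B'') (thom a b) (thom a' b')

theorem BandedFunctor.map₂_comp_id {G H K : BandedGroupoid k} (F : BandedFunctor (tensor G H) K)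
    {A A' A'' : G} (a : A ⟶ A') (a' : A' ⟶ A'') (B : H) :
    F.map₂ (a ≫ a') (𝟙 B) = F.map₂ a (𝟙 B) ≫ F.map₂ a' (𝟙 B) := by
  rw [← F.map₂_comp, Category.comp_id]

end Tensor

/-! ## The determinant gerbe of a 1-Tate space -/

section DetTheory

variable (k : Type u) [Field k] (V : Type u) [AddCommGroup V] [Module k V] [TopologicalSpace V]
  [IsTopologicalAddGroup V]

/-- A determinant theory on a 1-Tate space `V`: a one-dimensional space `Δ_L` for each lattice
`L` and isomorphisms `Δ_{L₁} ⊗ Det (L₂ / L₁) → Δ_{L₂}` for `L₁ ≤ L₂`, compatible with the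
isomorphisms `Det (L₂ / L₁) ⊗ Det (L₃ / L₂) → Det (L₃ / L₁)`,
`(a₁ ∧ ⋯ ∧ aₚ) ⊗ (b̄₁ ∧ ⋯ ∧ b̄_q) ↦ a₁ ∧ ⋯ ∧ aₚ ∧ b₁ ∧ ⋯ ∧ b_q`. -/
structure DetTheory where
  Δ : TateLattice k V → ModuleCat.{u} k
  finrank_eq_one : ∀ L, Module.finrank k (Δ L) = 1
  iso : ∀ {L₁ L₂ : TateLattice k V}, L₁ ≤ L₂ →
    (Δ L₁ ⊗[k] Det k (Subquot L₁.1 L₂.1)) ≃ₗ[k] Δ L₂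
  coherence : ∀ {L₁ L₂ L₃ : TateLattice k V} (h₁₂ : L₁ ≤ L₂)
    (h₂₃ : L₂ ≤ L₃) (x : Δ L₁)
    (a : Fin (Module.finrank k (Subquot L₁.1 L₂.1)) → Subquot L₁.1 L₂.1)
    (b : Fin (Module.finrank k (Subquot L₂.1 L₃.1)) → Subquot L₁.1 L₃.1),
    iso h₂₃ (iso h₁₂ (x ⊗ₜ wedge rfl a) ⊗ₜ wedge rfl (Subquot.proj h₁₂ L₃.1 ∘ b)) =
      iso (h₁₂.trans h₂₃) (x ⊗ₜ wedge (TateLattice.finrank_add h₁₂ h₂₃)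
        (Fin.append (Subquot.incl L₁.1 h₂₃ ∘ a) b))

variable {k V}

/-- Morphisms of determinant theories. -/
@[ext] structure DetTheory.Hom (Δ Δ' : DetTheory k V) where
  app : ∀ L, Δ.Δ L ≃ₗ[k] Δ'.Δ L
  comm : ∀ {L₁ L₂ : TateLattice k V} (h : L₁ ≤ L₂) (x : Δ.Δ L₁) (d : Det k (Subquot L₁.1 L₂.1)),
    app L₂ (Δ.iso h (x ⊗ₜ d)) = Δ'.iso h (app L₁ x ⊗ₜ d)

instance : Groupoid.{u} (DetTheory k V) where
  Hom := DetTheory.Hom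
  id Δ := ⟨fun _ => LinearEquiv.refl k _, fun _ _ _ => rfl⟩
  comp f g := ⟨fun L => (f.app L).trans (g.app L), fun h x d => by
    simp [f.comm h x d, g.comm h (f.app _ x) d]⟩
  inv f := ⟨fun L => (f.app L).symm, fun h x d => by
    rw [LinearEquiv.symm_apply_eq, f.comm, LinearEquiv.apply_symm_apply]⟩
  id_comp _ := rfl
  comp_id _ := rfl
  assoc _ _ _ := rfl
  inv_comp f := DetTheory.Hom.ext (funext fun L => (f.app L).symm_trans_self)
  comp_inv f := DetTheory.Hom.ext (funext fun L => (f.app L).self_trans_symm)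

variable (k V)

/-- The determinant gerbe `𝒟_V` of a 1-Tate space: the groupoid of determinant theories, with
`kˣ` acting by scalars. -/
def detGerbe : BandedGroupoid k where
  carrier := DetTheory k V
  sc Δ c := DetTheory.Hom.mk (fun L => LinearEquiv.smulOfUnit c) (fun h x d => by
    change (c : k) • Δ.iso h (x ⊗ₜ d) = Δ.iso h (((c : k) • x) ⊗ₜ d)
    rw [← LinearEquiv.map_smul, TensorProduct.smul_tmul'])
  sc_one Δ := DetTheory.Hom.ext (funext fun L => LinearEquiv.ext fun x => one_smul _ x)
  sc_mul Δ c d := DetTheory.Hom.ext (funext fun L => LinearEquiv.ext fun x => by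
    change (c * d) • x = d • (c • x)
    rw [mul_comm, mul_smul])
  sc_comm {Δ Δ'} f c := DetTheory.Hom.ext (funext fun L => LinearEquiv.ext fun x => by
    change f.app L (c • x) = c • f.app L x
    exact (f.app L).map_smul (c : k) x)

end DetTheory

/-! ## Two-dimensional Tate spaces

A locally compact object of the category of 1-Tate spaces is a diagram `F(i, j)` of 1-Tate spaces
indexed by `Iᵒᵖ × J`, with `I`, `J` countable linear orders, whose squares are cartesian and
cocartesian, with admissible surjections in the `I`-direction and admissible injections in the
`J`-direction; it stands for the object `colim_j lim_i F(i, j)` of `Ind (Pro (Tate))`.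

All transition maps being surjective, resp. injective, and `I`, `J` being countable, such a diagram
is the same as its realization `V = colim_j lim_i F(i, j) = lim_i colim_j F(i, j)` together with the
subspaces `U j = lim_i F(i, j)` and `W i = ker (U j → F(i, j))` (which does not depend on `j`), so
that `F(i, j) = U j / W i`.  The topologies of the `F(i, j)` are recorded by the
linear topology of `V` as the limit over `i` of the linear colimits over `j` of the `F(i, j)`. -/

section TwoTate

variable (k : Type u) [Field k]

/-- A presentation of a linearly topologized vector space `V` as the realization of an
ind-pro-system `F(i, j) = U j / W i` of 1-Tate spaces, indexed by `Iᵒᵖ × J`. -/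
structure Presentation (V : Type u) [AddCommGroup V] [Module k V] [TopologicalSpace V]
    (I J : Type) [LinearOrder I] [LinearOrder J] where
  W : I → Submodule k V
  U : J → Submodule k V
  countable_I : Countable I
  countable_J : Countable J
  nonempty_I : Nonempty I
  nonempty_J : Nonempty J
  W_antitone : Antitone W
  U_monotone : Monotone U
  W_le_U : ∀ i j, W i ≤ U j
  /-- the spaces `F(i, j)` are 1-Tate spaces -/
  isTate : ∀ i j, IsTate k (Subquot (W i) (U j))
  /-- `F(i, j) → F(i, j')` is an admissible (closed) embedding -/
  isClosed_U : ∀ j, IsClosed (U j : Set V)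
  /-- `V` is the union of the `U j` -/
  exists_mem_U : ∀ x, ∃ j, x ∈ U j
  /-- `U j` is the limit of the `U j / W i`: uniqueness -/
  eq_zero : ∀ x, (∀ i, x ∈ W i) → x = 0
  /-- `U j` is the limit of the `U j / W i`: existence -/
  complete : ∀ (j : J) (x : I → V), (∀ i, x i ∈ U j) → (∀ i i', i ≤ i' → x i' - x i ∈ W i) →
    ∃ y ∈ U j, ∀ i, y - x i ∈ W i
  /-- `V` carries the topology of `lim_i colim_j F(i, j)`, as a linearly topologized space -/
  isOpen_iff : ∀ N : Submodule k V, IsOpen (N : Set V) ↔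
    (∃ i, W i ≤ N) ∧ ∀ j, IsOpen ((↑) ⁻¹' (N : Set V) : Set (U j))

/-- A 2-Tate space over `k`. -/
structure TwoTate where
  carrier : Type u
  [addCommGroup : AddCommGroup carrier]
  [module : Module k carrier]
  [topologicalSpace : TopologicalSpace carrier]
  [topAddGroup : IsTopologicalAddGroup carrier]
  [linear : IsLinearTopology k carrier]
  I : Type
  J : Type
  [linearOrderI : LinearOrder I]
  [linearOrderJ : LinearOrder J]
  pres : Presentation k carrier I J

attribute [instance] TwoTate.addCommGroup TwoTate.module TwoTate.topologicalSpace
  TwoTate.topAddGroup TwoTate.linear TwoTate.linearOrderI TwoTate.linearOrderJ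

instance : CoeSort (TwoTate k) (Type u) := ⟨TwoTate.carrier⟩

variable {k}

/-- A morphism of 2-Tate spaces, i.e. an element of
`lim_j colim_j' lim_i' colim_i Hom (F(i, j), F'(i', j'))`, seen on realizations: a continuous
linear map that is compatible with the two filtrations. -/
structure TwoTate.Hom (X Y : TwoTate k) where
  map : X →L[k] Y
  map_U : ∀ j, ∃ j', X.pres.U j ≤ (Y.pres.U j').comap map.toLinearMap
  map_W : ∀ i', ∃ i, X.pres.W i ≤ (Y.pres.W i').comap map.toLinearMap

/-- Two presentations of the same space define isomorphic ind-pro-objects (through the identity)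
when their filtrations are cofinal in each other. -/
def Presentation.Equivalent {V : Type u} [AddCommGroup V] [Module k V] [TopologicalSpace V]
    {I J I' J' : Type} [LinearOrder I] [LinearOrder J] [LinearOrder I'] [LinearOrder J']
    (P : Presentation k V I J) (P' : Presentation k V I' J') : Prop :=
  (∀ i, ∃ i', P'.W i' ≤ P.W i) ∧ (∀ i', ∃ i, P.W i ≤ P'.W i') ∧
    (∀ j, ∃ j', P.U j ≤ P'.U j') ∧ (∀ j', ∃ j, P'.U j' ≤ P.U j)

/-- The map on subquotients induced by a linear map. -/
def Subquot.map {V V' : Type u} [AddCommGroup V] [Module k V] [AddCommGroup V'] [Module k V']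
    (f : V →ₗ[k] V') {L₁ L₂ : Submodule k V} {L₁' L₂' : Submodule k V'}
    (h₁ : L₁ ≤ L₁'.comap f) (h₂ : L₂ ≤ L₂'.comap f) : Subquot L₁ L₂ →ₗ[k] Subquot L₁' L₂' :=
  Submodule.mapQ _ _ (f.restrict h₂) (fun _ hx => h₁ hx)

/-- Admissible short exact sequences `0 → A → B → C → 0` of 1-Tate spaces: short exact sequences
with `A → B` a closed embedding and `B → C` an open quotient map. -/
def IsTateExact {A B C : Type u} [AddCommGroup A] [Module k A] [TopologicalSpace A]
    [AddCommGroup B] [Module k B] [TopologicalSpace B] [AddCommGroup C] [Module k C]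
    [TopologicalSpace C] (f : A →ₗ[k] B) (g : B →ₗ[k] C) : Prop :=
  Topology.IsClosedEmbedding f ∧ IsOpenQuotientMap g ∧ Function.Exact f g

/-- A sequence of morphisms of presentations over the same index sets that is levelwise an
admissible short exact sequence of 1-Tate spaces. -/
def Presentation.IsLevelExact {K V Q : Type u} [AddCommGroup K] [Module k K] [TopologicalSpace K]
    [AddCommGroup V] [Module k V] [TopologicalSpace V] [AddCommGroup Q] [Module k Q]
    [TopologicalSpace Q] {I J : Type} [LinearOrder I] [LinearOrder J]
    (PK : Presentation k K I J) (PV : Presentation k V I J) (PQ : Presentation k Q I J)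
    (f : K →ₗ[k] V) (g : V →ₗ[k] Q) : Prop :=
  ∀ i j, ∃ (fW : PK.W i ≤ (PV.W i).comap f) (fU : PK.U j ≤ (PV.U j).comap f)
    (gW : PV.W i ≤ (PQ.W i).comap g) (gU : PV.U j ≤ (PQ.U j).comap g),
    IsTateExact (Subquot.map f fW fU) (Subquot.map g gW gU)

/-- Admissible short exact sequences of 2-Tate spaces: those that can be represented by a levelwise
exact sequence of diagrams. -/
def TwoTate.IsExact {X Y Z : TwoTate k} (f : TwoTate.Hom X Y) (g : TwoTate.Hom Y Z) : Prop :=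
  ∃ (I J : Type) (_ : LinearOrder I) (_ : LinearOrder J) (PX : Presentation k X I J)
    (PY : Presentation k Y I J) (PZ : Presentation k Z I J),
    X.pres.Equivalent PX ∧ Y.pres.Equivalent PY ∧ Z.pres.Equivalent PZ ∧
      PX.IsLevelExact PY PZ f.map.toLinearMap g.map.toLinearMap

/-- A compact object: it has a presentation that is constant in the ind-direction. -/
def TwoTate.IsCompactObject (X : TwoTate k) : Prop :=
  ∃ (I J : Type) (_ : LinearOrder I) (_ : LinearOrder J) (P : Presentation k X I J),
    X.pres.Equivalent P ∧ ∀ j j', P.U j = P.U j'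

/-- A discrete object: it has a presentation that is constant in the pro-direction. -/
def TwoTate.IsDiscreteObject (X : TwoTate k) : Prop :=
  ∃ (I J : Type) (_ : LinearOrder I) (_ : LinearOrder J) (P : Presentation k X I J),
    X.pres.Equivalent P ∧ ∀ i i', P.W i = P.W i'

/-- A lattice of a 2-Tate space: an admissible compact subobject with discrete quotient. -/
def TwoTate.IsLattice (X : TwoTate k) (L : Submodule k X) : Prop :=
  ∃ (K Q : TwoTate k) (f : TwoTate.Hom K X) (g : TwoTate.Hom X Q), TwoTate.IsExact f g ∧
    K.IsCompactObject ∧ Q.IsDiscreteObject ∧ LinearMap.range f.map.toLinearMap = L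

/-- The set of lattices of a 2-Tate space, ordered by inclusion. -/
abbrev TwoTate.Lattice (X : TwoTate k) : Type u := {L : Submodule k X // X.IsLattice L}

/-- The determinant gerbe `𝒟_{L₂ / L₁}` of the 1-Tate space `L₂ / L₁`, for lattices `L₁ ≤ L₂`. -/
abbrev TwoTate.det {X : TwoTate k} (L₁ L₂ : X.Lattice) : BandedGroupoid k :=
  detGerbe k (Subquot L₁.1 L₂.1)

end TwoTate

/-! ## Gerbel theories -/

section GerbelTheory

variable {k : Type u} [Field k]

/-- The multiplicative structure of the determinant gerbes of the subquotients of a 2-Tate space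
used in the definition of gerbel theories: equivalences of gerbes
`μ : 𝒟_{L₂/L₁} ⊗ 𝒟_{L₃/L₂} → 𝒟_{L₃/L₁}` for `L₁ ≤ L₂ ≤ L₃`, natural transformations `α` between the
two resulting functors `𝒟_{L₂/L₁} ⊗ 𝒟_{L₃/L₂} ⊗ 𝒟_{L₄/L₃} → 𝒟_{L₄/L₁}` for `L₁ ≤ ⋯ ≤ L₄`, such
that the cubical diagram of natural transformations commutes for `L₁ ≤ ⋯ ≤ L₅`.  (All arrows of a
tensor product are of the form `a ⊗ b`, so naturality is stated for these.) -/
structure DetMul (X : TwoTate k) where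
  μ : ∀ {L₁ L₂ L₃ : X.Lattice}, L₁ ≤ L₂ → L₂ ≤ L₃ →
    BandedFunctor (tensor (TwoTate.det L₁ L₂) (TwoTate.det L₂ L₃)) (TwoTate.det L₁ L₃)
  μ_equiv : ∀ {L₁ L₂ L₃ : X.Lattice} (h₁₂ : L₁ ≤ L₂) (h₂₃ : L₂ ≤ L₃),
    (μ h₁₂ h₂₃).functor.IsEquivalence
  α : ∀ {L₁ L₂ L₃ L₄ : X.Lattice} (h₁₂ : L₁ ≤ L₂) (h₂₃ : L₂ ≤ L₃) (h₃₄ : L₃ ≤ L₄)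
    (A : TwoTate.det L₁ L₂) (B : TwoTate.det L₂ L₃) (C : TwoTate.det L₃ L₄),
    (μ (h₁₂.trans h₂₃) h₃₄).obj₂ ((μ h₁₂ h₂₃).obj₂ A B) C ⟶
      (μ h₁₂ (h₂₃.trans h₃₄)).obj₂ A ((μ h₂₃ h₃₄).obj₂ B C)
  α_natural : ∀ {L₁ L₂ L₃ L₄ : X.Lattice} (h₁₂ : L₁ ≤ L₂) (h₂₃ : L₂ ≤ L₃) (h₃₄ : L₃ ≤ L₄)
    {A A' : TwoTate.det L₁ L₂} {B B' : TwoTate.det L₂ L₃} {C C' : TwoTate.det L₃ L₄}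
    (a : A ⟶ A') (b : B ⟶ B') (c : C ⟶ C'),
    (μ (h₁₂.trans h₂₃) h₃₄).map₂ ((μ h₁₂ h₂₃).map₂ a b) c ≫ α h₁₂ h₂₃ h₃₄ A' B' C' =
      α h₁₂ h₂₃ h₃₄ A B C ≫ (μ h₁₂ (h₂₃.trans h₃₄)).map₂ a ((μ h₂₃ h₃₄).map₂ b c)
  cube : ∀ {L₁ L₂ L₃ L₄ L₅ : X.Lattice} (h₁₂ : L₁ ≤ L₂) (h₂₃ : L₂ ≤ L₃) (h₃₄ : L₃ ≤ L₄)
    (h₄₅ : L₄ ≤ L₅) (A : TwoTate.det L₁ L₂) (B : TwoTate.det L₂ L₃) (C : TwoTate.det L₃ L₄)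
    (D : TwoTate.det L₄ L₅),
    (μ (h₁₂.trans (h₂₃.trans h₃₄)) h₄₅).map₂ (α h₁₂ h₂₃ h₃₄ A B C) (𝟙 D) ≫
        α h₁₂ (h₂₃.trans h₃₄) h₄₅ A ((μ h₂₃ h₃₄).obj₂ B C) D ≫
        (μ h₁₂ (h₂₃.trans (h₃₄.trans h₄₅))).map₂ (𝟙 A) (α h₂₃ h₃₄ h₄₅ B C D) =
      α (h₁₂.trans h₂₃) h₃₄ h₄₅ ((μ h₁₂ h₂₃).obj₂ A B) C D ≫
        α h₁₂ h₂₃ (h₃₄.trans h₄₅) A B ((μ h₃₄ h₄₅).obj₂ C D)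

/-- A gerbel theory on a 2-Tate space `X`: a `𝔾ₘ`-gerbe `𝔻_L` for each lattice `L`, equivalences
of gerbes `φ : 𝔻_{L₁} ⊗ 𝒟_{L₂/L₁} → 𝔻_{L₂}` for `L₁ ≤ L₂`, and natural transformations `τ` between
the two resulting functors `𝔻_{L₁} ⊗ 𝒟_{L₂/L₁} ⊗ 𝒟_{L₃/L₂} → 𝔻_{L₃}` for `L₁ ≤ L₂ ≤ L₃`, such that
the cubical diagram of natural transformations commutes for `L₁ ≤ L₂ ≤ L₃ ≤ L₄`. -/
structure GerbelTheory (X : TwoTate k) (M : DetMul X) where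
  gerbe : X.Lattice → BandedGroupoid k
  isGerbe : ∀ L, (gerbe L).IsGerbe
  φ : ∀ {L₁ L₂ : X.Lattice}, L₁ ≤ L₂ →
    BandedFunctor (tensor (gerbe L₁) (TwoTate.det L₁ L₂)) (gerbe L₂)
  φ_equiv : ∀ {L₁ L₂ : X.Lattice} (h : L₁ ≤ L₂), (φ h).functor.IsEquivalence
  τ : ∀ {L₁ L₂ L₃ : X.Lattice} (h₁₂ : L₁ ≤ L₂) (h₂₃ : L₂ ≤ L₃)
    (A : gerbe L₁) (B : TwoTate.det L₁ L₂) (C : TwoTate.det L₂ L₃),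
    (φ h₂₃).obj₂ ((φ h₁₂).obj₂ A B) C ⟶ (φ (h₁₂.trans h₂₃)).obj₂ A ((M.μ h₁₂ h₂₃).obj₂ B C)
  τ_natural : ∀ {L₁ L₂ L₃ : X.Lattice} (h₁₂ : L₁ ≤ L₂) (h₂₃ : L₂ ≤ L₃)
    {A A' : gerbe L₁} {B B' : TwoTate.det L₁ L₂} {C C' : TwoTate.det L₂ L₃}
    (a : A ⟶ A') (b : B ⟶ B') (c : C ⟶ C'),
    (φ h₂₃).map₂ ((φ h₁₂).map₂ a b) c ≫ τ h₁₂ h₂₃ A' B' C' =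
      τ h₁₂ h₂₃ A B C ≫ (φ (h₁₂.trans h₂₃)).map₂ a ((M.μ h₁₂ h₂₃).map₂ b c)
  cube : ∀ {L₁ L₂ L₃ L₄ : X.Lattice} (h₁₂ : L₁ ≤ L₂) (h₂₃ : L₂ ≤ L₃) (h₃₄ : L₃ ≤ L₄)
    (A : gerbe L₁) (B : TwoTate.det L₁ L₂) (C : TwoTate.det L₂ L₃) (D : TwoTate.det L₃ L₄),
    (φ h₃₄).map₂ (τ h₁₂ h₂₃ A B C) (𝟙 D) ≫
        τ (h₁₂.trans h₂₃) h₃₄ A ((M.μ h₁₂ h₂₃).obj₂ B C) D ≫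
        (φ (h₁₂.trans (h₂₃.trans h₃₄))).map₂ (𝟙 A) (M.α h₁₂ h₂₃ h₃₄ B C D) =
      τ h₂₃ h₃₄ ((φ h₁₂).obj₂ A B) C D ≫
        τ h₁₂ (h₂₃.trans h₃₄) A B ((M.μ h₂₃ h₃₄).obj₂ C D)

namespace GerbelTheory

variable {X : TwoTate k} {M : DetMul X}

/-- A morphism of gerbel theories `𝔻 → 𝔼`: morphisms of gerbes `f_L : 𝔻_L → 𝔼_L` and natural
transformations `σ : φ ∘ (f_{L₁} ⊗ id) → f_{L₂} ∘ φ` of functors `𝔻_{L₁} ⊗ 𝒟_{L₂/L₁} → 𝔼_{L₂}`,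
compatible with the natural transformations `τ` for `L₁ ≤ L₂ ≤ L₃`. -/
structure Hom (P Q : GerbelTheory X M) where
  f : ∀ L, BandedFunctor (P.gerbe L) (Q.gerbe L)
  σ : ∀ {L₁ L₂ : X.Lattice} (h : L₁ ≤ L₂) (A : P.gerbe L₁) (B : TwoTate.det L₁ L₂),
    (Q.φ h).obj₂ ((f L₁).functor.obj A) B ⟶ (f L₂).functor.obj ((P.φ h).obj₂ A B)
  σ_natural : ∀ {L₁ L₂ : X.Lattice} (h : L₁ ≤ L₂) {A A' : P.gerbe L₁} {B B' : TwoTate.det L₁ L₂}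
    (a : A ⟶ A') (b : B ⟶ B'),
    (Q.φ h).map₂ ((f L₁).functor.map a) b ≫ σ h A' B' =
      σ h A B ≫ (f L₂).functor.map ((P.φ h).map₂ a b)
  compat : ∀ {L₁ L₂ L₃ : X.Lattice} (h₁₂ : L₁ ≤ L₂) (h₂₃ : L₂ ≤ L₃) (A : P.gerbe L₁)
    (B : TwoTate.det L₁ L₂) (C : TwoTate.det L₂ L₃),
    (Q.φ h₂₃).map₂ (σ h₁₂ A B) (𝟙 C) ≫ σ h₂₃ ((P.φ h₁₂).obj₂ A B) C ≫
        (f L₃).functor.map (P.τ h₁₂ h₂₃ A B C) =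
      Q.τ h₁₂ h₂₃ ((f L₁).functor.obj A) B C ≫
        σ (h₁₂.trans h₂₃) A ((M.μ h₁₂ h₂₃).obj₂ B C)

/-- A 2-morphism of gerbel theories: natural transformations `θ_L : f_L → g_L` compatible with the
natural transformations `σ` for `L₁ ≤ L₂`. -/
@[ext] structure Hom₂ {P Q : GerbelTheory X M} (F G : Hom P Q) where
  θ : ∀ (L : X.Lattice) (A : P.gerbe L), (F.f L).functor.obj A ⟶ (G.f L).functor.obj A
  natural : ∀ (L : X.Lattice) {A A' : P.gerbe L} (a : A ⟶ A'),
    (F.f L).functor.map a ≫ θ L A' = θ L A ≫ (G.f L).functor.map a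
  compat : ∀ {L₁ L₂ : X.Lattice} (h : L₁ ≤ L₂) (A : P.gerbe L₁) (B : TwoTate.det L₁ L₂),
    (Q.φ h).map₂ (θ L₁ A) (𝟙 B) ≫ G.σ h A B = F.σ h A B ≫ θ L₂ ((P.φ h).obj₂ A B)

/-- The identity morphism. -/
abbrev Hom.id (P : GerbelTheory X M) : Hom P P where
  f L := .id _
  σ h A B := 𝟙 ((P.φ h).obj₂ A B)
  σ_natural h _ _ _ _ a b := by simp
  compat h₁₂ h₂₃ A B C := by simp [BandedFunctor.map₂_id]

/-- The composition of morphisms. -/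
abbrev Hom.comp {P Q R : GerbelTheory X M} (F : Hom P Q) (G : Hom Q R) : Hom P R where
  f L := (F.f L).comp (G.f L)
  σ {_ L₂} h A B := G.σ h ((F.f _).functor.obj A) B ≫ (G.f L₂).functor.map (F.σ h A B)
  σ_natural h _ _ _ _ a b := by
    have e₁ := G.σ_natural h ((F.f _).functor.map a) b
    have e₂ := congrArg (G.f _).functor.map (F.σ_natural h a b)
    simp only [Functor.map_comp] at e₂
    simp only [Functor.comp_map, Category.assoc, ← e₂]
    rw [reassoc_of% e₁]
  compat h₁₂ h₂₃ A B C := by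
    have e₁ := G.compat h₁₂ h₂₃ ((F.f _).functor.obj A) B C
    have e₂ := congrArg (G.f _).functor.map (F.compat h₁₂ h₂₃ A B C)
    have e₃ := G.σ_natural h₂₃ (F.σ h₁₂ A B) (𝟙 C)
    simp only [Functor.map_comp] at e₂
    simp only [Functor.comp_obj, Functor.comp_map, Category.assoc,
      BandedFunctor.map₂_comp_id]
    rw [reassoc_of% e₃, e₂, reassoc_of% e₁]

/-- The vertical composition of 2-morphisms. -/
abbrev Hom₂.vcomp {P Q : GerbelTheory X M} {F G K : Hom P Q} (a : Hom₂ F G)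
    (b : Hom₂ G K) : Hom₂ F K where
  θ L A := a.θ L A ≫ b.θ L A
  natural L _ _ x := by
    rw [← Category.assoc, a.natural, Category.assoc, b.natural, Category.assoc]
  compat h A B := by
    rw [BandedFunctor.map₂_comp_id, Category.assoc, b.compat, ← Category.assoc, a.compat,
      Category.assoc]

instance (P Q : GerbelTheory X M) : Category (Hom P Q) where
  Hom := Hom₂
  id F := ⟨fun L A => 𝟙 _, fun L _ _ x => by simp, fun h A B => by simp [BandedFunctor.map₂_id]⟩
  comp a b := a.vcomp b
  id_comp a := Hom₂.ext (funext fun L => funext fun A => Category.id_comp _)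
  comp_id a := Hom₂.ext (funext fun L => funext fun A => Category.comp_id _)
  assoc a b c := Hom₂.ext (funext fun L => funext fun A => Category.assoc _ _ _)

/-- Composition of a 2-morphism with a morphism on the left. -/
abbrev Hom₂.whiskerLeft {P Q R : GerbelTheory X M} (F : Hom P Q) {G K : Hom Q R}
    (b : Hom₂ G K) : Hom₂ (F.comp G) (F.comp K) where
  θ L A := b.θ L ((F.f L).functor.obj A)
  natural L _ _ x := b.natural L ((F.f L).functor.map x)
  compat h A B := by
    have e := b.compat h ((F.f _).functor.obj A) B
    have e' := b.natural _ (F.σ h A B)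
    simp only [Functor.comp_obj, Category.assoc]
    rw [reassoc_of% e, e']

/-- Composition of a 2-morphism with a morphism on the right. -/
abbrev Hom₂.whiskerRight {P Q R : GerbelTheory X M} {F G : Hom P Q} (a : Hom₂ F G)
    (K : Hom Q R) : Hom₂ (F.comp K) (G.comp K) where
  θ L A := (K.f L).functor.map (a.θ L A)
  natural L _ _ x := by
    simp only [Functor.comp_map, Functor.comp_obj]
    rw [← Functor.map_comp, a.natural, Functor.map_comp]
  compat h A B := by
    have e := congrArg (K.f _).functor.map (a.compat h A B)
    have e₁ := K.σ_natural h (a.θ _ A) (𝟙 B)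
    simp only [Functor.map_comp] at e
    simp only [Functor.comp_obj, Category.assoc]
    rw [reassoc_of% e₁, e]

/-- An invertible 2-morphism with identity components. -/
abbrev isoOfId {P Q : GerbelTheory X M} {F G : Hom P Q} (hom : Hom₂ F G) (inv : Hom₂ G F)
    (h₁ : ∀ L A, hom.θ L A ≫ inv.θ L A = 𝟙 _) (h₂ : ∀ L A, inv.θ L A ≫ hom.θ L A = 𝟙 _) :
    F ≅ G where
  hom := hom
  inv := inv
  hom_inv_id := Hom₂.ext (funext fun L => funext fun A => h₁ L A)
  inv_hom_id := Hom₂.ext (funext fun L => funext fun A => h₂ L A)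

/-- The associativity constraint, with identity components. -/
abbrev assocIso {P Q R S : GerbelTheory X M} (F : Hom P Q) (G : Hom Q R) (K : Hom R S) :
    (F.comp G).comp K ≅ F.comp (G.comp K) :=
  isoOfId
    ⟨fun L A => 𝟙 _, fun L _ _ x => by simp, fun h A B => by simp [BandedFunctor.map₂_id]⟩
    ⟨fun L A => 𝟙 _, fun L _ _ x => by simp, fun h A B => by simp [BandedFunctor.map₂_id]⟩
    (fun _ _ => Category.comp_id _) (fun _ _ => Category.comp_id _)

/-- The left unit constraint, with identity components. -/
abbrev leftIso {P Q : GerbelTheory X M} (F : Hom P Q) : (Hom.id P).comp F ≅ F :=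
  isoOfId
    ⟨fun L A => 𝟙 _, fun L _ _ x => by simp, fun h A B => by simp [BandedFunctor.map₂_id]⟩
    ⟨fun L A => 𝟙 _, fun L _ _ x => by simp, fun h A B => by simp [BandedFunctor.map₂_id]⟩
    (fun _ _ => Category.comp_id _) (fun _ _ => Category.comp_id _)

/-- The right unit constraint, with identity components. -/
abbrev rightIso {P Q : GerbelTheory X M} (F : Hom P Q) : F.comp (Hom.id Q) ≅ F :=
  isoOfId
    ⟨fun L A => 𝟙 _, fun L _ _ x => by simp, fun h A B => by simp [BandedFunctor.map₂_id]⟩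
    ⟨fun L A => 𝟙 _, fun L _ _ x => by simp, fun h A B => by simp [BandedFunctor.map₂_id]⟩
    (fun _ _ => Category.comp_id _) (fun _ _ => Category.comp_id _)

theorem id_comp_comp_id {C : Type*} [Category C] {A B : C} (f : A ⟶ B) : f = 𝟙 A ≫ f ≫ 𝟙 B := by
  simp

/-- The bicategory `𝔾𝔼ℝ𝔹_X` of gerbel theories, their morphisms and their 2-morphisms. -/
instance : Bicategory (GerbelTheory X M) where
  Hom := Hom
  id := Hom.id
  comp := Hom.comp
  homCategory _ _ := inferInstance
  whiskerLeft F _ _ b := Hom₂.whiskerLeft F b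
  whiskerRight a K := Hom₂.whiskerRight a K
  associator F G K := assocIso F G K
  leftUnitor F := leftIso F
  rightUnitor F := rightIso F
  whiskerLeft_id _ _ := rfl
  whiskerLeft_comp _ _ _ _ _ _ := rfl
  id_whiskerLeft _ := Hom₂.ext (funext fun _ => funext fun _ => id_comp_comp_id _)
  comp_whiskerLeft _ _ _ _ _ := Hom₂.ext (funext fun _ => funext fun _ => id_comp_comp_id _)
  id_whiskerRight _ G := Hom₂.ext (funext fun L => funext fun _ => (G.f L).functor.map_id _)
  comp_whiskerRight _ _ G := Hom₂.ext (funext fun L => funext fun _ =>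
    (G.f L).functor.map_comp _ _)
  whiskerRight_id _ := Hom₂.ext (funext fun _ => funext fun _ => id_comp_comp_id _)
  whiskerRight_comp _ _ _ := Hom₂.ext (funext fun _ => funext fun _ => id_comp_comp_id _)
  whisker_assoc _ _ _ _ _ := Hom₂.ext (funext fun _ => funext fun _ => id_comp_comp_id _)
  whisker_exchange a b := Hom₂.ext (funext fun L => funext fun A =>
    (b.natural L (a.θ L A)).symm)
  pentagon _ _ _ I := Hom₂.ext (funext fun L => funext fun _ =>
    ((congrArg (fun t => t ≫ _) ((I.f L).functor.map_id _)).trans (Category.id_comp _)))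
  triangle _ G := Hom₂.ext (funext fun L => funext fun _ =>
    (Category.comp_id _).trans ((G.f L).functor.map_id _).symm)

end GerbelTheory

end GerbelTheory

/-! ## 2-gerbes -/

open Bicategory in
/-- A 2-gerbe (over a point) with band the abelian group `A`: a nonempty bicategory in which all
2-arrows are invertible, all 1-arrows are invertible up to a 2-arrow, there is a 1-arrow between any
two objects and a 2-arrow between any two parallel 1-arrows, and the automorphism groups of all
1-arrows are identified with `A`, compatibly with 2-arrows and with composition of 1-arrows (all
categories of 1-arrows are gerbes with band `A`, and composition is a morphism of gerbes). -/
structure IsTwoGerbe (A : Type*) [CommGroup A] (C : Type*) [Bicategory C] : Prop where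
  nonempty : Nonempty C
  isIso : ∀ {a b : C} {f g : a ⟶ b} (η : f ⟶ g), IsIso η
  invertible : ∀ {a b : C} (f : a ⟶ b), ∃ g : b ⟶ a,
    Nonempty (f ≫ g ≅ 𝟙 a) ∧ Nonempty (g ≫ f ≅ 𝟙 b)
  connected : ∀ a b : C, Nonempty (a ⟶ b)
  locally_connected : ∀ {a b : C} (f g : a ⟶ b), Nonempty (f ⟶ g)
  band : ∃ β : ∀ {a b : C} (f : a ⟶ b), A ≃* Aut f,
    (∀ {a b : C} {f g : a ⟶ b} (η : f ⟶ g) (c : A), (β f c).hom ≫ η = η ≫ (β g c).hom) ∧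
    (∀ {a b d : C} (f : a ⟶ b) (g : b ⟶ d) (c : A), f ◁ (β g c).hom = (β (f ≫ g) c).hom) ∧
    (∀ {a b d : C} (f : a ⟶ b) (g : b ⟶ d) (c : A), (β f c).hom ▷ g = (β (f ≫ g) c).hom)

end Gerbel

end

/-! A gerbe over a point is trivial, so after choosing base objects and arrows to them, each piece
of structure becomes a cochain on a set of lattices with values in `kˣ`, and each coherence axiom
becomes a cocycle or coboundary equation. The theorem thus reduces to vanishing of the cohomology of
a poset in degrees 1, 2 and 3. That holds because the poset is codirected: any finite set of chains
can be coned off from a point below all of them, so the augmented chain complex is exact, and being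
free it has a contraction. The results are `exists_coboundary₁`, `exists_coboundary₂` and
`exists_coboundary₃`.

They are applied at two levels. On the lattices of a 1-Tate space, trivialized determinant lines
multiply up to a 2-cocycle `detCocycle`. A determinant theory is a 1-cochain bounding it, so one
exists (H² = 0), any two are isomorphic (H¹ = 0), and automorphisms are constant scalars (H⁰ =
`kˣ`). This is `isGerbe_detGerbe`.

On the lattices of a 2-Tate space, a multiplicative structure gives a 3-cocycle `a`. Gerbel theories
are 2-cochains `t` with coboundary `a`; morphisms are 1-cochains `s` whose coboundary is the
difference of two such `t`; 2-morphisms are 0-cochains whose coboundary is the difference of two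
such `s`; and 2-automorphisms are constants. Vanishing of H³, H², H¹ gives nonemptiness,
connectedness and local connectedness, and H⁰ gives the band. A multiplicative structure exists
because chosen trivializations provide a strictly associative one, with trivial 3-cocycle.

The link between the levels is geometric. The subspaces `W i` of a presentation are lattices
(`TwoTate.isLattice_W`), and every lattice is closed and lies between some `W i` and some `U j`
(`TwoTate.IsLattice.bounds`). So the lattices are codirected, and `L₂ / L₁` is a subquotient of the
1-Tate space `U j / W i`, whence it has Tate lattices and its determinant gerbe is a gerbe. -/

noncomputable section

namespace Gerbel

/-! ## Cohomology of codirected posets in low degrees -/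

namespace OrderChain

open FreeAbelianGroup

variable (P : Type*) [Preorder P]

/-- Chains `x₀ ≤ x₁`. -/
structure S₁ where
  (x₀ x₁ : P)
  h₀ : x₀ ≤ x₁

/-- Chains `x₀ ≤ x₁ ≤ x₂`. -/
structure S₂ where
  (x₀ x₁ x₂ : P)
  h₀ : x₀ ≤ x₁
  h₁ : x₁ ≤ x₂

/-- Chains `x₀ ≤ x₁ ≤ x₂ ≤ x₃`. -/
structure S₃ where
  (x₀ x₁ x₂ x₃ : P)
  h₀ : x₀ ≤ x₁
  h₁ : x₁ ≤ x₂
  h₂ : x₂ ≤ x₃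

/-- Chains `x₀ ≤ x₁ ≤ x₂ ≤ x₃ ≤ x₄`. -/
structure S₄ where
  (x₀ x₁ x₂ x₃ x₄ : P)
  h₀ : x₀ ≤ x₁
  h₁ : x₁ ≤ x₂
  h₂ : x₂ ≤ x₃
  h₃ : x₃ ≤ x₄

/-- The augmentation. -/
def aug : FreeAbelianGroup P →+ ℤ := lift fun _ => 1

/-- The boundary of 1-chains. -/
def bd₁ : FreeAbelianGroup (S₁ P) →+ FreeAbelianGroup P := lift fun s => of s.x₁ - of s.x₀

/-- The boundary of 2-chains. -/
def bd₂ : FreeAbelianGroup (S₂ P) →+ FreeAbelianGroup (S₁ P) :=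
  lift fun s => of ⟨s.x₁, s.x₂, s.h₁⟩ - of ⟨s.x₀, s.x₂, s.h₀.trans s.h₁⟩ + of ⟨s.x₀, s.x₁, s.h₀⟩

/-- The boundary of 3-chains. -/
def bd₃ : FreeAbelianGroup (S₃ P) →+ FreeAbelianGroup (S₂ P) :=
  lift fun s => of ⟨s.x₁, s.x₂, s.x₃, s.h₁, s.h₂⟩ - of ⟨s.x₀, s.x₂, s.x₃, s.h₀.trans s.h₁, s.h₂⟩ +
    of ⟨s.x₀, s.x₁, s.x₃, s.h₀, s.h₁.trans s.h₂⟩ - of ⟨s.x₀, s.x₁, s.x₂, s.h₀, s.h₁⟩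

/-- The boundary of 4-chains. -/
def bd₄ : FreeAbelianGroup (S₄ P) →+ FreeAbelianGroup (S₃ P) :=
  lift fun s => of ⟨s.x₁, s.x₂, s.x₃, s.x₄, s.h₁, s.h₂, s.h₃⟩ -
    of ⟨s.x₀, s.x₂, s.x₃, s.x₄, s.h₀.trans s.h₁, s.h₂, s.h₃⟩ +
    of ⟨s.x₀, s.x₁, s.x₃, s.x₄, s.h₀, s.h₁.trans s.h₂, s.h₃⟩ -
    of ⟨s.x₀, s.x₁, s.x₂, s.x₄, s.h₀, s.h₁, s.h₂.trans s.h₃⟩ +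
    of ⟨s.x₀, s.x₁, s.x₂, s.x₃, s.h₀, s.h₁, s.h₂⟩

variable {P}

theorem aug_bd₁ (c : FreeAbelianGroup (S₁ P)) : aug P (bd₁ P c) = 0 := by
  refine DFunLike.congr_fun (f := (aug P).comp (bd₁ P)) (g := 0) (lift_ext _ _ ?_) c
  intro s
  simp [aug, bd₁]

theorem bd₁_bd₂ (c : FreeAbelianGroup (S₂ P)) : bd₁ P (bd₂ P c) = 0 := by
  refine DFunLike.congr_fun (f := (bd₁ P).comp (bd₂ P)) (g := 0) (lift_ext _ _ ?_) c
  intro s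
  simp [bd₁, bd₂]

theorem bd₂_bd₃ (c : FreeAbelianGroup (S₃ P)) : bd₂ P (bd₃ P c) = 0 := by
  refine DFunLike.congr_fun (f := (bd₂ P).comp (bd₃ P)) (g := 0) (lift_ext _ _ ?_) c
  intro s
  simp only [AddMonoidHom.comp_apply, bd₂, bd₃, map_add, map_sub, lift_apply_of,
    AddMonoidHom.zero_apply]
  abel

open Classical in
/-- The cone over a point. -/
def cone₀ (p : P) : FreeAbelianGroup P →+ FreeAbelianGroup (S₁ P) :=
  lift fun x => if h : p ≤ x then of ⟨p, x, h⟩ else 0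

open Classical in
/-- The cone over a 1-chain. -/
def cone₁ (p : P) : FreeAbelianGroup (S₁ P) →+ FreeAbelianGroup (S₂ P) :=
  lift fun s => if h : p ≤ s.x₀ then of ⟨p, s.x₀, s.x₁, h, s.h₀⟩ else 0

open Classical in
/-- The cone over a 2-chain. -/
def cone₂ (p : P) : FreeAbelianGroup (S₂ P) →+ FreeAbelianGroup (S₃ P) :=
  lift fun s => if h : p ≤ s.x₀ then of ⟨p, s.x₀, s.x₁, s.x₂, h, s.h₀, s.h₁⟩ else 0

open Classical in
/-- The cone over a 3-chain. -/
def cone₃ (p : P) : FreeAbelianGroup (S₃ P) →+ FreeAbelianGroup (S₄ P) :=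
  lift fun s => if h : p ≤ s.x₀ then of ⟨p, s.x₀, s.x₁, s.x₂, s.x₃, h, s.h₀, s.h₁, s.h₂⟩ else 0

/-! ### Exactness of the chain complex by coning from a small point -/

section Codirected

variable [IsDirected P (· ≥ ·)] [Nonempty P]

/-- Two homomorphisms that depend on a point of a codirected set agree on every chain for small
points if they do so on generators. -/
theorem exists_eq_of_generators {S B : Type*} [AddCommGroup B]
    (f g : P → FreeAbelianGroup S →+ B)
    (hfg : ∀ s, ∃ p, ∀ q ≤ p, f q (of s) = g q (of s)) (c : FreeAbelianGroup S) :
    ∃ p, ∀ q ≤ p, f q c = g q c := by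
  induction c using FreeAbelianGroup.induction_on with
  | zero => exact ⟨Classical.arbitrary P, fun q _ => by simp⟩
  | of s => exact hfg s
  | neg s ih =>
    obtain ⟨p, hp⟩ := ih
    exact ⟨p, fun q hq => by rw [map_neg, map_neg, hp q hq]⟩
  | add a b iha ihb =>
    obtain ⟨p, hp⟩ := iha
    obtain ⟨p', hp'⟩ := ihb
    obtain ⟨r, hr, hr'⟩ := exists_le_le p p'
    exact ⟨r, fun q hq => by rw [map_add, map_add, hp q (hq.trans hr), hp' q (hq.trans hr')]⟩

/-- Coning from `q` is a homotopy from the identity to the constant chain at `q`, on every chain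
whose vertices lie above `q`. Codirectedness gives such a `q` for each chain, and the cone of a
cycle then bounds it. The same argument serves in degrees 1 to 3, where the constant term is absent.
-/
theorem exact₀ (c : FreeAbelianGroup P) (hc : aug P c = 0) : ∃ b, bd₁ P b = c := by
  obtain ⟨p, hp⟩ := exists_eq_of_generators (fun p : P => (bd₁ P).comp (cone₀ p))
    (fun p => AddMonoidHom.id _ - ((zmultiplesHom _) (of p)).comp (aug P))
    (fun s => ⟨s, fun q hq => by simp [bd₁, cone₀, aug, hq]⟩) c
  exact ⟨cone₀ p c, by simpa [hc] using hp p le_rfl⟩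

theorem exact₁ (c : FreeAbelianGroup (S₁ P)) (hc : bd₁ P c = 0) : ∃ b, bd₂ P b = c := by
  obtain ⟨p, hp⟩ := exists_eq_of_generators (fun p : P => (bd₂ P).comp (cone₁ p))
    (fun p => AddMonoidHom.id _ - (cone₀ p).comp (bd₁ P))
    (fun s => ⟨s.x₀, fun q hq => by
      simp [bd₁, bd₂, cone₀, cone₁, hq, hq.trans s.h₀]
      abel⟩) c
  exact ⟨cone₁ p c, by simpa [hc] using hp p le_rfl⟩

theorem exact₂ (c : FreeAbelianGroup (S₂ P)) (hc : bd₂ P c = 0) : ∃ b, bd₃ P b = c := by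
  obtain ⟨p, hp⟩ := exists_eq_of_generators (fun p : P => (bd₃ P).comp (cone₂ p))
    (fun p => AddMonoidHom.id _ - (cone₁ p).comp (bd₂ P))
    (fun s => ⟨s.x₀, fun q hq => by
      simp [bd₂, bd₃, cone₁, cone₂, hq, hq.trans s.h₀]
      abel⟩) c
  exact ⟨cone₂ p c, by simpa [hc] using hp p le_rfl⟩

theorem exact₃ (c : FreeAbelianGroup (S₃ P)) (hc : bd₃ P c = 0) : ∃ b, bd₄ P b = c := by
  obtain ⟨p, hp⟩ := exists_eq_of_generators (fun p : P => (bd₄ P).comp (cone₃ p))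
    (fun p => AddMonoidHom.id _ - (cone₂ p).comp (bd₃ P))
    (fun s => ⟨s.x₀, fun q hq => by
      simp [bd₃, bd₄, cone₂, cone₃, hq, hq.trans s.h₀]
      abel⟩) c
  exact ⟨cone₃ p c, by simpa [hc] using hp p le_rfl⟩

end Codirected

/-- Freeness of the source: lifting generators suffices. The cones depend on the chain, so this is
what turns exactness into homotopies defined on all chains at once. -/
theorem exists_lift {S B C : Type*} [AddCommGroup B] [AddCommGroup C] (d : B →+ C)
    (g : FreeAbelianGroup S →+ C) (hg : ∀ s, ∃ b, d b = g (of s)) :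
    ∃ h : FreeAbelianGroup S →+ B, ∀ c, d (h c) = g c := by
  choose h hh using hg
  refine ⟨lift h, fun c => DFunLike.congr_fun (f := d.comp (lift h)) (g := g) (lift_ext _ _ ?_) c⟩
  intro s
  simp [hh]

section Contraction

variable (P) [IsDirected P (· ≥ ·)] [Nonempty P]

/-- A contraction of the augmented chain complex in low degrees. -/
theorem exists_contraction : ∃ (x : P) (h₀ : FreeAbelianGroup P →+ FreeAbelianGroup (S₁ P))
    (h₁ : FreeAbelianGroup (S₁ P) →+ FreeAbelianGroup (S₂ P))
    (h₂ : FreeAbelianGroup (S₂ P) →+ FreeAbelianGroup (S₃ P)),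
    (∀ c, bd₁ P (h₀ c) = c - aug P c • of x) ∧ (∀ c, bd₂ P (h₁ c) = c - h₀ (bd₁ P c)) ∧
      (∀ c, bd₃ P (h₂ c) = c - h₁ (bd₂ P c)) := by
  obtain ⟨x⟩ := ‹Nonempty P›
  obtain ⟨h₀, e₀⟩ := exists_lift (bd₁ P)
    (AddMonoidHom.id _ - ((zmultiplesHom _) (of x)).comp (aug P))
    (fun s => exact₀ _ (by simp [aug]))
  obtain ⟨h₁, e₁⟩ := exists_lift (bd₂ P) (AddMonoidHom.id _ - h₀.comp (bd₁ P))
    (fun s => exact₁ _ (by simp [e₀, aug_bd₁]))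
  obtain ⟨h₂, e₂⟩ := exists_lift (bd₃ P) (AddMonoidHom.id _ - h₁.comp (bd₂ P))
    (fun s => exact₂ _ (by simp [e₁, bd₁_bd₂]))
  exact ⟨x, h₀, h₁, h₂, fun c => by simpa using e₀ c, fun c => by simpa using e₁ c,
    fun c => by simpa using e₂ c⟩

end Contraction

end OrderChain

/-! ### Vanishing of H¹, H² and H³ -/

section Vanishing

open OrderChain FreeAbelianGroup

variable {P A : Type*} [Preorder P] [IsDirected P (· ≥ ·)] [Nonempty P] [AddCommGroup A]

/-- Vanishing of `H¹` of a codirected set. -/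
theorem exists_coboundary₁ (d : ∀ {x y : P}, x ≤ y → A)
    (hd : ∀ {x y z : P} (h : x ≤ y) (h' : y ≤ z), d h' - d (h.trans h') + d h = 0) :
    ∃ e : P → A, ∀ {x y : P} (h : x ≤ y), d h = e y - e x := by
  obtain ⟨x, h₀, h₁, -, e₀, e₁, -⟩ := exists_contraction P
  let a : FreeAbelianGroup (S₁ P) →+ A := lift fun s => d s.h₀
  have ha : ∀ c, a (bd₂ P c) = 0 := fun c => by
    refine DFunLike.congr_fun (f := a.comp (bd₂ P)) (g := 0) (lift_ext _ _ ?_) c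
    intro s
    simpa [a, bd₂] using hd s.h₀ s.h₁
  refine ⟨fun y => a (h₀ (of y)), fun {y z} h => ?_⟩
  -- The cocycle kills the boundary term of the homotopy identity, leaving `a = (a ∘ h₀) ∘ bd₁`, so
  -- `a ∘ h₀` is the required primitive.
  have := congrArg a (e₁ (of ⟨y, z, h⟩))
  rw [ha, map_sub] at this
  simpa [a, bd₁] using sub_eq_zero.1 this.symm

/-- Vanishing of `H²` of a codirected set. -/
theorem exists_coboundary₂ (d : ∀ {x y z : P}, x ≤ y → y ≤ z → A)
    (hd : ∀ {x y z w : P} (h : x ≤ y) (h' : y ≤ z) (h'' : z ≤ w),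
      d h' h'' - d (h.trans h') h'' + d h (h'.trans h'') - d h h' = 0) :
    ∃ e : ∀ {x y : P}, x ≤ y → A, ∀ {x y z : P} (h : x ≤ y) (h' : y ≤ z),
      d h h' = e h' - e (h.trans h') + e h := by
  obtain ⟨x, h₀, h₁, h₂, e₀, e₁, e₂⟩ := exists_contraction P
  let a : FreeAbelianGroup (S₂ P) →+ A := lift fun s => d s.h₀ s.h₁
  have ha : ∀ c, a (bd₃ P c) = 0 := fun c => by
    refine DFunLike.congr_fun (f := a.comp (bd₃ P)) (g := 0) (lift_ext _ _ ?_) c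
    intro s
    simpa [a, bd₃] using hd s.h₀ s.h₁ s.h₂
  refine ⟨fun {y z} h => a (h₁ (of ⟨y, z, h⟩)), fun {y z w} h h' => ?_⟩
  have := congrArg a (e₂ (of ⟨y, z, w, h, h'⟩))
  rw [ha, map_sub] at this
  simpa [a, bd₂] using sub_eq_zero.1 this.symm

/-- Vanishing of `H³` of a codirected set. -/
theorem exists_coboundary₃ (d : ∀ {x y z w : P}, x ≤ y → y ≤ z → z ≤ w → A)
    (hd : ∀ {x y z w v : P} (h : x ≤ y) (h' : y ≤ z) (h'' : z ≤ w) (h''' : w ≤ v),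
      d h' h'' h''' - d (h.trans h') h'' h''' + d h (h'.trans h'') h''' -
        d h h' (h''.trans h''') + d h h' h'' = 0) :
    ∃ e : ∀ {x y z : P}, x ≤ y → y ≤ z → A, ∀ {x y z w : P} (h : x ≤ y) (h' : y ≤ z) (h'' : z ≤ w),
      d h h' h'' = e h' h'' - e (h.trans h') h'' + e h (h'.trans h'') - e h h' := by
  obtain ⟨x, h₀, h₁, h₂, e₀, e₁, e₂⟩ := exists_contraction P
  let a : FreeAbelianGroup (S₃ P) →+ A := lift fun s => d s.h₀ s.h₁ s.h₂
  have ha : ∀ c, a (bd₄ P c) = 0 := fun c => by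
    refine DFunLike.congr_fun (f := a.comp (bd₄ P)) (g := 0) (lift_ext _ _ ?_) c
    intro s
    simpa [a, bd₄] using hd s.h₀ s.h₁ s.h₂ s.h₃
  refine ⟨fun {y z w} h h' => a (h₂ (of ⟨y, z, w, h, h'⟩)), fun {y z w v} h h' h'' => ?_⟩
  -- The contraction ends with `h₂`. No homotopy in the next degree is needed: on this generator it
  -- is enough that the 3-cycle is some boundary.
  obtain ⟨b, hb⟩ := exact₃ (of ⟨y, z, w, v, h, h', h''⟩ - h₂ (bd₃ P (of ⟨y, z, w, v, h, h', h''⟩)))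
    (by rw [map_sub, e₂, bd₂_bd₃]; simp)
  have := congrArg a hb
  rw [ha, map_sub] at this
  simpa only [a, bd₃, lift_apply_of, map_add, map_sub] using sub_eq_zero.1 this.symm

end Vanishing

/-! ## Coordinates on gerbes -/

section Coordinates

variable {k : Type u} [Field k]

namespace BandedGroupoid.IsGerbe

variable {G : BandedGroupoid k} (hG : G.IsGerbe)

/-- A base object of a gerbe. -/
def base : G := hG.nonempty.some

/-- An arrow from an object to the base object. -/
def toBase (A : G) : A ⟶ hG.base := (hG.connected A hG.base).some

/-- The coordinate in `kˣ` (written additively) of an arrow of a gerbe, with respect to the chosen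
arrows to the base object. -/
def coord {A B : G} (f : A ⟶ B) : Additive kˣ :=
  Additive.ofMul ((Equiv.ofBijective _ (hG.band hG.base)).symm
    (Groupoid.inv (hG.toBase A) ≫ f ≫ hG.toBase B))

/-- The arrow with a given coordinate. -/
def ofCoord (A B : G) (c : Additive kˣ) : A ⟶ B :=
  hG.toBase A ≫ G.sc _ c.toMul ≫ Groupoid.inv (hG.toBase B)


theorem sc_coord {A B : G} (f : A ⟶ B) :
    G.sc hG.base (hG.coord f).toMul = Groupoid.inv (hG.toBase A) ≫ f ≫ hG.toBase B :=
  (Equiv.ofBijective _ (hG.band hG.base)).apply_symm_apply _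

theorem sc_injective (hG : G.IsGerbe) (A : G) : Function.Injective (G.sc A) := (hG.band A).1

/-- An inverse-free description of coordinates as a commuting square over the base object;
additivity under composition is then pasting of squares. -/
theorem coord_eq_iff {A B : G} (f : A ⟶ B) (c : Additive kˣ) :
    hG.coord f = c ↔ f ≫ hG.toBase B = hG.toBase A ≫ G.sc _ c.toMul := by
  have h := hG.sc_coord f
  rw [← cancel_epi (hG.toBase A), ← Category.assoc (hG.toBase A), Groupoid.comp_inv,
    Category.id_comp] at h
  rw [← h, cancel_epi, (hG.sc_injective _).eq_iff]
  rfl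

theorem comp_toBase {A B : G} (f : A ⟶ B) :
    f ≫ hG.toBase B = hG.toBase A ≫ G.sc _ (hG.coord f).toMul :=
  (hG.coord_eq_iff f _).1 rfl

theorem coord_injective {A B : G} {f g : A ⟶ B} (h : hG.coord f = hG.coord g) : f = g := by
  rw [coord_eq_iff, ← comp_toBase, cancel_mono] at h
  exact h

@[simp]
theorem coord_ofCoord (A B : G) (c : Additive kˣ) : hG.coord (hG.ofCoord A B c) = c := by
  rw [coord_eq_iff]
  simp [ofCoord]

@[simp]
theorem coord_comp {A B C : G} (f : A ⟶ B) (g : B ⟶ C) :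
    hG.coord (f ≫ g) = hG.coord f + hG.coord g := by
  rw [coord_eq_iff, Category.assoc, comp_toBase, ← Category.assoc, comp_toBase, Category.assoc,
    ← G.sc_mul]
  rfl

@[simp]
theorem coord_sc (A : G) (c : kˣ) : hG.coord (G.sc A c) = Additive.ofMul c := by
  rw [coord_eq_iff]
  exact G.sc_comm _ _

@[simp]
theorem coord_id (A : G) : hG.coord (𝟙 A) = 0 := by
  rw [← G.sc_one, coord_sc]
  rfl

end BandedGroupoid.IsGerbe

open BandedGroupoid

/-- A functor of gerbes changes coordinates by a coboundary. -/
theorem BandedFunctor.exists_coord_map {G H : BandedGroupoid k} (hG : G.IsGerbe) (hH : H.IsGerbe)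
    (F : BandedFunctor G H) : ∃ u : G → Additive kˣ, ∀ {A B : G} (f : A ⟶ B),
      hH.coord (F.functor.map f) = hG.coord f + u B - u A := by
  refine ⟨fun A => - hH.coord (F.functor.map (hG.toBase A)), fun {A B} f => ?_⟩
  have h := congrArg (fun x => hH.coord (F.functor.map x)) (hG.comp_toBase f)
  simp only [Functor.map_comp, hH.coord_comp, F.map_sc, hH.coord_sc, ofMul_toMul] at h
  rw [← sub_eq_zero] at h ⊢
  rw [← h]
  abel

/-- A functor on the tensor product of two gerbes adds coordinates, up to a coboundary. -/
theorem BandedFunctor.exists_coord_map₂ {G H K : BandedGroupoid k} (hG : G.IsGerbe)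
    (hH : H.IsGerbe) (hK : K.IsGerbe) (F : BandedFunctor (tensor G H) K) :
    ∃ u : G → H → Additive kˣ, ∀ {A A' : G} {B B' : H} (a : A ⟶ A') (b : B ⟶ B'),
      hK.coord (F.map₂ a b) = hG.coord a + hH.coord b + u A' B' - u A B := by
  refine ⟨fun A B => - hK.coord (F.map₂ (hG.toBase A) (hH.toBase B)), fun {A A' B B'} a b => ?_⟩
  -- Over the pair of base objects both arrows are scalars, and in the tensor product a scalar in
  -- either factor is the same arrow, so `F` sends the pair to the product scalar.
  have h₁ : F.map₂ a b ≫ F.map₂ (hG.toBase A') (hH.toBase B') =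
      F.map₂ (hG.toBase A) (hH.toBase B) ≫ K.sc _ ((hG.coord a).toMul * (hH.coord b).toMul) := by
    rw [← F.map₂_comp, hG.comp_toBase, hH.comp_toBase]
    rw [F.map₂_comp, K.sc_mul]
    congr 1
    rw [← Category.id_comp (H.sc _ _), ← Category.comp_id (G.sc hG.base _), F.map₂_comp]
    congr 1
    · exact F.map_sc (tobj hG.base hH.base) _
    · refine Eq.trans ?_ (F.map_sc (tobj hG.base hH.base) _)
      refine congrArg (F.functor.map (X := tobj hG.base hH.base) (Y := tobj hG.base hH.base)) ?_
      have := thom_sc (𝟙 hG.base) (𝟙 hH.base) (hH.coord b).toMul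
      rw [Category.id_comp, Category.id_comp] at this
      exact this.symm
  have h := congrArg hK.coord h₁
  simp only [hK.coord_comp, hK.coord_sc, ofMul_mul, ofMul_toMul] at h
  rw [← sub_eq_zero] at h ⊢
  rw [← h]
  abel

/-- The tensor product of gerbes is a gerbe. -/
theorem isGerbe_tensor {G H : BandedGroupoid k} (hG : G.IsGerbe) (hH : H.IsGerbe) :
    (tensor G H).IsGerbe where
  nonempty := ⟨tobj hG.base hH.base⟩
  connected P Q := ⟨thom (hG.connected P.fst Q.fst).some (hH.connected P.snd Q.snd).some⟩
  band P := by
    constructor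
    · intro c d h
      obtain ⟨e, h₁, h₂⟩ := Quotient.exact (s := tensorSetoid P P) h
      dsimp only at h₁ h₂
      have he : e = 1 := hH.sc_injective _ (by
        rw [H.sc_one, ← Category.id_comp (H.sc _ e)]; exact h₂.symm)
      subst he
      rw [G.sc_one, Category.comp_id] at h₁
      exact (hG.sc_injective _ h₁).symm
    · intro x
      obtain ⟨f, g, rfl⟩ := thom_exists_rep x
      obtain ⟨c, rfl⟩ := (hG.band _).2 f
      obtain ⟨d, rfl⟩ := (hH.band _).2 g
      refine ⟨c * d, ?_⟩
      have := thom_sc (G.sc P.fst c) (𝟙 P.snd) d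
      rw [Category.id_comp, ← G.sc_mul] at this
      exact this

/-- Functors of gerbes are equivalences. -/
theorem BandedFunctor.isEquivalence {G H : BandedGroupoid k} (hG : G.IsGerbe) (hH : H.IsGerbe)
    (F : BandedFunctor G H) : F.functor.IsEquivalence := by
  obtain ⟨u, hu⟩ := F.exists_coord_map hG hH
  refine { faithful := ⟨fun {A B f g} h => ?_⟩, full := ⟨fun {A B} g => ?_⟩, essSurj := ⟨fun B => ?_⟩ }
  · have := congrArg hH.coord h
    rw [hu, hu] at this
    exact hG.coord_injective (by simpa using this)
  · refine ⟨hG.ofCoord A B (hH.coord g + u A - u B), hH.coord_injective ?_⟩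
    rw [hu, hG.coord_ofCoord]
    abel
  · exact ⟨hG.base, ⟨(Groupoid.isoEquivHom _ _).symm (hH.connected _ _).some⟩⟩

/-- The functor from a gerbe to a banded groupoid that sends all objects to a given one and preserves
coordinates. -/
def BandedGroupoid.IsGerbe.constFunctor {G H : BandedGroupoid k} (hG : G.IsGerbe) (T : H) :
    BandedFunctor G H where
  functor :=
    { obj := fun _ => T
      map := fun f => H.sc T (hG.coord f).toMul
      map_id := fun A => by simp [H.sc_one]
      map_comp := fun f g => by simp [H.sc_mul] }
  map_sc A c := by simp

/-- The functor on the tensor product of two gerbes that sends all objects to a given one and adds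
coordinates. -/
def BandedGroupoid.IsGerbe.constFunctor₂ {G H K : BandedGroupoid k} (hG : G.IsGerbe)
    (hH : H.IsGerbe) (T : K) : BandedFunctor (tensor G H) K where
  functor :=
    { obj := fun _ => T
      map := fun {P Q} x => TensorHom.lift (P := P) (Q := Q)
        (fun f g => K.sc T ((hG.coord f + hH.coord g).toMul))
        (fun f g c => by simp [add_right_comm, add_assoc]) x
      map_id := fun P => (congrArg (fun c : Additive kˣ => K.sc T c.toMul)
        (show hG.coord (𝟙 P.fst) + hH.coord (𝟙 P.snd) = 0 by
          rw [hG.coord_id, hH.coord_id, add_zero])).trans (K.sc_one T)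
      map_comp := fun {P Q R} x y => by
        obtain ⟨f, g, rfl⟩ := thom_exists_rep x
        obtain ⟨f', g', rfl⟩ := thom_exists_rep y
        change K.sc T (hG.coord (f ≫ f') + hH.coord (g ≫ g')).toMul =
          K.sc T (hG.coord f + hH.coord g).toMul ≫ K.sc T (hG.coord f' + hH.coord g').toMul
        rw [← K.sc_mul, ← toMul_add, hG.coord_comp, hH.coord_comp, add_add_add_comm] }
  map_sc P c := by
    change K.sc T (hG.coord (G.sc P.fst c) + hH.coord (𝟙 P.snd)).toMul = K.sc T c
    rw [hG.coord_sc, hH.coord_id, add_zero, toMul_ofMul]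

theorem BandedGroupoid.IsGerbe.coord_constFunctor_map {G H : BandedGroupoid k} (hG : G.IsGerbe)
    (hH : H.IsGerbe) (T : H) {A A' : G} (a : A ⟶ A') :
    hH.coord ((hG.constFunctor T).functor.map a) = hG.coord a :=
  hH.coord_sc T _

theorem BandedGroupoid.IsGerbe.coord_constFunctor₂_map₂ {G H K : BandedGroupoid k}
    (hG : G.IsGerbe) (hH : H.IsGerbe) (hK : K.IsGerbe) (T : K) {A A' : G} {B B' : H} (a : A ⟶ A')
    (b : B ⟶ B') :
    hK.coord ((hG.constFunctor₂ hH T).map₂ a b) = hG.coord a + hH.coord b :=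
  hK.coord_sc T _

end Coordinates

/-! ## Volume forms -/

section VolForm

variable {k : Type u} [Field k]

theorem append_update_left {m n : ℕ} {W : Type*} (a : Fin m → W) (b : Fin n → W) (i : Fin m)
    (x : W) : Fin.append (Function.update a i x) b =
      Function.update (Fin.append a b) (Fin.castAdd n i) x := by
  ext j
  refine Fin.addCases (fun j => ?_) (fun j => ?_) j
  · simp [Function.update_apply]
  · have : Fin.natAdd m j ≠ Fin.castAdd n i := fun h => by
      have := congrArg Fin.val h
      simp at this
      omega
    simp [Function.update_of_ne this]

theorem append_update_right {m n : ℕ} {W : Type*} (a : Fin m → W) (b : Fin n → W) (i : Fin n)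
    (x : W) : Fin.append a (Function.update b i x) =
      Function.update (Fin.append a b) (Fin.natAdd m i) x := by
  ext j
  refine Fin.addCases (fun j => ?_) (fun j => ?_) j
  · have : Fin.castAdd n j ≠ Fin.natAdd m i := fun h => by
      have := congrArg Fin.val h
      simp at this
      omega
    simp [Function.update_of_ne this]
  · simp [Function.update_apply]

section

variable {W : Type*} [AddCommGroup W] [Module k W]

/-- An alternating form as a function of its last arguments. -/
def _root_.AlternatingMap.appendRight {m n : ℕ} (f : W [⋀^Fin (m + n)]→ₗ[k] k) (a : Fin m → W) :
    W [⋀^Fin n]→ₗ[k] k where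
  toFun b := f (Fin.append a b)
  map_update_add' := by
    intro inst b i x y
    rw [Subsingleton.elim inst (instDecidableEqFin n)]
    simp only [append_update_right, f.map_update_add]
  map_update_smul' := by
    intro inst b i c x
    rw [Subsingleton.elim inst (instDecidableEqFin n)]
    simp only [append_update_right, f.map_update_smul]
  map_eq_zero_of_eq' b i j h hij := f.map_eq_zero_of_eq _
    (i := Fin.natAdd m i) (j := Fin.natAdd m j) (by simpa using h) (by simpa using hij)

/-- An alternating form as a function of its first arguments. -/
def _root_.AlternatingMap.appendLeft {m n : ℕ} (f : W [⋀^Fin (m + n)]→ₗ[k] k) (b : Fin n → W) :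
    W [⋀^Fin m]→ₗ[k] k where
  toFun a := f (Fin.append a b)
  map_update_add' := by
    intro inst b i x y
    rw [Subsingleton.elim inst (instDecidableEqFin m)]
    simp only [append_update_left, f.map_update_add]
  map_update_smul' := by
    intro inst b i c x
    rw [Subsingleton.elim inst (instDecidableEqFin m)]
    simp only [append_update_left, f.map_update_smul]
  map_eq_zero_of_eq' b i j h hij := f.map_eq_zero_of_eq _
    (i := Fin.castAdd n i) (j := Fin.castAdd n j) (by simpa using h) (by simpa using hij)

/-- A multilinear form that vanishes as soon as one of its arguments lies in a subspace only depends
on its arguments modulo the subspace. -/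
theorem _root_.AlternatingMap.congr_mod {n : ℕ} (f : W [⋀^Fin n]→ₗ[k] k) (K : Submodule k W)
    (hf : ∀ v i, v i ∈ K → f v = 0) {v w : Fin n → W} (hvw : ∀ i, w i - v i ∈ K) : f v = f w := by
  -- Expanding `f (v + (w - v))` over subsets of the indices, every term but that of the full set
  -- has an entry in `K`.
  have h := f.map_add_univ v (w - v)
  rw [add_sub_cancel] at h
  rw [h, Finset.sum_eq_single_of_mem Finset.univ (Finset.mem_univ _), Finset.piecewise_univ]
  intro s _ hs
  obtain ⟨i, hi⟩ : ∃ i, i ∉ s := by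
    by_contra! h
    exact hs (Finset.eq_univ_iff_forall.2 h)
  refine hf _ i ?_
  rw [Finset.piecewise_eq_of_notMem _ _ _ hi]
  exact hvw i

end

variable {W : Type u} [AddCommGroup W] [Module k W] [Module.Finite k W]

theorem finrank_det : Module.finrank k (Det k W) = 1 := by
  rw [exteriorPower.finrank_eq, Nat.choose_self]

variable (k W) in
/-- A trivialization of the determinant line. -/
def detEquiv : Det k W ≃ₗ[k] k :=
  LinearEquiv.ofFinrankEq _ _ (by rw [finrank_det, Module.finrank_self])

/-- The volume form given by the trivialization of the determinant line. -/
def volForm {n : ℕ} (h : Module.finrank k W = n) : W [⋀^Fin n]→ₗ[k] k :=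
  ((detEquiv k W).toLinearMap.compAlternatingMap
    (exteriorPower.ιMulti k (Module.finrank k W))).domDomCongr (finCongr h)

theorem detEquiv_wedge {n : ℕ} (h : Module.finrank k W = n) (w : Fin n → W) :
    detEquiv k W (wedge h w) = volForm h w := rfl

theorem volForm_ne_zero {n : ℕ} (h : Module.finrank k W = n) :
    (volForm h : W [⋀^Fin n]→ₗ[k] k) ≠ 0 := by
  subst h
  intro h
  have : (detEquiv k W).toLinearMap = 0 := by
    apply exteriorPower.linearMap_ext
    ext w
    exact DFunLike.congr_fun h w
  have := LinearMap.congr_fun this ((detEquiv k W).symm 1)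
  simp at this

theorem volForm_basis_ne_zero {n : ℕ} (h : Module.finrank k W = n)
    (e : Module.Basis (Fin n) k W) : volForm h e ≠ 0 :=
  ((volForm h).map_basis_ne_zero_iff e).2 (volForm_ne_zero h)

theorem exists_volForm_ne_zero {n : ℕ} (h : Module.finrank k W = n) : ∃ w, volForm h w ≠ 0 :=
  ⟨_, volForm_basis_ne_zero h (Module.finBasisOfFinrankEq k W h)⟩

theorem volForm_ne_zero_of_span {n : ℕ} (h : Module.finrank k W = n) {w : Fin n → W}
    (hw : ⊤ ≤ Submodule.span k (Set.range w)) : volForm h w ≠ 0 := by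
  have := volForm_basis_ne_zero h (basisOfTopLeSpanOfCardEqFinrank w hw (by simp [h]))
  rwa [coe_basisOfTopLeSpanOfCardEqFinrank] at this

/-- The volume form is a multiple of the determinant in a basis, so where it does not vanish neither
does the determinant. -/
theorem isBasis_of_volForm_ne_zero {n : ℕ} (h : Module.finrank k W = n) {w : Fin n → W}
    (hw : volForm h w ≠ 0) :
    LinearIndependent k w ∧ Submodule.span k (Set.range w) = ⊤ := by
  let e := Module.finBasisOfFinrankEq k W h
  rw [e.is_basis_iff_det, isUnit_iff_ne_zero]
  intro h0
  apply hw
  rw [(volForm h).eq_smul_basis_det e, AlternatingMap.smul_apply, h0, smul_zero]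

/-- A top-degree alternating form is a multiple of the volume form. -/
theorem exists_eq_mul_volForm {n : ℕ} (h : Module.finrank k W = n) (f : W [⋀^Fin n]→ₗ[k] k) :
    ∃ c : k, ∀ w, f w = c * volForm h w := by
  let e := Module.finBasisOfFinrankEq k W h
  have he := volForm_basis_ne_zero h e
  refine ⟨f e / volForm h e, fun w => ?_⟩
  conv_lhs => rw [f.eq_smul_basis_det e]
  conv_rhs => rw [(volForm h).eq_smul_basis_det e]
  simp only [AlternatingMap.smul_apply, smul_eq_mul]
  have hd : e.det e = 1 := e.det_self
  rw [hd]
  field_simp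

/-- Volume forms in a short exact sequence. -/
theorem exists_volForm_append {W₁ W₂ : Type u} [AddCommGroup W₁] [Module k W₁] [Module.Finite k W₁]
    [AddCommGroup W₂] [Module k W₂] [Module.Finite k W₂] {m n : ℕ} (h₁ : Module.finrank k W₁ = m)
    (h₂ : Module.finrank k W₂ = n) (h : Module.finrank k W = m + n) (i : W₁ →ₗ[k] W)
    (p : W →ₗ[k] W₂) (hp : Function.Surjective p)
    (hex : LinearMap.range i = LinearMap.ker p) :
    ∃ c : kˣ, ∀ a b, volForm h (Fin.append (i ∘ a) b) = c * (volForm h₁ a * volForm h₂ (p ∘ b)) := by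
  obtain ⟨a₀, ha₀⟩ := exists_volForm_ne_zero h₁
  obtain ⟨s, hs⟩ := p.exists_rightInverse_of_surjective (LinearMap.range_eq_top.2 hp)
  have hs' : ∀ y, p (s y) = y := LinearMap.congr_fun hs
  have hk : ∀ y ∈ LinearMap.ker p, y ∈ Submodule.span k (Set.range (i ∘ a₀)) := by
    intro y hy
    rw [← hex] at hy
    obtain ⟨x, rfl⟩ := hy
    rw [Set.range_comp, ← LinearMap.coe_coe, ← Submodule.map_span]
    refine Submodule.mem_map_of_mem ?_
    rw [(isBasis_of_volForm_ne_zero h₁ ha₀).2]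
    trivial
  -- A nonzero volume would make the family independent, but a vector of the kernel is already in
  -- the span of the first `m` members. Hence the form depends on `b` only through `p ∘ b`.
  have hker : ∀ b j, b j ∈ LinearMap.ker p → (volForm h).appendRight (i ∘ a₀) b = 0 := by
    intro b j hj
    by_contra hne
    have hli := (isBasis_of_volForm_ne_zero h hne).1
    refine hli.notMem_span_image (s := Set.range (Fin.castAdd n)) (x := Fin.natAdd m j) ?_ ?_
    · rintro ⟨l, hl⟩
      have := congrArg Fin.val hl
      simp at this
      omega
    · rw [← Set.range_comp]
      have e : Fin.append (i ∘ a₀) b ∘ Fin.castAdd n = i ∘ a₀ := by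
        ext l
        simp
      rw [e, Fin.append_right]
      exact hk _ hj
  -- Two applications of uniqueness of top forms: here in `b`, on the quotient by means of the
  -- section `s`; below in `a`, on `W₁`. Evaluating at `a₀` compares the two constants.
  obtain ⟨c, hc⟩ := exists_eq_mul_volForm h₂ (((volForm h).appendRight (i ∘ a₀)).compLinearMap s)
  have hc' : ∀ a b, volForm h (Fin.append (i ∘ a) b) =
      c / volForm h₁ a₀ * (volForm h₁ a * volForm h₂ (p ∘ b)) := by
    intro a b
    obtain ⟨d, hd⟩ := exists_eq_mul_volForm h₁ (((volForm h).appendLeft b).compLinearMap i)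
    have e₁ := hd a
    have e₂ := hd a₀
    have e₃ := hc (p ∘ b)
    rw [AlternatingMap.compLinearMap_apply] at e₁ e₂ e₃
    rw [← AlternatingMap.congr_mod _ (LinearMap.ker p) hker (v := b)
      (fun j => by simp [hs'])] at e₃
    change volForm h (Fin.append (i ∘ a) b) = _ at e₁
    change volForm h (Fin.append (i ∘ a₀) b) = _ at e₂
    change volForm h (Fin.append (i ∘ a₀) b) = _ at e₃
    rw [e₂] at e₃
    rw [e₁]
    field_simp
    linear_combination volForm h₁ a * e₃
  -- A basis of `W₁` together with the lift of a basis of `W₂` spans `W`, so the left-hand side is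
  -- nonzero for that family.
  have hne : c / volForm h₁ a₀ ≠ 0 := by
    intro h0
    obtain ⟨b₀, hb₀⟩ := exists_volForm_ne_zero h₂
    have := hc' a₀ (s ∘ b₀)
    rw [h0, zero_mul] at this
    refine volForm_ne_zero_of_span h ?_ this
    intro x _
    have hr : Set.range (Fin.append (i ∘ a₀) (s ∘ b₀)) =
        Set.range (i ∘ a₀) ∪ Set.range (s ∘ b₀) := by
      ext y
      constructor
      · rintro ⟨j, rfl⟩
        refine Fin.addCases (fun j => ?_) (fun j => ?_) j
        · left; simp
        · right; simp
      · rintro (⟨j, rfl⟩ | ⟨j, rfl⟩)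
        · exact ⟨Fin.castAdd n j, by simp⟩
        · exact ⟨Fin.natAdd m j, by simp⟩
    rw [hr, Submodule.span_union]
    rw [← sub_add_cancel x (s (p x))]
    refine Submodule.add_mem_sup (hk _ (by simp [hs'])) ?_
    rw [Set.range_comp, ← LinearMap.coe_coe, ← Submodule.map_span,
      (isBasis_of_volForm_ne_zero h₂ hb₀).2]
    exact Submodule.mem_map_of_mem trivial
  exact ⟨Units.mk0 _ hne, hc'⟩

end VolForm

/-! ## Linear compactness -/

section LinearlyCompact

variable {k : Type u} [Field k] {A B : Type u} [AddCommGroup A] [Module k A] [TopologicalSpace A]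
  [AddCommGroup B] [Module k B] [TopologicalSpace B]

/-- The indexed form of the finite intersection property, convenient for families of images and
preimages of affine subspaces. -/
theorem LinearlyCompact.iInter_nonempty (h : LinearlyCompact k A) {ι : Type*}
    (F : ι → AffineSubspace k A) (hF : ∀ i, IsClosed (F i : Set A))
    (hfin : ∀ T : Finset ι, (⋂ i ∈ T, (F i : Set A)).Nonempty) :
    (⋂ i, (F i : Set A)).Nonempty := by
  classical
  obtain ⟨x, hx⟩ := h (Set.range F) (by rintro _ ⟨i, rfl⟩; exact hF i) (by
    intro T hT
    rw [← Set.image_univ, Finset.subset_set_image_iff] at hT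
    obtain ⟨T', -, rfl⟩ := hT
    obtain ⟨x, hx⟩ := hfin T'
    exact ⟨x, by simpa using hx⟩)
  exact ⟨x, by simpa using hx⟩

theorem LinearlyCompact.of_isClosedEmbedding (h : LinearlyCompact k A) (f : B →ₗ[k] A)
    (hf : Topology.IsClosedEmbedding f) : LinearlyCompact k B := by
  intro S hS hfin
  obtain ⟨x, hx⟩ := h.iInter_nonempty (fun F : S => F.1.map f.toAffineMap)
    (fun F => by
      rw [AffineSubspace.coe_map]
      exact hf.isClosedMap _ (hS F.1 F.2))
    (fun T => by
      obtain ⟨x, hx⟩ := hfin (T.map (Function.Embedding.subtype _)) (by simp)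
      refine ⟨f x, Set.mem_iInter₂.2 fun F hF => ?_⟩
      rw [AffineSubspace.coe_map]
      exact ⟨x, Set.mem_iInter₂.1 hx F.1 (Finset.mem_map.2 ⟨F, hF, rfl⟩), rfl⟩)
  rw [Set.mem_iInter] at hx
  -- For the empty family the common point found in `A` need not come from `B`.
  rcases S.eq_empty_or_nonempty with rfl | ⟨F₀, hF₀⟩
  · exact ⟨0, by simp⟩
  · obtain ⟨y, -, rfl⟩ := (AffineSubspace.coe_map _ _).subset (hx ⟨F₀, hF₀⟩)
    refine ⟨y, Set.mem_iInter₂.2 fun F hF => ?_⟩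
    obtain ⟨z, hz, hzy⟩ := (AffineSubspace.coe_map _ _).subset (hx ⟨F, hF⟩)
    have : z = y := hf.injective hzy
    exact this ▸ hz

/-- Closed affine subspaces are pulled back; surjectivity keeps the finite intersections nonempty,
and the image of a common point is common. -/
theorem LinearlyCompact.of_surjective (h : LinearlyCompact k A) (f : A →ₗ[k] B)
    (hf : Continuous f) (hs : Function.Surjective f) : LinearlyCompact k B := by
  intro S hS hfin
  obtain ⟨x, hx⟩ := h.iInter_nonempty (fun F : S => F.1.comap f.toAffineMap)
    (fun F => by
      rw [AffineSubspace.coe_comap]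
      exact (hS F.1 F.2).preimage hf)
    (fun T => by
      obtain ⟨x, hx⟩ := hfin (T.map (Function.Embedding.subtype _)) (by simp)
      obtain ⟨y, rfl⟩ := hs x
      exact ⟨y, Set.mem_iInter₂.2 fun F hF =>
        Set.mem_iInter₂.1 hx F.1 (Finset.mem_map.2 ⟨F, hF, rfl⟩)⟩)
  rw [Set.mem_iInter] at hx
  exact ⟨f x, Set.mem_iInter₂.2 fun F hF => hx ⟨F, hF⟩⟩

/-- The preimage of a lattice under a closed embedding is a lattice. -/
theorem IsTateLattice.comap {L : Submodule k A} (hL : IsTateLattice L) (f : B →ₗ[k] A)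
    (hf : Topology.IsClosedEmbedding f) : IsTateLattice (L.comap f) := by
  refine ⟨hL.1.preimage hf.continuous, hL.2.of_isClosedEmbedding
    (f.restrict (p := L.comap f) (q := L) fun _ hx => hx) ?_⟩
  have := hf.restrictPreimage (L : Set A)
  exact this

/-- The image of a lattice under an open continuous map is a lattice. -/
theorem IsTateLattice.map {L : Submodule k A} (hL : IsTateLattice L) (f : A →ₗ[k] B)
    (hf : Continuous f) (ho : IsOpenMap f) : IsTateLattice (L.map f) := by
  refine ⟨ho _ hL.1, hL.2.of_surjective
    (f.restrict (p := L) (q := L.map f) fun _ hx => Submodule.mem_map_of_mem hx) ?_ ?_⟩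
  · exact (hf.comp continuous_subtype_val).subtype_mk _
  · rintro ⟨_, x, hx, rfl⟩
    exact ⟨⟨x, hx⟩, rfl⟩

/-- Open subgroups are closed, so the intersection is a closed subspace of a linearly compact one.
This makes the set of lattices codirected. -/
theorem IsTateLattice.inf [IsTopologicalAddGroup A] {L L' : Submodule k A} (hL : IsTateLattice L)
    (hL' : IsTateLattice L') : IsTateLattice (L ⊓ L') := by
  refine ⟨hL.1.inter hL'.1, hL.2.of_isClosedEmbedding (Submodule.inclusion inf_le_left) ?_⟩
  refine Topology.IsClosedEmbedding.inclusion (s := ((L ⊓ L' : Submodule k A) : Set A))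
    (t := (L : Set A)) inf_le_left ?_
  have h : IsClosed ((L' : Submodule k A) : Set A) := L'.toAddSubgroup.isClosed_of_isOpen hL'.1
  have e : (Subtype.val : ↥(L : Set A) → A) ⁻¹' ((L ⊓ L' : Submodule k A) : Set A) =
      (Subtype.val : ↥(L : Set A) → A) ⁻¹' (L' : Set A) := by
    ext x
    exact ⟨fun hx => hx.2, fun hx => ⟨x.2, hx⟩⟩
  rw [e]
  exact h.preimage continuous_subtype_val

instance [IsTopologicalAddGroup A] : IsDirected (TateLattice k A) (· ≥ ·) :=
  ⟨fun L L' => ⟨⟨L.1 ⊓ L'.1, L.2.inf L'.2⟩,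
    show L.1 ⊓ L'.1 ≤ L.1 from inf_le_left, show L.1 ⊓ L'.1 ≤ L'.1 from inf_le_right⟩⟩

end LinearlyCompact

/-! ## The determinant gerbe -/

section DetGerbe

variable {k : Type u} [Field k] {V : Type u} [AddCommGroup V] [Module k V]

theorem Subquot.proj_surjective {L₁ L₂ : Submodule k V} (h : L₁ ≤ L₂) (L₃ : Submodule k V) :
    Function.Surjective (Subquot.proj h L₃) := by
  intro y
  obtain ⟨y, rfl⟩ := Submodule.mkQ_surjective _ y
  exact ⟨Submodule.Quotient.mk y, rfl⟩

theorem Subquot.range_incl {L₁ L₂ L₃ : Submodule k V} (h₁₂ : L₁ ≤ L₂) (h₂₃ : L₂ ≤ L₃) :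
    LinearMap.range (Subquot.incl L₁ h₂₃) = LinearMap.ker (Subquot.proj h₁₂ L₃) := by
  ext y
  obtain ⟨y, rfl⟩ := Submodule.mkQ_surjective _ y
  constructor
  · rintro ⟨z, hz⟩
    obtain ⟨z, rfl⟩ := Submodule.mkQ_surjective _ z
    rw [← hz]
    exact (Submodule.Quotient.mk_eq_zero _).2 z.2
  · intro hy
    have : (y : V) ∈ L₂ := (Submodule.Quotient.mk_eq_zero (L₂.submoduleOf L₃)).1 hy
    exact ⟨Submodule.Quotient.mk ⟨y, this⟩, rfl⟩

theorem Subquot.proj_incl {L₁ L₂ L₃ L₄ : Submodule k V} (h₁₂ : L₁ ≤ L₂) (h₃₄ : L₃ ≤ L₄)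
    (x : Subquot L₁ L₃) :
    Subquot.proj h₁₂ L₄ (Subquot.incl L₁ h₃₄ x) = Subquot.incl L₂ h₃₄ (Subquot.proj h₁₂ L₃ x) := by
  obtain ⟨x, rfl⟩ := Submodule.mkQ_surjective _ x
  rfl

theorem Subquot.incl_incl {L₁ L₂ L₃ L₄ : Submodule k V} (h₂₃ : L₂ ≤ L₃) (h₃₄ : L₃ ≤ L₄)
    (x : Subquot L₁ L₂) :
    Subquot.incl L₁ h₃₄ (Subquot.incl L₁ h₂₃ x) = Subquot.incl L₁ (h₂₃.trans h₃₄) x := by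
  obtain ⟨x, rfl⟩ := Submodule.mkQ_surjective _ x
  rfl

theorem Subquot.proj_proj {L₁ L₂ L₃ L₄ : Submodule k V} (h₁₂ : L₁ ≤ L₂) (h₂₃ : L₂ ≤ L₃)
    (x : Subquot L₁ L₄) :
    Subquot.proj h₂₃ L₄ (Subquot.proj h₁₂ L₄ x) = Subquot.proj (h₁₂.trans h₂₃) L₄ x := by
  obtain ⟨x, rfl⟩ := Submodule.mkQ_surjective _ x
  rfl

variable [TopologicalSpace V] [IsTopologicalAddGroup V]

instance (L₁ L₂ : TateLattice k V) : Module.Finite k (Subquot L₁.1 L₂.1) :=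
  finite_subquot L₁.2.1 inferInstance L₂.2.2

theorem exists_detCocycle {L₁ L₂ L₃ : TateLattice k V} (h₁₂ : L₁ ≤ L₂) (h₂₃ : L₂ ≤ L₃) :
    ∃ c : kˣ, ∀ (a : Fin (Module.finrank k (Subquot L₁.1 L₂.1)) → Subquot L₁.1 L₂.1)
      (b : Fin (Module.finrank k (Subquot L₂.1 L₃.1)) → Subquot L₁.1 L₃.1),
      volForm (TateLattice.finrank_add h₁₂ h₂₃) (Fin.append (Subquot.incl L₁.1 h₂₃ ∘ a) b) =
        c * (volForm rfl a * volForm rfl (Subquot.proj h₁₂ L₃.1 ∘ b)) :=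
  exists_volForm_append rfl rfl _ _ _ (Subquot.proj_surjective _ _) (Subquot.range_incl h₁₂ h₂₃)

/-- The 2-cocycle on the set of lattices that describes the multiplication of volume forms. -/
def detCocycle {L₁ L₂ L₃ : TateLattice k V} (h₁₂ : L₁ ≤ L₂) (h₂₃ : L₂ ≤ L₃) : kˣ :=
  (exists_detCocycle h₁₂ h₂₃).choose

theorem volForm_append {L₁ L₂ L₃ : TateLattice k V} (h₁₂ : L₁ ≤ L₂) (h₂₃ : L₂ ≤ L₃)
    (a : Fin (Module.finrank k (Subquot L₁.1 L₂.1)) → Subquot L₁.1 L₂.1)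
    (b : Fin (Module.finrank k (Subquot L₂.1 L₃.1)) → Subquot L₁.1 L₃.1) :
    volForm (TateLattice.finrank_add h₁₂ h₂₃) (Fin.append (Subquot.incl L₁.1 h₂₃ ∘ a) b) =
      detCocycle h₁₂ h₂₃ * (volForm rfl a * volForm rfl (Subquot.proj h₁₂ L₃.1 ∘ b)) :=
  (exists_detCocycle h₁₂ h₂₃).choose_spec a b

/-- `volForm_append` for arbitrary proofs that the dimensions are as expected. -/
theorem volForm_append' {L₁ L₂ L₃ : TateLattice k V} (h₁₂ : L₁ ≤ L₂) (h₂₃ : L₂ ≤ L₃) {m n : ℕ}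
    (hm : Module.finrank k (Subquot L₁.1 L₂.1) = m)
    (hn : Module.finrank k (Subquot L₂.1 L₃.1) = n)
    (h : Module.finrank k (Subquot L₁.1 L₃.1) = m + n)
    (a : Fin m → Subquot L₁.1 L₂.1) (b : Fin n → Subquot L₁.1 L₃.1) :
    volForm h (Fin.append (Subquot.incl L₁.1 h₂₃ ∘ a) b) =
      detCocycle h₁₂ h₂₃ * (volForm hm a * volForm hn (Subquot.proj h₁₂ L₃.1 ∘ b)) := by
  subst hm hn
  exact volForm_append h₁₂ h₂₃ a b

theorem volForm_cast {W : Type u} [AddCommGroup W] [Module k W] [Module.Finite k W] {m n : ℕ}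
    (h : Module.finrank k W = m) (e : m = n) (w : Fin n → W) :
    volForm h (w ∘ Fin.cast e) = volForm (h.trans e) w := by
  subst e
  rfl

theorem append_comp {m n : ℕ} {W W' : Type*} (f : W → W') (a : Fin m → W) (b : Fin n → W) :
    f ∘ Fin.append a b = Fin.append (f ∘ a) (f ∘ b) := by
  ext j
  refine Fin.addCases (fun j => ?_) (fun j => ?_) j <;> simp

/-- Associativity of concatenation: the volume of one family of vectors adapted to the filtration of
`L₄ / L₁` is computed with either bracketing, and the nonzero volumes of the graded pieces are
cancelled. -/
theorem detCocycle_mul {L₁ L₂ L₃ L₄ : TateLattice k V} (h₁₂ : L₁ ≤ L₂) (h₂₃ : L₂ ≤ L₃)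
    (h₃₄ : L₃ ≤ L₄) :
    detCocycle (h₁₂.trans h₂₃) h₃₄ * detCocycle h₁₂ h₂₃ =
      detCocycle h₁₂ (h₂₃.trans h₃₄) * detCocycle h₂₃ h₃₄ := by
  obtain ⟨a, ha⟩ := exists_volForm_ne_zero (k := k) (W := Subquot L₁.1 L₂.1) rfl
  obtain ⟨b', hb⟩ := exists_volForm_ne_zero (k := k) (W := Subquot L₂.1 L₃.1) rfl
  obtain ⟨d', hd⟩ := exists_volForm_ne_zero (k := k) (W := Subquot L₃.1 L₄.1) rfl
  -- The families are lifted to quotients by the smallest lattice, so that both concatenations live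
  -- in `L₄ / L₁`.
  obtain ⟨b, rfl⟩ := (Subquot.proj_surjective h₁₂ L₃.1).comp_left b'
  obtain ⟨d, rfl⟩ := (Subquot.proj_surjective (h₁₂.trans h₂₃) L₄.1).comp_left d'
  have e₁ := volForm_append' (h₁₂.trans h₂₃) h₃₄ (TateLattice.finrank_add h₁₂ h₂₃) rfl
    (by rw [← TateLattice.finrank_add h₁₂ h₂₃,
      ← TateLattice.finrank_add (h₁₂.trans h₂₃) h₃₄])
    (Fin.append (Subquot.incl L₁.1 h₂₃ ∘ a) b) d
  have e₂ := volForm_append' h₁₂ (h₂₃.trans h₃₄) rfl (TateLattice.finrank_add h₂₃ h₃₄)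
    (by rw [← TateLattice.finrank_add h₂₃ h₃₄,
      ← TateLattice.finrank_add h₁₂ (h₂₃.trans h₃₄)])
    a (Fin.append (Subquot.incl L₁.1 h₃₄ ∘ b) d)
  rw [volForm_append h₁₂ h₂₃, append_comp, Fin.append_assoc] at e₁
  rw [append_comp] at e₂
  have e₃ : (Subquot.proj h₁₂ L₄.1 ∘ Subquot.incl L₁.1 h₃₄ ∘ b) =
      Subquot.incl L₂.1 h₃₄ ∘ Subquot.proj h₁₂ L₃.1 ∘ b :=
    funext fun j => Subquot.proj_incl h₁₂ h₃₄ (b j)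
  have e₄ : (Subquot.proj h₂₃ L₄.1 ∘ Subquot.proj h₁₂ L₄.1 ∘ d) =
      Subquot.proj (h₁₂.trans h₂₃) L₄.1 ∘ d :=
    funext fun j => Subquot.proj_proj h₁₂ h₂₃ (d j)
  have e₅ : (Subquot.incl L₁.1 h₃₄ ∘ Subquot.incl L₁.1 h₂₃ ∘ a) =
      Subquot.incl L₁.1 (h₂₃.trans h₃₄) ∘ a :=
    funext fun j => Subquot.incl_incl h₂₃ h₃₄ (a j)
  rw [e₃, volForm_append h₂₃ h₃₄, e₄] at e₂
  rw [e₅, volForm_cast, e₂] at e₁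
  have hne := mul_ne_zero (mul_ne_zero ha hb) hd
  refine Units.ext (mul_right_cancel₀ hne ?_)
  push_cast
  linear_combination -e₁

/-- A determinant theory has coordinates: for trivializations of all its lines it is given by a
1-cochain on the set of lattices. -/
theorem DetTheory.exists_coords (Δ : DetTheory k V) :
    ∃ (r : ∀ L, Δ.Δ L ≃ₗ[k] k) (t : ∀ {L₁ L₂ : TateLattice k V}, L₁ ≤ L₂ → kˣ),
      (∀ {L₁ L₂ : TateLattice k V} (h : L₁ ≤ L₂) (x : Δ.Δ L₁) (d : Det k (Subquot L₁.1 L₂.1)),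
        r L₂ (Δ.iso h (x ⊗ₜ d)) = t h * (r L₁ x * detEquiv k _ d)) ∧
      ∀ {L₁ L₂ L₃ : TateLattice k V} (h₁₂ : L₁ ≤ L₂) (h₂₃ : L₂ ≤ L₃),
        t h₂₃ * t h₁₂ = t (h₁₂.trans h₂₃) * detCocycle h₁₂ h₂₃ := by
  have hr : ∀ L, Nonempty (Δ.Δ L ≃ₗ[k] k) := fun L => by
    have : Module.Finite k (Δ.Δ L) :=
      Module.finite_of_finrank_pos (by rw [Δ.finrank_eq_one]; exact one_pos)
    exact ⟨LinearEquiv.ofFinrankEq _ _ (by rw [Δ.finrank_eq_one, Module.finrank_self])⟩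
  obtain ⟨r⟩ : Nonempty (∀ L, Δ.Δ L ≃ₗ[k] k) := ⟨fun L => (hr L).some⟩
  have ht : ∀ {L₁ L₂ : TateLattice k V} (h : L₁ ≤ L₂), ∃ t : kˣ, ∀ (x : Δ.Δ L₁)
      (d : Det k (Subquot L₁.1 L₂.1)),
      r L₂ (Δ.iso h (x ⊗ₜ d)) = t * (r L₁ x * detEquiv k _ d) := by
    intro L₁ L₂ h
    -- In the chosen trivializations the structure isomorphism is a linear automorphism of `k`,
    -- hence multiplication by its value at 1.
    let e := ((TensorProduct.congr (r L₁) (detEquiv k (Subquot L₁.1 L₂.1))).trans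
      (TensorProduct.lid k k)).symm.trans ((Δ.iso h).trans (r L₂))
    have he : e 1 ≠ 0 := by simp
    refine ⟨Units.mk0 _ he, fun x d => ?_⟩
    have e₁ : r L₂ (Δ.iso h (x ⊗ₜ d)) = e (r L₁ x * detEquiv k _ d) := by
      simp only [e, LinearEquiv.trans_apply]
      congr 2
      rw [LinearEquiv.eq_symm_apply]
      simp
    rw [e₁, Units.val_mk0, mul_comm (e 1), ← smul_eq_mul (r L₁ x * _), ← map_smul, smul_eq_mul,
      mul_one]
  choose t ht using @ht
  refine ⟨r, t, ht, fun {L₁ L₂ L₃} h₁₂ h₂₃ => ?_⟩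
  obtain ⟨a, ha⟩ := exists_volForm_ne_zero (k := k) (W := Subquot L₁.1 L₂.1) rfl
  obtain ⟨b', hb⟩ := exists_volForm_ne_zero (k := k) (W := Subquot L₂.1 L₃.1) rfl
  obtain ⟨b, rfl⟩ := (Subquot.proj_surjective h₁₂ L₃.1).comp_left b'
  have h := congrArg (r L₃) (Δ.coherence h₁₂ h₂₃ ((r L₁).symm 1) a b)
  rw [ht, ht, ht, detEquiv_wedge, detEquiv_wedge, detEquiv_wedge, volForm_append h₁₂ h₂₃,
    LinearEquiv.apply_symm_apply] at h
  refine Units.ext (mul_right_cancel₀ (mul_ne_zero ha hb) ?_)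
  push_cast
  linear_combination h

variable [Nonempty (TateLattice k V)]

variable (k V) in
/-- Determinant theories exist. -/
theorem nonempty_detTheory : Nonempty (DetTheory k V) := by
  -- All lines will be `k`; a primitive `t` of the determinant cocycle supplies the scalars in the
  -- structure isomorphisms.
  obtain ⟨t, ht⟩ := exists_coboundary₂ (P := TateLattice k V) (A := Additive kˣ)
    (fun {_ _ _} h₁₂ h₂₃ => Additive.ofMul (detCocycle h₁₂ h₂₃))
    (fun {_ _ _ _} h₁₂ h₂₃ h₃₄ => by
      have := congrArg Additive.ofMul (detCocycle_mul h₁₂ h₂₃ h₃₄)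
      rw [ofMul_mul, ofMul_mul, ← sub_eq_zero] at this
      rw [← neg_eq_zero, ← this]
      abel)
  have ht' : ∀ {L₁ L₂ L₃ : TateLattice k V} (h₁₂ : L₁ ≤ L₂) (h₂₃ : L₂ ≤ L₃),
      ((t h₂₃).toMul : k) * (t h₁₂).toMul = (t (h₁₂.trans h₂₃)).toMul * detCocycle h₁₂ h₂₃ := by
    intro L₁ L₂ L₃ h₁₂ h₂₃
    have h : t h₂₃ + t h₁₂ = t (h₁₂.trans h₂₃) + Additive.ofMul (detCocycle h₁₂ h₂₃) := by
      rw [ht]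
      abel
    have := congrArg (fun x : Additive kˣ => (x.toMul : k)) h
    simpa using this
  have hiso : ∀ {L₁ L₂ : TateLattice k V} (h : L₁ ≤ L₂),
      ∃ e : (ModuleCat.of k k ⊗[k] Det k (Subquot L₁.1 L₂.1)) ≃ₗ[k] ModuleCat.of k k,
        ∀ x d, e (x ⊗ₜ d) = ((t h).toMul : k) * ((show k from x) * detEquiv k _ d) := by
    intro L₁ L₂ h
    refine ⟨((TensorProduct.congr (LinearEquiv.refl k k)
      (detEquiv k (Subquot L₁.1 L₂.1))).trans (TensorProduct.lid k k)).trans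
        (LinearEquiv.smulOfUnit (t h).toMul), fun x d => ?_⟩
    rfl
  choose e he using @hiso
  exact ⟨{
    Δ := fun _ => ModuleCat.of k k
    finrank_eq_one := fun _ => Module.finrank_self k
    iso := fun h => e h
    coherence := fun h₁₂ h₂₃ x a b => by
      rw [he, he, he, detEquiv_wedge, detEquiv_wedge, detEquiv_wedge, volForm_append h₁₂ h₂₃]
      change _ * (_ * (_ * _) * _) = _
      linear_combination ((show k from x) * volForm rfl a *
        volForm rfl (Subquot.proj h₁₂ _ ∘ b)) * ht' h₁₂ h₂₃ }⟩

/-- Any two determinant theories are isomorphic. -/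
theorem DetTheory.nonempty_hom (Δ Δ' : DetTheory k V) : Nonempty (DetTheory.Hom Δ Δ') := by
  obtain ⟨r, t, hr, ht⟩ := Δ.exists_coords
  obtain ⟨r', t', hr', ht'⟩ := Δ'.exists_coords
  -- Both cochains have the same coboundary `detCocycle`, so their difference is a 1-cocycle; a
  -- primitive of it gives the scalars of the isomorphism.
  obtain ⟨e, he⟩ := exists_coboundary₁ (P := TateLattice k V) (A := Additive kˣ)
    (fun {_ _} h => Additive.ofMul (t' h) - Additive.ofMul (t h))
    (fun {_ _ _} h₁₂ h₂₃ => by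
      have h := congrArg Additive.ofMul (ht h₁₂ h₂₃)
      have h' := congrArg Additive.ofMul (ht' h₁₂ h₂₃)
      rw [ofMul_mul, ofMul_mul] at h h'
      have h'' : Additive.ofMul (t' h₂₃) + Additive.ofMul (t' h₁₂) -
        (Additive.ofMul (t h₂₃) + Additive.ofMul (t h₁₂)) - (Additive.ofMul (t' (h₁₂.trans h₂₃)) -
          Additive.ofMul (t (h₁₂.trans h₂₃))) = 0 := by
        rw [h, h']
        abel
      rw [← h'']
      abel)
  have he' : ∀ {L₁ L₂ : TateLattice k V} (h : L₁ ≤ L₂),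
      ((e L₂).toMul : k) * t h = t' h * (e L₁).toMul := by
    intro L₁ L₂ h
    have h₁ : e L₂ + Additive.ofMul (t h) = Additive.ofMul (t' h) + e L₁ := by
      have := sub_eq_zero.2 (he h)
      rw [← sub_eq_zero, ← neg_eq_zero, ← this]
      abel
    have := congrArg (fun x : Additive kˣ => (x.toMul : k)) h₁
    simpa using this
  refine ⟨⟨fun L => (r L).trans ((LinearEquiv.smulOfUnit (e L).toMul).trans (r' L).symm), ?_⟩⟩
  intro L₁ L₂ h x d
  apply (r' L₂).injective
  rw [hr']
  simp only [LinearEquiv.trans_apply, LinearEquiv.apply_symm_apply, hr]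
  change ((e L₂).toMul : k) * _ = _ * (((e L₁).toMul : k) * _ * _)
  linear_combination (r L₁ x * detEquiv k _ d) * he' h

variable (k V) in
/-- The determinant gerbe of a space that has a lattice is a gerbe. -/
theorem isGerbe_detGerbe : (detGerbe k V).IsGerbe where
  nonempty := nonempty_detTheory k V
  connected := DetTheory.nonempty_hom
  band (Δ : DetTheory k V) := by
    obtain ⟨r, t, hr, -⟩ := Δ.exists_coords
    have hsc : ∀ (c : kˣ) L x, (show DetTheory.Hom Δ Δ from (detGerbe k V).sc Δ c).app L x =
      (c : k) • x := fun _ _ _ => rfl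
    constructor
    · intro c d h
      let L : TateLattice k V := Classical.arbitrary _
      have := congrArg (fun f : DetTheory.Hom Δ Δ => r L (f.app L ((r L).symm 1))) h
      simp only [hsc, map_smul] at this
      exact Units.ext (by simpa using this)
    · intro f
      change DetTheory.Hom Δ Δ at f
      have hc : ∀ L, ∃ c : kˣ, ∀ x, f.app L x = (c : k) • x := fun L => by
        have hne : r L (f.app L ((r L).symm 1)) ≠ 0 := by simp
        refine ⟨Units.mk0 _ hne, fun x => (r L).injective ?_⟩
        have hx : x = r L x • (r L).symm 1 := (r L).injective (by simp)
        conv_lhs => rw [hx]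
        simp [mul_comm]
      choose c hc using hc
      have hcc : ∀ {L₁ L₂ : TateLattice k V}, L₁ ≤ L₂ → c L₁ = c L₂ := fun {L₁ L₂} h => by
        have h₁ := congrArg (r L₂) (f.comm h ((r L₁).symm 1) ((detEquiv k _).symm 1))
        rw [hc, hc, map_smul, hr, hr, map_smul] at h₁
        simp only [LinearEquiv.apply_symm_apply, smul_eq_mul, mul_one] at h₁
        rw [mul_comm] at h₁
        exact Units.ext (mul_left_cancel₀ (t h).ne_zero h₁).symm
      let L₀ : TateLattice k V := Classical.arbitrary _
      refine ⟨c L₀, DetTheory.Hom.ext (funext fun L => LinearEquiv.ext fun x => ?_)⟩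
      -- The scalar is constant along inclusions, and any two lattices have a common lower bound.
      obtain ⟨L', h, h'⟩ := exists_le_le L L₀
      rw [hsc, hc, ← hcc h, hcc h']

end DetGerbe

/-! ## Topology of subquotients -/

section Subquotients

variable {k : Type u} [Field k]

theorem Subquot.mkQ_eq_zero {V : Type u} [AddCommGroup V] [Module k V] {L₁ L₂ : Submodule k V} (x : L₂) :
    (L₁.submoduleOf L₂).mkQ x = 0 ↔ (x : V) ∈ L₁ :=
  Submodule.Quotient.mk_eq_zero _

theorem Subquot.map_injective {V V' : Type u} [AddCommGroup V] [Module k V] [AddCommGroup V']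
    [Module k V'] {L₁ L₂ : Submodule k V} {L₁' L₂' : Submodule k V'} (f : V →ₗ[k] V') (h₁ : L₁ ≤ L₁'.comap f)
    (h₂ : L₂ ≤ L₂'.comap f) (h : ∀ x ∈ L₂, f x ∈ L₁' → x ∈ L₁) :
    Function.Injective (Subquot.map f h₁ h₂) := by
  rw [injective_iff_map_eq_zero]
  intro y hy
  obtain ⟨y, rfl⟩ := Submodule.mkQ_surjective _ y
  exact (Subquot.mkQ_eq_zero y).2 (h y y.2 ((Subquot.mkQ_eq_zero (f.restrict h₂ y)).1 hy))

theorem isClosedEmbedding_restrict_id {V : Type u} [AddCommGroup V] [Module k V]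
    [TopologicalSpace V] {L₂ L₃ : Submodule k V} (h : L₂ ≤ L₃)
    (hc : IsClosed (L₂ : Set V)) :
    Topology.IsClosedEmbedding
      (LinearMap.restrict (LinearMap.id : V →ₗ[k] V) (p := L₂) (q := L₃) h) :=
  Topology.IsClosedEmbedding.inclusion (s := (L₂ : Set V)) (t := (L₃ : Set V)) h
    (hc.preimage continuous_subtype_val)

variable {V V' : Type u} [AddCommGroup V] [Module k V] [TopologicalSpace V]
  [AddCommGroup V'] [Module k V'] [TopologicalSpace V']

theorem isLinearTopology_of_isInducing [IsTopologicalAddGroup V'] [IsLinearTopology k V']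
    (f : V →ₗ[k] V') (hf : Topology.IsInducing f) : IsLinearTopology k V := by
  have h := (IsLinearTopology.hasBasis_submodule (M := V') k).comap f
  rw [← map_zero f, ← hf.nhds_eq_comap] at h
  exact IsLinearTopology.mk_of_hasBasis k (s := fun N : Submodule k V' => N.comap f) h

theorem isLinearTopology_of_isOpenQuotientMap [IsLinearTopology k V]
    (f : V →ₗ[k] V') (hf : IsOpenQuotientMap f) : IsLinearTopology k V' := by
  have h := (IsLinearTopology.hasBasis_submodule (M := V) k).map f
  rw [hf.map_nhds_eq, map_zero] at h
  exact IsLinearTopology.mk_of_hasBasis k (s := fun N : Submodule k V => N.map f) h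

/-- A closed subspace of a 1-Tate space is a 1-Tate space. -/
theorem IsTate.of_isClosedEmbedding (h : IsTate k V') (f : V →ₗ[k] V')
    (hf : Topology.IsClosedEmbedding f) : IsTate k V := by
  obtain ⟨h₁, h₂, h₃, h₄, L, hL, hr⟩ := h
  refine ⟨hf.isInducing.topologicalAddGroup f, isLinearTopology_of_isInducing f hf.isInducing,
    hf.isEmbedding.t2Space, hf.isInducing.firstCountableTopology, L.comap f, hL.comap f hf, ?_⟩
  refine (LinearMap.rank_le_of_injective ((L.comap f).mapQ L f le_rfl) ?_).trans hr
  rw [injective_iff_map_eq_zero]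
  intro y hy
  obtain ⟨y, rfl⟩ := Submodule.mkQ_surjective _ y
  have : f y ∈ L := (Submodule.Quotient.mk_eq_zero L).1 hy
  exact (Submodule.Quotient.mk_eq_zero _).2 this

theorem IsTate.of_bijective (h : IsTate k V) (f : V →ₗ[k] V') (hf : IsOpenQuotientMap f)
    (hinj : Function.Injective f) : IsTate k V' := by
  let e := LinearEquiv.ofBijective f ⟨hinj, hf.surjective⟩
  have he : IsHomeomorph e := ⟨hf.continuous, hf.isOpenMap, hinj, hf.surjective⟩
  refine h.of_isClosedEmbedding e.symm.toLinearMap ?_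
  have hs : ⇑e.symm.toLinearMap = (he.homeomorph _).symm :=
    funext fun y => e.symm_apply_eq.2 ((he.homeomorph _).apply_symm_apply y).symm
  rw [hs]
  exact (he.homeomorph _).symm.isClosedEmbedding

theorem Subquot.isOpenQuotientMap_mkQ [IsTopologicalAddGroup V] (L₁ L₂ : Submodule k V) :
    IsOpenQuotientMap (L₁.submoduleOf L₂).mkQ :=
  Submodule.isOpenQuotientMap_mkQ _

variable [IsTopologicalAddGroup V] [IsTopologicalAddGroup V'] {L₁ L₂ : Submodule k V}
  {L₁' L₂' : Submodule k V'}

theorem Subquot.continuous_map (f : V →ₗ[k] V') (hf : Continuous f) (h₁ : L₁ ≤ L₁'.comap f)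
    (h₂ : L₂ ≤ L₂'.comap f) : Continuous (Subquot.map f h₁ h₂) := by
  rw [← (Subquot.isOpenQuotientMap_mkQ L₁ L₂).continuous_comp_iff]
  exact (Subquot.isOpenQuotientMap_mkQ L₁' L₂').continuous.comp
    ((hf.comp continuous_subtype_val).subtype_mk _)

theorem Subquot.isOpenQuotientMap_map (f : V →ₗ[k] V') (h₁ : L₁ ≤ L₁'.comap f)
    (h₂ : L₂ ≤ L₂'.comap f) (hf : IsOpenQuotientMap (f.restrict h₂)) :
    IsOpenQuotientMap (Subquot.map f h₁ h₂) := by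
  rw [← (Subquot.isOpenQuotientMap_mkQ L₁ L₂).of_comp_iff]
  exact (Subquot.isOpenQuotientMap_mkQ L₁' L₂').comp hf

/-- Closedness of an image is tested after pulling back to `L₂'`. By `h'` the kernel of the target
quotient comes from `L₂`, so this pullback is the image of the pullback of `C` to `L₂`, which is
closed by `hf`. -/
theorem Subquot.isClosedEmbedding_map (f : V →ₗ[k] V') (hc : Continuous f)
    (h₁ : L₁ ≤ L₁'.comap f) (h₂ : L₂ ≤ L₂'.comap f)
    (hf : Topology.IsClosedEmbedding (f.restrict h₂)) (h : ∀ x ∈ L₂, f x ∈ L₁' → x ∈ L₁)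
    (h' : L₁' ≤ L₂.map f) : Topology.IsClosedEmbedding (Subquot.map f h₁ h₂) := by
  refine .of_continuous_injective_isClosedMap (Subquot.continuous_map f hc h₁ h₂)
    (Subquot.map_injective f h₁ h₂ h) fun C hC => ?_
  rw [← (Subquot.isOpenQuotientMap_mkQ L₁' L₂').isQuotientMap.isClosed_preimage]
  have e : (L₁'.submoduleOf L₂').mkQ ⁻¹' (Subquot.map f h₁ h₂ '' C) =
      f.restrict h₂ '' ((L₁.submoduleOf L₂).mkQ ⁻¹' C) := by
    ext y
    constructor
    · rintro ⟨c, hc, hcy⟩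
      obtain ⟨x, rfl⟩ := Submodule.mkQ_surjective _ c
      have hy : (L₁'.submoduleOf L₂').mkQ (y - f.restrict h₂ x) = 0 := by
        rw [map_sub, ← hcy]
        exact sub_self _
      rw [Subquot.mkQ_eq_zero] at hy
      obtain ⟨z, hz, hzy⟩ := h' hy
      refine ⟨x + ⟨z, hz⟩, ?_, ?_⟩
      · have : (L₁.submoduleOf L₂).mkQ ⟨z, hz⟩ = 0 :=
          (Subquot.mkQ_eq_zero _).2 (h z hz (hzy ▸ hy))
        rw [Set.mem_preimage, map_add, this, add_zero]
        exact hc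
      · refine Subtype.ext ?_
        change f (x + z) = y
        rw [map_add, hzy]
        exact add_sub_cancel _ _
    · rintro ⟨x, hx, rfl⟩
      exact ⟨_, hx, rfl⟩
  rw [e]
  exact hf.isClosedMap _ (hC.preimage (Subquot.isOpenQuotientMap_mkQ L₁ L₂).continuous)

/-- Subquotients of 1-Tate spaces have lattices. -/
theorem nonempty_tateLattice {W L₁ L₂ U : Submodule k V} (hT : IsTate k (Subquot W U))
    (h : W ≤ L₁) (h₁₂ : L₁ ≤ L₂) (h' : L₂ ≤ U) (hc : IsClosed (L₂ : Set V)) :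
    Nonempty (TateLattice k (Subquot L₁ L₂)) := by
  obtain ⟨Λ, hΛ, -⟩ := hT.exists_lattice
  -- A lattice of `U / W` is restricted to the closed subspace `L₂ / W` and then pushed along the
  -- open quotient `L₂ / W → L₂ / L₁`.
  have hi : Topology.IsClosedEmbedding
      (Subquot.map (LinearMap.id : V →ₗ[k] V) (L₁ := W) (L₁' := W) le_rfl h') :=
    Subquot.isClosedEmbedding_map _ continuous_id _ _ (isClosedEmbedding_restrict_id h' hc)
      (fun _ _ hx => hx) (by rw [Submodule.map_id]; exact h.trans h₁₂)
  have hp : IsOpenQuotientMap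
      (Subquot.map (LinearMap.id : V →ₗ[k] V) (L₂ := L₂) (L₂' := L₂) h le_rfl) :=
    Subquot.isOpenQuotientMap_map _ _ _ IsOpenQuotientMap.id
  exact ⟨⟨_, (hΛ.comap _ hi).map _ hp.continuous hp.isOpenMap⟩⟩

end Subquotients

/-! ## Lattices in 2-Tate spaces -/

namespace Presentation

variable {k : Type u} [Field k] {V : Type u} [AddCommGroup V] [Module k V] [TopologicalSpace V]
  {I J : Type} [LinearOrder I] [LinearOrder J] (P : Presentation k V I J)

/-- The restriction of a presentation to the indices above `i`. -/
def restrict (i : I) : Presentation k V {i' // i ≤ i'} J where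
  W i' := P.W i'
  U := P.U
  countable_I := have := P.countable_I; inferInstance
  countable_J := P.countable_J
  nonempty_I := ⟨⟨i, le_rfl⟩⟩
  nonempty_J := P.nonempty_J
  W_antitone _ _ h := P.W_antitone h
  U_monotone := P.U_monotone
  W_le_U _ j := P.W_le_U _ j
  isTate _ j := P.isTate _ j
  isClosed_U := P.isClosed_U
  exists_mem_U := P.exists_mem_U
  eq_zero x hx := P.eq_zero x fun i' =>
    P.W_antitone (le_max_right i i') (hx ⟨max i i', le_max_left _ _⟩)
  complete j x hx hxx := by
    -- A compatible family on the indices above `i` is extended to all of `I` through `max i`.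
    obtain ⟨y, hy, hyx⟩ := P.complete j (fun i' => x ⟨max i i', le_max_left _ _⟩)
      (fun _ => hx _) (fun i₁ i₂ h => P.W_antitone (le_max_right i i₁)
        (hxx ⟨max i i₁, le_max_left _ _⟩ ⟨max i i₂, le_max_left _ _⟩ (max_le_max le_rfl h)))
    refine ⟨y, hy, fun i' => ?_⟩
    have := hyx i'
    simpa only [max_eq_right i'.2] using this
  isOpen_iff N := by
    rw [P.isOpen_iff]
    refine and_congr_left fun _ => ⟨?_, ?_⟩
    · rintro ⟨i', h⟩
      exact ⟨⟨max i i', le_max_left _ _⟩, (P.W_antitone (le_max_right i i')).trans h⟩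
    · rintro ⟨i', h⟩
      exact ⟨i', h⟩

theorem equivalent_refl : P.Equivalent P :=
  ⟨fun i => ⟨i, le_rfl⟩, fun i => ⟨i, le_rfl⟩, fun i => ⟨i, le_rfl⟩, fun i => ⟨i, le_rfl⟩⟩

theorem equivalent_restrict (i : I) : P.Equivalent (P.restrict i) :=
  ⟨fun i' => ⟨⟨max i i', le_max_left _ _⟩, P.W_antitone (le_max_right i i')⟩,
    fun i' => ⟨i', le_rfl⟩, fun j => ⟨j, le_rfl⟩, fun j => ⟨j, le_rfl⟩⟩

variable [IsTopologicalAddGroup V]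

/-- `U j / W i` is Hausdorff, so `W i` is closed in `U j`, which is closed in `V`. -/
theorem isClosed_W (i : I) : IsClosed (P.W i : Set V) := by
  obtain ⟨j⟩ := P.nonempty_J
  have := (P.isTate i j).t2
  have h : IsClosed ((P.W i).submoduleOf (P.U j) : Set (P.U j)) := by
    have : ((P.W i).submoduleOf (P.U j) : Set (P.U j)) =
        ((P.W i).submoduleOf (P.U j)).mkQ ⁻¹' {0} := by
      ext x
      exact (Subquot.mkQ_eq_zero x).symm
    rw [this]
    exact isClosed_singleton.preimage (Subquot.isOpenQuotientMap_mkQ _ _).continuous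
  have h' := (P.isClosed_U j).isClosedMap_subtype_val _ h
  have e : Subtype.val '' ((P.W i).submoduleOf (P.U j) : Set (P.U j)) = (P.W i : Set V) := by
    ext x
    constructor
    · rintro ⟨y, hy, rfl⟩
      exact hy
    · intro hx
      exact ⟨⟨x, P.W_le_U i j hx⟩, hx, rfl⟩
  exact e ▸ h'

theorem isClosedEmbedding_sub (i : I) (i' : {i' // i ≤ i'}) (j : J) :
    ∃ (hW : (P.W i').submoduleOf (P.W i) ≤ (P.W i').comap (P.W i).subtype)
      (hU : ⊤ ≤ (P.U j).comap (P.W i).subtype),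
      Topology.IsClosedEmbedding (Subquot.map (P.W i).subtype hW hU) := by
  refine ⟨fun _ hx => hx, fun x _ => P.W_le_U i j x.2, ?_⟩
  refine Subquot.isClosedEmbedding_map _ continuous_subtype_val _ _ ?_ (fun _ _ hx => hx) ?_
  · refine ((P.isClosed_U j).isClosedEmbedding_subtypeVal).of_comp_iff.1 ?_
    exact (P.isClosed_W i).isClosedEmbedding_subtypeVal.comp
      (isClosed_univ (X := P.W i)).isClosedEmbedding_subtypeVal
  · rw [Submodule.map_top, Submodule.range_subtype]
    exact P.W_antitone i'.2

/-- The presentation of `W i` that is constant in the ind-direction. -/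
def sub [IsLinearTopology k V] (i : I) : Presentation k (P.W i) {i' // i ≤ i'} J where
  W i' := (P.W i').submoduleOf (P.W i)
  U _ := ⊤
  countable_I := have := P.countable_I; inferInstance
  countable_J := P.countable_J
  nonempty_I := ⟨⟨i, le_rfl⟩⟩
  nonempty_J := P.nonempty_J
  W_antitone _ _ h _ hx := P.W_antitone h hx
  U_monotone _ _ _ := le_rfl
  W_le_U _ _ := le_top
  isTate i' j := by
    obtain ⟨hW, hU, h⟩ := P.isClosedEmbedding_sub i i' j
    exact (P.isTate i' j).of_isClosedEmbedding _ h
  isClosed_U _ := isClosed_univ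
  exists_mem_U x := have := P.nonempty_J; ⟨Classical.arbitrary J, trivial⟩
  eq_zero x hx := Subtype.ext ((P.restrict i).eq_zero x hx)
  complete j x _ hxx := by
    obtain ⟨y, -, hyx⟩ := (P.restrict i).complete j (fun i' => x i')
      (fun i' => P.W_le_U i j (x i').2) hxx
    refine ⟨⟨y, ?_⟩, trivial, hyx⟩
    -- At the least index `i` the limit differs from an element of `W i` by an element of `W i`, so
    -- it lies there.
    have := (P.W i).add_mem (hyx ⟨i, le_rfl⟩) (x ⟨i, le_rfl⟩).2
    rwa [sub_add_cancel] at this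
  isOpen_iff N := by
    constructor
    · intro hN
      refine ⟨?_, fun j => hN.preimage continuous_subtype_val⟩
      have hN0 : (N : Set (P.W i)) ∈ nhds 0 := hN.mem_nhds N.zero_mem
      rw [nhds_subtype_eq_comap, Filter.mem_comap] at hN0
      obtain ⟨O, hO, hON⟩ := hN0
      obtain ⟨M, hM, hMO⟩ := (IsLinearTopology.hasBasis_open_submodule k).mem_iff.1 hO
      obtain ⟨⟨i', hi'⟩, -⟩ := ((P.restrict i).isOpen_iff M).1 hM
      exact ⟨i', fun x hx => hON (hMO (hi' hx))⟩
    · rintro ⟨-, h⟩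
      obtain ⟨j⟩ := P.nonempty_J
      have := (isOpen_univ (X := P.W i)).isOpenMap_subtype_val _ (h j)
      have e : Subtype.val '' ((↑) ⁻¹' (N : Set (P.W i)) : Set (Set.univ : Set (P.W i))) = N := by
        ext x
        constructor
        · rintro ⟨y, hy, rfl⟩
          exact hy
        · intro hx
          exact ⟨⟨x, trivial⟩, hx, rfl⟩
      rwa [← e]

/-- Restricting an open quotient map to a subspace keeps it open when the subspace is saturated;
here `U j` contains the kernel `W i`. -/
theorem isOpenQuotientMap_quot (i : I) (j : J) :
    IsOpenQuotientMap ((P.W i).mkQ.restrict (p := P.U j) (q := (P.U j).map (P.W i).mkQ)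
      (fun _ hx => Submodule.mem_map_of_mem hx)) := by
  have hq : IsOpenQuotientMap (P.W i).mkQ := (P.W i).isOpenQuotientMap_mkQ
  refine ⟨?_, (hq.continuous.comp continuous_subtype_val).subtype_mk _, ?_⟩
  · rintro ⟨_, x, hx, rfl⟩
    exact ⟨⟨x, hx⟩, rfl⟩
  · intro O hO
    obtain ⟨O', hO', rfl⟩ := isOpen_induced_iff.1 hO
    refine isOpen_induced_iff.2 ⟨_, hq.isOpenMap _ hO', ?_⟩
    ext ⟨y, x, hx, rfl⟩
    constructor
    · rintro ⟨z, hz, hzx⟩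
      have : z - x ∈ P.W i := by
        rw [← (P.W i).ker_mkQ, LinearMap.mem_ker, map_sub, sub_eq_zero]
        exact hzx
      have hzU : z ∈ P.U j := by
        have := (P.U j).add_mem (P.W_le_U i j this) hx
        rwa [sub_add_cancel] at this
      exact ⟨⟨z, hzU⟩, hz, Subtype.ext hzx⟩
    · rintro ⟨z, hz, hzx⟩
      exact ⟨z, hz, congrArg Subtype.val hzx⟩

/-- The presentation of `V / W i` that is constant in the pro-direction. -/
def quot (i : I) : Presentation k (V ⧸ P.W i) {i' // i ≤ i'} J where
  W _ := ⊥
  U j := (P.U j).map (P.W i).mkQ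
  countable_I := have := P.countable_I; inferInstance
  countable_J := P.countable_J
  nonempty_I := ⟨⟨i, le_rfl⟩⟩
  nonempty_J := P.nonempty_J
  W_antitone _ _ _ := le_rfl
  U_monotone _ _ h := Submodule.map_mono (P.U_monotone h)
  W_le_U _ _ := bot_le
  isTate _ j := by
    refine (P.isTate i j).of_bijective (Subquot.map (P.W i).mkQ (fun x hx => ?_)
      (fun _ hx => Submodule.mem_map_of_mem hx))
      (Subquot.isOpenQuotientMap_map _ _ _ (P.isOpenQuotientMap_quot i j))
      (Subquot.map_injective _ _ _ fun x _ hx => ?_)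
    · exact (Submodule.Quotient.mk_eq_zero _).2 hx
    · exact (Submodule.Quotient.mk_eq_zero _).1 hx
  isClosed_U j := by
    rw [← (P.W i).isOpenQuotientMap_mkQ.isQuotientMap.isClosed_preimage]
    have : (P.W i).mkQ ⁻¹' ((P.U j).map (P.W i).mkQ : Submodule k (V ⧸ P.W i)) =
        (P.U j : Set V) := by
      rw [← Submodule.comap_coe, Submodule.comap_map_mkQ, sup_eq_right.2 (P.W_le_U i j)]
    rw [this]
    exact P.isClosed_U j
  exists_mem_U x := by
    obtain ⟨x, rfl⟩ := (P.W i).mkQ_surjective x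
    obtain ⟨j, hj⟩ := P.exists_mem_U x
    exact ⟨j, Submodule.mem_map_of_mem hj⟩
  eq_zero x hx := hx ⟨i, le_rfl⟩
  -- With all `W` equal to zero a compatible family is constant, so its value at the least index is
  -- the limit.
  complete j x hx hxx := ⟨x ⟨i, le_rfl⟩, hx _, fun i' => by
    have := hxx ⟨i, le_rfl⟩ i' i'.2
    rw [← neg_mem_iff, neg_sub]
    exact this⟩
  isOpen_iff N := by
    constructor
    · exact fun h => ⟨⟨⟨i, le_rfl⟩, bot_le⟩, fun j => h.preimage continuous_subtype_val⟩
    · rintro ⟨-, h⟩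
      rw [← (P.W i).isOpenQuotientMap_mkQ.isQuotientMap.isOpen_preimage, ← Submodule.comap_coe,
        P.isOpen_iff]
      refine ⟨⟨i, fun x hx => ?_⟩, fun j => ?_⟩
      · have h0 : (P.W i).mkQ x = 0 := (Submodule.Quotient.mk_eq_zero _).2 hx
        rw [Submodule.mem_comap, h0]
        exact N.zero_mem
      · exact (h j).preimage (P.isOpenQuotientMap_quot i j).continuous

/-- At level `(i', j)` this is the sequence of `W i / W i'`, `U j / W i'` and `U j / W i`. It
requires `W i' ≤ W i`, which is why the indices are restricted to those above `i`. -/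
theorem isLevelExact [IsLinearTopology k V] (i : I) :
    (P.sub i).IsLevelExact (P.restrict i) (P.quot i) (P.W i).subtype (P.W i).mkQ := by
  intro i' j
  obtain ⟨hW, hU, h⟩ := P.isClosedEmbedding_sub i i' j
  refine ⟨hW, hU, fun x hx => (Submodule.Quotient.mk_eq_zero _).2 (P.W_antitone i'.2 hx),
    fun _ hx => Submodule.mem_map_of_mem hx, h,
    Subquot.isOpenQuotientMap_map _ _ _ (P.isOpenQuotientMap_quot i j), fun y => ?_⟩
  obtain ⟨y, rfl⟩ := Submodule.mkQ_surjective _ y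
  constructor
  · intro hy
    have hy' : (P.W i).mkQ y.1 = 0 :=
      (Submodule.mem_bot k).1 ((Subquot.mkQ_eq_zero (L₁ := ⊥) _).1 hy)
    have : y.1 ∈ P.W i := (Submodule.Quotient.mk_eq_zero _).1 hy'
    exact ⟨Submodule.Quotient.mk ⟨⟨y.1, this⟩, trivial⟩, rfl⟩
  · rintro ⟨x, hx⟩
    obtain ⟨x, rfl⟩ := Submodule.mkQ_surjective _ x
    rw [← hx]
    refine (Subquot.mkQ_eq_zero (L₁ := ⊥) _).2 ((Submodule.mem_bot k).2 ?_)
    exact (Submodule.Quotient.mk_eq_zero _).2 x.1.2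

end Presentation

/-! ### Lattices coming from the presentation; compact and discrete objects -/

namespace TwoTate

variable {k : Type u} [Field k] (X : TwoTate k)

/-- The subspaces `W i` of the presentation of a 2-Tate space are lattices. -/
theorem isLattice_W (i : X.I) : X.IsLattice (X.pres.W i) := by
  let K : TwoTate k :=
    { carrier := X.pres.W i
      linear := isLinearTopology_of_isInducing (X.pres.W i).subtype Topology.IsInducing.subtypeVal
      I := {i' // i ≤ i'}
      J := X.J
      pres := X.pres.sub i }
  let Q : TwoTate k :=
    { carrier := X ⧸ X.pres.W i
      linear := isLinearTopology_of_isOpenQuotientMap (X.pres.W i).mkQ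
        (X.pres.W i).isOpenQuotientMap_mkQ
      I := {i' // i ≤ i'}
      J := X.J
      pres := X.pres.quot i }
  let f : TwoTate.Hom K X :=
    { map := (X.pres.W i).subtypeL
      map_U := fun j => ⟨j, fun x _ => X.pres.W_le_U i j x.2⟩
      map_W := fun i' => ⟨⟨max i i', le_max_left _ _⟩, fun x hx =>
        X.pres.W_antitone (le_max_right i i') hx⟩ }
  let g : TwoTate.Hom X Q :=
    { map := (X.pres.W i).mkQL
      map_U := fun j => ⟨j, fun x hx => Submodule.mem_map_of_mem hx⟩
      map_W := fun _ => ⟨i, fun x hx => (Submodule.Quotient.mk_eq_zero _).2 hx⟩ }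
  refine ⟨K, Q, f, g, ⟨_, _, inferInstance, inferInstance, X.pres.sub i, X.pres.restrict i,
    X.pres.quot i, K.pres.equivalent_refl, X.pres.equivalent_restrict i, Q.pres.equivalent_refl,
    X.pres.isLevelExact i⟩, ⟨_, _, inferInstance, inferInstance, K.pres, K.pres.equivalent_refl,
      fun _ _ => rfl⟩, ⟨_, _, inferInstance, inferInstance, Q.pres, Q.pres.equivalent_refl,
      fun _ _ => rfl⟩, ?_⟩
  exact (X.pres.W i).range_subtype

variable {X}

/-- A constant filtration that exhausts the space equals the whole space, and equivalent
presentations have mutually cofinal filtrations. Dually, for discrete objects, a constant `W` with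
zero intersection is zero. -/
theorem IsCompactObject.exists_U_eq_top (h : X.IsCompactObject) {I J : Type} [LinearOrder I]
    [LinearOrder J] {P : Presentation k X I J} (hP : X.pres.Equivalent P) : ∃ j, P.U j = ⊤ := by
  obtain ⟨I', J', _, _, P', hP', hU⟩ := h
  obtain ⟨j'⟩ := P'.nonempty_J
  obtain ⟨j₁, h₁⟩ := hP'.2.2.2 j'
  obtain ⟨j, h₂⟩ := hP.2.2.1 j₁
  refine ⟨j, eq_top_iff.2 fun x _ => h₂ (h₁ ?_)⟩
  obtain ⟨j'', hj''⟩ := P'.exists_mem_U x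
  rwa [hU j' j'']

theorem IsDiscreteObject.exists_W_eq_bot (h : X.IsDiscreteObject) {I J : Type} [LinearOrder I]
    [LinearOrder J] {P : Presentation k X I J} (hP : X.pres.Equivalent P) : ∃ i, P.W i = ⊥ := by
  obtain ⟨I', J', _, _, P', hP', hW⟩ := h
  obtain ⟨i'⟩ := P'.nonempty_I
  obtain ⟨i₁, h₁⟩ := hP'.2.1 i'
  obtain ⟨i, h₂⟩ := hP.1 i₁
  refine ⟨i, eq_bot_iff.2 fun x hx => (Submodule.mem_bot k).2 (P'.eq_zero x fun i'' => ?_)⟩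
  rw [hW i'' i']
  exact h₁ (h₂ hx)

end TwoTate

/-- Levelwise exact sequences are exact in the middle. -/
theorem Presentation.IsLevelExact.exact {k : Type u} [Field k] {K V Q : Type u} [AddCommGroup K]
    [Module k K] [TopologicalSpace K] [AddCommGroup V] [Module k V] [TopologicalSpace V]
    [AddCommGroup Q] [Module k Q] [TopologicalSpace Q] {I J : Type} [LinearOrder I] [LinearOrder J]
    {PK : Presentation k K I J} {PV : Presentation k V I J} {PQ : Presentation k Q I J}
    {f : K →ₗ[k] V} {g : V →ₗ[k] Q} (h : PK.IsLevelExact PV PQ f g) {y : V} (hy : g y = 0) :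
    y ∈ LinearMap.range f := by
  obtain ⟨j, hj⟩ := PV.exists_mem_U y
  -- Exactness at each level gives approximate preimages. Injectivity at each level makes them a
  -- compatible family, whose limit in `K` is a true preimage because the intersection of the `PV.W
  -- i` is zero.
  have hx : ∀ i, ∃ x ∈ PK.U j, y - f x ∈ PV.W i := by
    intro i
    obtain ⟨fW, fU, gW, gU, -, -, hex⟩ := h i j
    obtain ⟨x, hx⟩ := (hex ((PV.W i).submoduleOf (PV.U j) |>.mkQ ⟨y, hj⟩)).1 (by
      refine (Subquot.mkQ_eq_zero (g.restrict gU ⟨y, hj⟩)).2 ?_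
      change g y ∈ _
      rw [hy]
      exact Submodule.zero_mem _)
    obtain ⟨x, rfl⟩ := Submodule.mkQ_surjective _ x
    refine ⟨x, x.2, ?_⟩
    have : ((PV.W i).submoduleOf (PV.U j)).mkQ (⟨y, hj⟩ - f.restrict fU x) = 0 := by
      rw [map_sub, ← hx]
      exact sub_self _
    exact (Subquot.mkQ_eq_zero _).1 this
  choose x hxU hx using hx
  obtain ⟨z, hz, hzx⟩ := PK.complete j x hxU (fun i i' hii' => by
    obtain ⟨fW, fU, gW, gU, hf, -, -⟩ := h i j
    have h₁ : f (x i' - x i) ∈ PV.W i := by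
      have := (PV.W i).sub_mem (hx i) (PV.W_antitone hii' (hx i'))
      rwa [sub_sub_sub_cancel_left, ← map_sub] at this
    have hm : x i' - x i ∈ PK.U j := (PK.U j).sub_mem (hxU _) (hxU _)
    refine (Subquot.mkQ_eq_zero (⟨x i' - x i, hm⟩ : PK.U j)).1 (hf.injective ?_)
    rw [map_zero]
    exact (Subquot.mkQ_eq_zero (f.restrict fU ⟨x i' - x i, hm⟩)).2 h₁)
  refine ⟨z, (sub_eq_zero.1 (PV.eq_zero _ fun i => ?_)).symm⟩
  obtain ⟨fW, -⟩ := h i j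
  have := (PV.W i).sub_mem (hx i) (fW (hzx i))
  rwa [map_sub, sub_sub_sub_cancel_right] at this

/-! ### Bounds for lattices and the determinant gerbes of their quotients -/

namespace TwoTate

variable {k : Type u} [Field k] {X : TwoTate k}

/-- Compactness of the subobject puts `L` inside one `U j`, and discreteness of the quotient puts
some `W i` inside `L`. At that level `L` is the preimage in `U j` of a closed subspace of `U j / W
i`. -/
theorem IsLattice.bounds {L : Submodule k X} (hL : X.IsLattice L) :
    (∃ i, X.pres.W i ≤ L) ∧ (∃ j, L ≤ X.pres.U j) ∧ IsClosed (L : Set X) := by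
  obtain ⟨K, Q, f, g, ⟨I, J, _, _, PK, PX, PQ, eK, eX, eQ, hex⟩, hK, hQ, rfl⟩ := hL
  obtain ⟨j, hj⟩ := hK.exists_U_eq_top eK
  obtain ⟨i, hi⟩ := hQ.exists_W_eq_bot eQ
  obtain ⟨fW, fU, gW, gU, hf, -, -⟩ := hex i j
  have h₁ : PX.W i ≤ LinearMap.range f.map.toLinearMap := fun y hy =>
    hex.exact ((Submodule.mem_bot k).1 (hi ▸ gW hy))
  have h₂ : LinearMap.range f.map.toLinearMap ≤ PX.U j := by
    rintro _ ⟨x, rfl⟩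
    exact fU (hj ▸ Submodule.mem_top)
  obtain ⟨i', hi'⟩ := eX.2.1 i
  obtain ⟨j', hj'⟩ := eX.2.2.2 j
  refine ⟨⟨i', hi'.trans h₁⟩, ⟨j', h₂.trans hj'⟩, ?_⟩
  have hc := (PX.isClosed_U j).isClosedMap_subtype_val _
    (hf.isClosed_range.preimage (Subquot.isOpenQuotientMap_mkQ (PX.W i) (PX.U j)).continuous)
  convert hc using 1
  ext y
  constructor
  · rintro ⟨x, rfl⟩
    have hx : x ∈ PK.U j := hj ▸ Submodule.mem_top
    exact ⟨⟨f.map x, fU hx⟩, ⟨Submodule.Quotient.mk ⟨x, hx⟩, rfl⟩, rfl⟩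
  · rintro ⟨⟨y, hy⟩, ⟨x, hx⟩, rfl⟩
    obtain ⟨x, rfl⟩ := Submodule.mkQ_surjective _ x
    have h0 : ((PX.W i).submoduleOf (PX.U j)).mkQ (⟨y, hy⟩ - f.map.toLinearMap.restrict fU x) =
        0 := by
      rw [map_sub, ← hx]
      exact sub_self _
    have h0' := h₁ ((Subquot.mkQ_eq_zero _).1 h0)
    have := (LinearMap.range f.map.toLinearMap).add_mem h0' ⟨x.1, rfl⟩
    change y - f.map x.1 + f.map x.1 ∈ _ at this
    rwa [sub_add_cancel] at this

variable (X) in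
theorem exists_le_lattice (L L' : X.Lattice) :
    ∃ i, X.pres.W i ≤ L.1 ∧ X.pres.W i ≤ L'.1 := by
  obtain ⟨⟨i, hi⟩, -⟩ := L.2.bounds
  obtain ⟨⟨i', hi'⟩, -⟩ := L'.2.bounds
  exact ⟨max i i', (X.pres.W_antitone (le_max_left _ _)).trans hi,
    (X.pres.W_antitone (le_max_right _ _)).trans hi'⟩

/-- No intersection of lattices is needed: a small enough `W i` lies in both and is itself a
lattice. -/
instance : IsDirected X.Lattice (· ≥ ·) :=
  ⟨fun L L' => by
    obtain ⟨i, h, h'⟩ := X.exists_le_lattice L L'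
    exact ⟨⟨_, X.isLattice_W i⟩, h, h'⟩⟩

instance : Nonempty X.Lattice :=
  have := X.pres.nonempty_I
  ⟨⟨_, X.isLattice_W (Classical.arbitrary X.I)⟩⟩

/-- The determinant gerbes of the quotients of lattices of a 2-Tate space are gerbes. -/
theorem isGerbe_det {L₁ L₂ : X.Lattice} (h : L₁ ≤ L₂) : (TwoTate.det L₁ L₂).IsGerbe := by
  obtain ⟨⟨i, hi⟩, -⟩ := L₁.2.bounds
  obtain ⟨-, ⟨j, hj⟩, hc⟩ := L₂.2.bounds
  have := nonempty_tateLattice (X.pres.isTate i j) hi h hj hc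
  exact isGerbe_detGerbe k _

end TwoTate

/-! ## Gerbel theories form a 2-gerbe -/

section TwoGerbe

variable {k : Type u} [Field k] {X : TwoTate k}

open TwoTate (isGerbe_det)

/-- Multiplicative structures exist: gerbes over a point are trivial, so chosen trivializations of the
determinant gerbes give equivalences that add the coordinates of arrows; these are strictly
associative. -/
theorem nonempty_detMul (X : TwoTate k) : Nonempty (DetMul X) :=
  ⟨{ μ := fun h₁₂ h₂₃ => (isGerbe_det h₁₂).constFunctor₂ (isGerbe_det h₂₃)
        (isGerbe_det (h₁₂.trans h₂₃)).base
     μ_equiv := fun h₁₂ h₂₃ => BandedFunctor.isEquivalence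
        (isGerbe_tensor (isGerbe_det h₁₂) (isGerbe_det h₂₃)) (isGerbe_det (h₁₂.trans h₂₃)) _
     α := fun h₁₂ h₂₃ h₃₄ _ _ _ => (isGerbe_det (h₁₂.trans (h₂₃.trans h₃₄))).ofCoord _ _ 0
     α_natural := fun h₁₂ h₂₃ h₃₄ => fun a b c => by
        apply (isGerbe_det (h₁₂.trans (h₂₃.trans h₃₄))).coord_injective
        simp only [BandedGroupoid.IsGerbe.coord_comp, BandedGroupoid.IsGerbe.coord_ofCoord,
          BandedGroupoid.IsGerbe.coord_constFunctor₂_map₂]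
        abel
     cube := fun h₁₂ h₂₃ h₃₄ h₄₅ A B C D => by
        apply (isGerbe_det (h₁₂.trans (h₂₃.trans (h₃₄.trans h₄₅)))).coord_injective
        simp only [BandedGroupoid.IsGerbe.coord_comp, BandedGroupoid.IsGerbe.coord_ofCoord,
          BandedGroupoid.IsGerbe.coord_constFunctor₂_map₂, BandedGroupoid.IsGerbe.coord_id]
        abel }⟩

/-- The coordinates of a multiplicative structure: a 3-cochain with values in `kˣ`, together with
the cochains measuring the dependence of the structure on the objects. -/
structure DetMul.Coords (M : DetMul X) where
  u : ∀ {L₁ L₂ L₃ : X.Lattice}, L₁ ≤ L₂ → L₂ ≤ L₃ → TwoTate.det L₁ L₂ → TwoTate.det L₂ L₃ →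
    Additive kˣ
  coord_μ : ∀ {L₁ L₂ L₃ : X.Lattice} (h₁₂ : L₁ ≤ L₂) (h₂₃ : L₂ ≤ L₃) {A A' : TwoTate.det L₁ L₂}
    {B B' : TwoTate.det L₂ L₃} (a : A ⟶ A') (b : B ⟶ B'),
    (isGerbe_det (h₁₂.trans h₂₃)).coord ((M.μ h₁₂ h₂₃).map₂ a b) =
      (isGerbe_det h₁₂).coord a + (isGerbe_det h₂₃).coord b + u h₁₂ h₂₃ A' B' - u h₁₂ h₂₃ A B
  a : ∀ {L₁ L₂ L₃ L₄ : X.Lattice}, L₁ ≤ L₂ → L₂ ≤ L₃ → L₃ ≤ L₄ → Additive kˣ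
  coord_α : ∀ {L₁ L₂ L₃ L₄ : X.Lattice} (h₁₂ : L₁ ≤ L₂) (h₂₃ : L₂ ≤ L₃) (h₃₄ : L₃ ≤ L₄)
    (A : TwoTate.det L₁ L₂) (B : TwoTate.det L₂ L₃) (C : TwoTate.det L₃ L₄),
    (isGerbe_det (h₁₂.trans (h₂₃.trans h₃₄))).coord (M.α h₁₂ h₂₃ h₃₄ A B C) =
      a h₁₂ h₂₃ h₃₄ + u h₂₃ h₃₄ B C + u h₁₂ (h₂₃.trans h₃₄) A ((M.μ h₂₃ h₃₄).obj₂ B C) -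
        u h₁₂ h₂₃ A B - u (h₁₂.trans h₂₃) h₃₄ ((M.μ h₁₂ h₂₃).obj₂ A B) C

/-- Naturality along the arrows to the base objects shows that, after subtracting the `u`-terms, the
coordinate of the associator is the same for all objects. Its value at the base objects defines `a`;
the analogous constants below arise in the same way. -/
theorem DetMul.nonempty_coords (M : DetMul X) : Nonempty M.Coords := by
  choose u hu using fun {L₁ L₂ L₃ : X.Lattice} (h₁₂ : L₁ ≤ L₂) (h₂₃ : L₂ ≤ L₃) =>
    (M.μ h₁₂ h₂₃).exists_coord_map₂ (isGerbe_det h₁₂) (isGerbe_det h₂₃)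
      (isGerbe_det (h₁₂.trans h₂₃))
  have ha : ∀ {L₁ L₂ L₃ L₄ : X.Lattice} (h₁₂ : L₁ ≤ L₂) (h₂₃ : L₂ ≤ L₃) (h₃₄ : L₃ ≤ L₄),
      ∃ a : Additive kˣ, ∀ (A : TwoTate.det L₁ L₂) (B : TwoTate.det L₂ L₃) (C : TwoTate.det L₃ L₄),
        (isGerbe_det (h₁₂.trans (h₂₃.trans h₃₄))).coord (M.α h₁₂ h₂₃ h₃₄ A B C) =
          a + u h₂₃ h₃₄ B C + u h₁₂ (h₂₃.trans h₃₄) A ((M.μ h₂₃ h₃₄).obj₂ B C) -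
            u h₁₂ h₂₃ A B - u (h₁₂.trans h₂₃) h₃₄ ((M.μ h₁₂ h₂₃).obj₂ A B) C := by
    intro L₁ L₂ L₃ L₄ h₁₂ h₂₃ h₃₄
    let A₀ := (isGerbe_det h₁₂).base
    let B₀ := (isGerbe_det h₂₃).base
    let C₀ := (isGerbe_det h₃₄).base
    refine ⟨(isGerbe_det (h₁₂.trans (h₂₃.trans h₃₄))).coord (M.α h₁₂ h₂₃ h₃₄ A₀ B₀ C₀) -
      (u h₂₃ h₃₄ B₀ C₀ + u h₁₂ (h₂₃.trans h₃₄) A₀ ((M.μ h₂₃ h₃₄).obj₂ B₀ C₀) -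
        u h₁₂ h₂₃ A₀ B₀ - u (h₁₂.trans h₂₃) h₃₄ ((M.μ h₁₂ h₂₃).obj₂ A₀ B₀) C₀), ?_⟩
    intro A B C
    have h := congrArg (isGerbe_det (h₁₂.trans (h₂₃.trans h₃₄))).coord
      (M.α_natural h₁₂ h₂₃ h₃₄ ((isGerbe_det h₁₂).toBase A) ((isGerbe_det h₂₃).toBase B)
        ((isGerbe_det h₃₄).toBase C))
    rw [BandedGroupoid.IsGerbe.coord_comp, BandedGroupoid.IsGerbe.coord_comp, hu, hu, hu, hu] at h
    rw [← sub_eq_zero] at h ⊢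
    rw [← neg_eq_zero, ← h]
    abel
  choose a ha using @ha
  exact ⟨⟨u, hu, a, ha⟩⟩

/-- In the coordinates of the cubical diagram all `u`-terms cancel, leaving the alternating sum of
`a`. The boundary formulas for theories and for morphisms come from their axioms by the same
cancellation. -/
theorem DetMul.Coords.cocycle {M : DetMul X} (c : M.Coords) {L₁ L₂ L₃ L₄ L₅ : X.Lattice}
    (h₁₂ : L₁ ≤ L₂) (h₂₃ : L₂ ≤ L₃) (h₃₄ : L₃ ≤ L₄) (h₄₅ : L₄ ≤ L₅) :
    c.a h₂₃ h₃₄ h₄₅ - c.a (h₁₂.trans h₂₃) h₃₄ h₄₅ + c.a h₁₂ (h₂₃.trans h₃₄) h₄₅ -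
      c.a h₁₂ h₂₃ (h₃₄.trans h₄₅) + c.a h₁₂ h₂₃ h₃₄ = 0 := by
  have h := congrArg (isGerbe_det (h₁₂.trans (h₂₃.trans (h₃₄.trans h₄₅)))).coord
    (M.cube h₁₂ h₂₃ h₃₄ h₄₅ (isGerbe_det h₁₂).base (isGerbe_det h₂₃).base (isGerbe_det h₃₄).base
      (isGerbe_det h₄₅).base)
  simp only [BandedGroupoid.IsGerbe.coord_comp, c.coord_μ, c.coord_α,
    BandedGroupoid.IsGerbe.coord_id] at h
  rw [← sub_eq_zero] at h
  rw [← h]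
  abel

/-! ### Gerbel theories, morphisms and 2-morphisms as cochains -/

namespace GerbelTheory

variable {M : DetMul X}

/-- The coordinates of a gerbel theory. -/
structure Coords (c : M.Coords) (P : GerbelTheory X M) where
  p : ∀ {L₁ L₂ : X.Lattice}, L₁ ≤ L₂ → P.gerbe L₁ → TwoTate.det L₁ L₂ → Additive kˣ
  coord_φ : ∀ {L₁ L₂ : X.Lattice} (h : L₁ ≤ L₂) {A A' : P.gerbe L₁} {B B' : TwoTate.det L₁ L₂}
    (a : A ⟶ A') (b : B ⟶ B'), (P.isGerbe L₂).coord ((P.φ h).map₂ a b) =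
      (P.isGerbe L₁).coord a + (isGerbe_det h).coord b + p h A' B' - p h A B
  t : ∀ {L₁ L₂ L₃ : X.Lattice}, L₁ ≤ L₂ → L₂ ≤ L₃ → Additive kˣ
  coord_τ : ∀ {L₁ L₂ L₃ : X.Lattice} (h₁₂ : L₁ ≤ L₂) (h₂₃ : L₂ ≤ L₃) (A : P.gerbe L₁)
    (B : TwoTate.det L₁ L₂) (C : TwoTate.det L₂ L₃),
    (P.isGerbe L₃).coord (P.τ h₁₂ h₂₃ A B C) =
      t h₁₂ h₂₃ + c.u h₁₂ h₂₃ B C + p (h₁₂.trans h₂₃) A ((M.μ h₁₂ h₂₃).obj₂ B C) -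
        p h₁₂ A B - p h₂₃ ((P.φ h₁₂).obj₂ A B) C

theorem nonempty_coords (c : M.Coords) (P : GerbelTheory X M) : Nonempty (P.Coords c) := by
  choose p hp using fun {L₁ L₂ : X.Lattice} (h : L₁ ≤ L₂) =>
    (P.φ h).exists_coord_map₂ (P.isGerbe L₁) (isGerbe_det h) (P.isGerbe L₂)
  have ht : ∀ {L₁ L₂ L₃ : X.Lattice} (h₁₂ : L₁ ≤ L₂) (h₂₃ : L₂ ≤ L₃),
      ∃ t : Additive kˣ, ∀ (A : P.gerbe L₁) (B : TwoTate.det L₁ L₂) (C : TwoTate.det L₂ L₃),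
        (P.isGerbe L₃).coord (P.τ h₁₂ h₂₃ A B C) =
          t + c.u h₁₂ h₂₃ B C + p (h₁₂.trans h₂₃) A ((M.μ h₁₂ h₂₃).obj₂ B C) -
            p h₁₂ A B - p h₂₃ ((P.φ h₁₂).obj₂ A B) C := by
    intro L₁ L₂ L₃ h₁₂ h₂₃
    let A₀ := (P.isGerbe L₁).base
    let B₀ := (isGerbe_det h₁₂).base
    let C₀ := (isGerbe_det h₂₃).base
    refine ⟨(P.isGerbe L₃).coord (P.τ h₁₂ h₂₃ A₀ B₀ C₀) -
      (c.u h₁₂ h₂₃ B₀ C₀ + p (h₁₂.trans h₂₃) A₀ ((M.μ h₁₂ h₂₃).obj₂ B₀ C₀) -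
        p h₁₂ A₀ B₀ - p h₂₃ ((P.φ h₁₂).obj₂ A₀ B₀) C₀), ?_⟩
    intro A B C
    have h := congrArg (P.isGerbe L₃).coord
      (P.τ_natural h₁₂ h₂₃ ((P.isGerbe L₁).toBase A) ((isGerbe_det h₁₂).toBase B)
        ((isGerbe_det h₂₃).toBase C))
    rw [BandedGroupoid.IsGerbe.coord_comp, BandedGroupoid.IsGerbe.coord_comp, hp, hp, hp,
      c.coord_μ] at h
    rw [← sub_eq_zero] at h ⊢
    rw [← neg_eq_zero, ← h]
    abel
  choose t ht using @ht
  exact ⟨⟨p, hp, t, ht⟩⟩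

theorem Coords.boundary {c : M.Coords} {P : GerbelTheory X M} (x : P.Coords c)
    {L₁ L₂ L₃ L₄ : X.Lattice} (h₁₂ : L₁ ≤ L₂) (h₂₃ : L₂ ≤ L₃) (h₃₄ : L₃ ≤ L₄) :
    x.t h₂₃ h₃₄ - x.t (h₁₂.trans h₂₃) h₃₄ + x.t h₁₂ (h₂₃.trans h₃₄) - x.t h₁₂ h₂₃ =
      c.a h₁₂ h₂₃ h₃₄ := by
  have h := congrArg (P.isGerbe L₄).coord
    (P.cube h₁₂ h₂₃ h₃₄ (P.isGerbe L₁).base (isGerbe_det h₁₂).base (isGerbe_det h₂₃).base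
      (isGerbe_det h₃₄).base)
  simp only [BandedGroupoid.IsGerbe.coord_comp, x.coord_φ, x.coord_τ, c.coord_α,
    BandedGroupoid.IsGerbe.coord_id] at h
  rw [← sub_eq_zero] at h ⊢
  rw [← neg_eq_zero, ← h]
  abel

/-- Gerbel theories exist. -/
theorem nonempty (M : DetMul X) : Nonempty (GerbelTheory X M) := by
  obtain ⟨c⟩ := M.nonempty_coords
  obtain ⟨t, ht⟩ := exists_coboundary₃ (fun {_ _ _ _} h₁₂ h₂₃ h₃₄ => c.a h₁₂ h₂₃ h₃₄)
    (fun h₁₂ h₂₃ h₃₄ h₄₅ => c.cocycle h₁₂ h₂₃ h₃₄ h₄₅)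
  have hD : ∀ L : X.Lattice, (TwoTate.det L L).IsGerbe := fun L => isGerbe_det le_rfl
  exact ⟨{
    -- Any gerbe would do here; the content is in `τ`.
    gerbe := fun L => TwoTate.det L L
    isGerbe := hD
    φ := fun {L₁ L₂} h => (hD L₁).constFunctor₂ (isGerbe_det h) (hD L₂).base
    φ_equiv := fun {L₁ L₂} h => BandedFunctor.isEquivalence
      (isGerbe_tensor (hD L₁) (isGerbe_det h)) (hD L₂) _
    τ := fun {L₁ L₂ L₃} h₁₂ h₂₃ A B C =>
      -- The functors `φ` add coordinates exactly, so their correction terms `p` vanish; the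
      -- `u`-term compensates for that of `μ`, and the cube reduces to the equation for `t`.
      (hD L₃).ofCoord _ _ (t h₁₂ h₂₃ + c.u h₁₂ h₂₃ B C)
    τ_natural := fun {L₁ L₂ L₃} h₁₂ h₂₃ => fun a b b' => by
      apply (hD L₃).coord_injective
      simp only [BandedGroupoid.IsGerbe.coord_comp, BandedGroupoid.IsGerbe.coord_ofCoord,
        BandedGroupoid.IsGerbe.coord_constFunctor₂_map₂, c.coord_μ]
      abel
    cube := fun {L₁ L₂ L₃ L₄} h₁₂ h₂₃ h₃₄ A B C D => by
      apply (hD L₄).coord_injective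
      simp only [BandedGroupoid.IsGerbe.coord_comp, BandedGroupoid.IsGerbe.coord_ofCoord,
        BandedGroupoid.IsGerbe.coord_constFunctor₂_map₂, BandedGroupoid.IsGerbe.coord_id,
        c.coord_α, ht]
      abel }⟩

/-- The coordinates of a morphism of gerbel theories. -/
structure Hom.Coords {c : M.Coords} {P Q : GerbelTheory X M} (x : P.Coords c) (y : Q.Coords c)
    (F : Hom P Q) where
  v : ∀ L, P.gerbe L → Additive kˣ
  coord_f : ∀ L {A A' : P.gerbe L} (a : A ⟶ A'),
    (Q.isGerbe L).coord ((F.f L).functor.map a) = (P.isGerbe L).coord a + v L A' - v L A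
  s : ∀ {L₁ L₂ : X.Lattice}, L₁ ≤ L₂ → Additive kˣ
  coord_σ : ∀ {L₁ L₂ : X.Lattice} (h : L₁ ≤ L₂) (A : P.gerbe L₁) (B : TwoTate.det L₁ L₂),
    (Q.isGerbe L₂).coord (F.σ h A B) = s h + x.p h A B + v L₂ ((P.φ h).obj₂ A B) - v L₁ A -
      y.p h ((F.f L₁).functor.obj A) B

theorem Hom.nonempty_coords {c : M.Coords} {P Q : GerbelTheory X M} (x : P.Coords c)
    (y : Q.Coords c) (F : Hom P Q) : Nonempty (F.Coords x y) := by
  choose v hv using fun L => (F.f L).exists_coord_map (P.isGerbe L) (Q.isGerbe L)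
  have hs : ∀ {L₁ L₂ : X.Lattice} (h : L₁ ≤ L₂), ∃ s : Additive kˣ,
      ∀ (A : P.gerbe L₁) (B : TwoTate.det L₁ L₂), (Q.isGerbe L₂).coord (F.σ h A B) =
        s + x.p h A B + v L₂ ((P.φ h).obj₂ A B) - v L₁ A -
          y.p h ((F.f L₁).functor.obj A) B := by
    intro L₁ L₂ h₁₂
    let A₀ := (P.isGerbe L₁).base
    let B₀ := (isGerbe_det h₁₂).base
    refine ⟨(Q.isGerbe L₂).coord (F.σ h₁₂ A₀ B₀) -
      (x.p h₁₂ A₀ B₀ + v L₂ ((P.φ h₁₂).obj₂ A₀ B₀) - v L₁ A₀ -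
          y.p h₁₂ ((F.f L₁).functor.obj A₀) B₀), ?_⟩
    intro A B
    have h := congrArg (Q.isGerbe L₂).coord
      (F.σ_natural h₁₂ ((P.isGerbe L₁).toBase A) ((isGerbe_det h₁₂).toBase B))
    rw [BandedGroupoid.IsGerbe.coord_comp, BandedGroupoid.IsGerbe.coord_comp, y.coord_φ, hv, hv,
      x.coord_φ] at h
    rw [← sub_eq_zero] at h ⊢
    rw [← neg_eq_zero, ← h]
    abel
  choose s hs using @hs
  exact ⟨⟨v, hv, s, hs⟩⟩

theorem Hom.Coords.boundary {c : M.Coords} {P Q : GerbelTheory X M} {x : P.Coords c}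
    {y : Q.Coords c} {F : Hom P Q} (z : F.Coords x y) {L₁ L₂ L₃ : X.Lattice} (h₁₂ : L₁ ≤ L₂)
    (h₂₃ : L₂ ≤ L₃) :
    z.s h₂₃ - z.s (h₁₂.trans h₂₃) + z.s h₁₂ = y.t h₁₂ h₂₃ - x.t h₁₂ h₂₃ := by
  have h := congrArg (Q.isGerbe L₃).coord
    (F.compat h₁₂ h₂₃ (P.isGerbe L₁).base (isGerbe_det h₁₂).base (isGerbe_det h₂₃).base)
  simp only [BandedGroupoid.IsGerbe.coord_comp, x.coord_τ, y.coord_φ, y.coord_τ, z.coord_f,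
    z.coord_σ, BandedGroupoid.IsGerbe.coord_id] at h
  rw [← sub_eq_zero] at h ⊢
  rw [← h]
  abel

/-- There is a morphism between any two gerbel theories. -/
theorem nonempty_hom (P Q : GerbelTheory X M) : Nonempty (Hom P Q) := by
  obtain ⟨c⟩ := M.nonempty_coords
  obtain ⟨x⟩ := P.nonempty_coords c
  obtain ⟨y⟩ := Q.nonempty_coords c
  obtain ⟨s, hs⟩ := exists_coboundary₂ (fun {_ _ _} h₁₂ h₂₃ => y.t h₁₂ h₂₃ - x.t h₁₂ h₂₃)
    (fun h₁₂ h₂₃ h₃₄ => by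
      have := (y.boundary h₁₂ h₂₃ h₃₄).trans (x.boundary h₁₂ h₂₃ h₃₄).symm
      rw [← sub_eq_zero] at this
      rw [← this]
      abel)
  exact ⟨{
    f := fun L => (P.isGerbe L).constFunctor (Q.isGerbe L).base
    σ := fun {L₁ L₂} h A B => (Q.isGerbe L₂).ofCoord _ _
      -- This is the general shape of the coordinate of `σ` with `v = 0`, since the constant
      -- functors preserve coordinates.
      (s h + x.p h A B - y.p h (((P.isGerbe L₁).constFunctor (Q.isGerbe L₁).base).functor.obj A) B)
    σ_natural := fun {L₁ L₂} h => fun a b => by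
      apply (Q.isGerbe L₂).coord_injective
      simp only [BandedGroupoid.IsGerbe.coord_comp, BandedGroupoid.IsGerbe.coord_ofCoord,
        BandedGroupoid.IsGerbe.coord_constFunctor_map, x.coord_φ, y.coord_φ]
      abel
    compat := fun {L₁ L₂ L₃} h₁₂ h₂₃ A B C => by
      apply (Q.isGerbe L₃).coord_injective
      simp only [BandedGroupoid.IsGerbe.coord_comp, BandedGroupoid.IsGerbe.coord_ofCoord,
        BandedGroupoid.IsGerbe.coord_constFunctor_map, BandedGroupoid.IsGerbe.coord_id, x.coord_τ,
        y.coord_φ, y.coord_τ, add_zero]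
      have := hs h₁₂ h₂₃
      rw [← sub_eq_zero] at this ⊢
      rw [← neg_eq_zero, ← this]
      abel }⟩

/-- There is a 2-morphism between any two parallel morphisms of gerbel theories. -/
theorem nonempty_hom₂ {P Q : GerbelTheory X M} (F G : Hom P Q) : Nonempty (Hom₂ F G) := by
  obtain ⟨c⟩ := M.nonempty_coords
  obtain ⟨x⟩ := P.nonempty_coords c
  obtain ⟨y⟩ := Q.nonempty_coords c
  obtain ⟨z⟩ := F.nonempty_coords x y
  obtain ⟨w⟩ := G.nonempty_coords x y
  -- Both cochains have coboundary `y.t - x.t`, so their difference is a 1-cocycle. The `v`-terms in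
  -- `θ` below account for naturality.
  obtain ⟨e, he⟩ := exists_coboundary₁ (fun {_ _} h => w.s h - z.s h)
    (fun h₁₂ h₂₃ => by
      have := (w.boundary h₁₂ h₂₃).trans (z.boundary h₁₂ h₂₃).symm
      rw [← sub_eq_zero] at this
      rw [← this]
      abel)
  exact ⟨{
    θ := fun L A => (Q.isGerbe L).ofCoord _ _ (e L + w.v L A - z.v L A)
    natural := fun L {A A'} a => by
      apply (Q.isGerbe L).coord_injective
      simp only [BandedGroupoid.IsGerbe.coord_comp, BandedGroupoid.IsGerbe.coord_ofCoord,
        z.coord_f, w.coord_f]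
      abel
    compat := fun {L₁ L₂} h A B => by
      apply (Q.isGerbe L₂).coord_injective
      simp only [BandedGroupoid.IsGerbe.coord_comp, BandedGroupoid.IsGerbe.coord_ofCoord,
        y.coord_φ, z.coord_σ, w.coord_σ, BandedGroupoid.IsGerbe.coord_id, add_zero]
      have := he h
      rw [← sub_eq_zero] at this ⊢
      rw [← this]
      abel }⟩

/-- 2-morphisms of gerbel theories are invertible. -/
def Hom₂.inv {P Q : GerbelTheory X M} {F G : Hom P Q} (a : Hom₂ F G) : Hom₂ G F where
  θ L A := Groupoid.inv (a.θ L A)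
  natural L {A A'} x := by
    rw [← cancel_epi (a.θ L A), ← cancel_mono (a.θ L A')]
    simp [← a.natural]
  compat {L₁ L₂} h A B := by
    have e : (Q.φ h).map₂ (a.θ L₁ A) (𝟙 B) ≫ (Q.φ h).map₂ (Groupoid.inv (a.θ L₁ A)) (𝟙 B) =
        𝟙 _ := by
      rw [← BandedFunctor.map₂_comp_id, Groupoid.comp_inv, BandedFunctor.map₂_id]
    rw [← cancel_epi ((Q.φ h).map₂ (a.θ L₁ A) (𝟙 B)),
      ← cancel_mono (a.θ L₂ ((P.φ h).obj₂ A B)), reassoc_of% e, ← Category.assoc, a.compat]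
    simp

theorem isIso_hom₂ {P Q : GerbelTheory X M} {F G : Hom P Q} (a : F ⟶ G) : IsIso a :=
  ⟨Hom₂.inv a, Hom₂.ext (funext fun _ => funext fun _ => Groupoid.comp_inv _),
    Hom₂.ext (funext fun _ => funext fun _ => Groupoid.inv_comp _)⟩

/-- The 2-automorphism of a morphism of gerbel theories given by a scalar. -/
def Hom.sc {P Q : GerbelTheory X M} (F : Hom P Q) (c : kˣ) : Hom₂ F F where
  θ L A := (Q.gerbe L).sc _ c
  natural L {A A'} a := ((Q.gerbe L).sc_comm _ c).symm
  compat {L₁ L₂} h A B := by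
    rw [← (Q.gerbe L₂).sc_comm]
    congr 1
    exact (Q.φ h).map_sc (tobj _ _) c

/-- The automorphism group of a morphism of gerbel theories. -/
theorem Hom.exists_sc {P Q : GerbelTheory X M} (F : Hom P Q) (a : Hom₂ F F) :
    ∃ c : kˣ, a = F.sc c := by
  choose e he using fun L => ((Q.isGerbe L).band ((F.f L).functor.obj (P.isGerbe L).base)).2
    (a.θ L (P.isGerbe L).base)
  -- Naturality makes the scalar independent of the object; compatibility with `σ` then makes it
  -- constant along inclusions of lattices, hence on the whole codirected set.
  have h₁ : ∀ L A, a.θ L A = (Q.gerbe L).sc _ (e L) := fun L A => by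
    have := a.natural L ((P.isGerbe L).toBase A)
    rw [← he, ← (Q.gerbe L).sc_comm] at this
    exact ((cancel_mono _).1 this).symm
  have h₂ : ∀ {L₁ L₂ : X.Lattice}, L₁ ≤ L₂ → e L₁ = e L₂ := fun {L₁ L₂} h => by
    have := a.compat h (P.isGerbe L₁).base (isGerbe_det h).base
    rw [h₁, h₁, ← (Q.gerbe L₂).sc_comm, cancel_mono] at this
    refine (Q.isGerbe L₂).sc_injective _ (Eq.trans ?_ this)
    exact ((Q.φ h).map_sc (tobj _ _) _).symm
  let L₀ : X.Lattice := Classical.arbitrary _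
  refine ⟨e L₀, Hom₂.ext (funext fun L => funext fun A => ?_)⟩
  obtain ⟨L', h, h'⟩ := exists_le_le L L₀
  rw [h₁, ← h₂ h, h₂ h']
  rfl

/-- The scalar 2-automorphisms of a morphism of gerbel theories as isomorphisms. -/
def Hom.scAut {P Q : GerbelTheory X M} (F : Hom P Q) (c : kˣ) : Aut F :=
  isoOfId (F.sc c) (F.sc c⁻¹)
    (fun L A => by
      change (Q.gerbe L).sc _ c ≫ (Q.gerbe L).sc _ c⁻¹ = 𝟙 _
      rw [← (Q.gerbe L).sc_mul, mul_inv_cancel, (Q.gerbe L).sc_one])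
    (fun L A => by
      change (Q.gerbe L).sc _ c⁻¹ ≫ (Q.gerbe L).sc _ c = 𝟙 _
      rw [← (Q.gerbe L).sc_mul, inv_mul_cancel, (Q.gerbe L).sc_one])

/-- The identification of the automorphism group of a morphism of gerbel theories with `kˣ`. -/
def Hom.band {P Q : GerbelTheory X M} (F : Hom P Q) : kˣ ≃* Aut F :=
  MulEquiv.ofBijective
    (MonoidHom.mk' F.scAut
      (fun c d => Iso.ext (Hom₂.ext (funext fun L => funext fun A => by
        change (Q.gerbe L).sc _ (c * d) = (Q.gerbe L).sc _ d ≫ (Q.gerbe L).sc _ c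
        rw [← (Q.gerbe L).sc_mul, mul_comm]))))
    ⟨fun c d h => by
      let L₀ : X.Lattice := Classical.arbitrary _
      have : (F.sc c).θ L₀ (P.isGerbe L₀).base = (F.sc d).θ L₀ (P.isGerbe L₀).base :=
        congrArg (fun a : Aut F => Hom₂.θ a.hom L₀ (P.isGerbe L₀).base) h
      exact (Q.isGerbe L₀).sc_injective _ this,
    fun a => by
      obtain ⟨c, hc⟩ := F.exists_sc a.hom
      exact ⟨c, Iso.ext hc.symm⟩⟩

/-- Gerbel theories form a 2-gerbe. -/
theorem isTwoGerbe (M : DetMul X) : IsTwoGerbe kˣ (GerbelTheory X M) where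
  nonempty := nonempty M
  isIso η := isIso_hom₂ η
  invertible {P Q} F := by
    -- Any morphism backwards is an inverse, because parallel morphisms are always isomorphic.
    obtain ⟨G⟩ := nonempty_hom Q P
    have h : ∀ {P Q : GerbelTheory X M} (F G : P ⟶ Q), Nonempty (F ≅ G) := fun F G => by
      obtain ⟨η⟩ := nonempty_hom₂ F G
      have := isIso_hom₂ (F := F) (G := G) η
      exact ⟨asIso (X := F) (Y := G) η⟩
    exact ⟨G, h _ _, h _ _⟩
  connected P Q := nonempty_hom P Q
  locally_connected F G := nonempty_hom₂ F G
  band := ⟨fun F => Hom.band F,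
    fun {P Q} {F G} (η : Hom₂ F G) c => Hom₂.ext (funext fun L => funext fun A =>
      (Q.gerbe L).sc_comm (η.θ L A) c),
    fun _ _ _ => rfl,
    fun {P Q R} (F : Hom P Q) (G : Hom Q R) c => Hom₂.ext (funext fun L => funext fun A => (G.f L).map_sc _ c)⟩

end GerbelTheory

end TwoGerbe

end Gerbel

end

/-- For every 2-Tate space `X` the determinant gerbes of the quotients of lattices of `X` carry a
coherent multiplicative structure, and for every such structure the gerbel theories on `X` form a
2-gerbe with band `𝔾ₘ`. -/
theorem mainTheorem2 {k : Type u} [Field k] (X : Gerbel.TwoTate k) :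
    Nonempty (Gerbel.DetMul X) ∧
      ∀ M : Gerbel.DetMul X, Gerbel.IsTwoGerbe kˣ (Gerbel.GerbelTheory X M) :=
  ⟨Gerbel.nonempty_detMul X, Gerbel.GerbelTheory.isTwoGerbe⟩
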